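/- Conventions. Let $d\ge 1$. For an integrable function $f$ on $\mathbb{R}^d$ put $\widehat f(\xi)=\int_{\mathbb{R}^d} f(x)e^{-ix\cdot\xi}\,dx$, and for a finitely supported filter $u:\mathbb{Z}^d\to\mathbb{C}$ (written $u\in l_0(\mathbb{Z}^d)$) put $\widehat u(\xi)=\sum_{k\in\mathbb{Z}^d}u(k)e^{-ik\cdot\xi}$. Let $u^\star(k)=\overline{u(-k)}$ and $(v*u)(n)=\sum_k v(k)u(n-k)$. A $d\times d$ dilation matrix $M$ is an integer matrix all of whose eigenvalues are greater than one in modulus; put $\Omega_M=(M^{-T}\mathbb{Z}^d)\cap[0,1)^d$, $\delta(0)=1$, and $\delta(\omega)=0$ for $\omega\neq 0$. A filter $a\in l_0(\mathbb{Z}^d)$ has order $m$ sum rules with respect to $M$ with matching filter $v\in l_0(\mathbb{Z}^d)$ if $\widehat v(0)\neq0$ and, for every $\omega\in\Omega_M$, $$\widehat v(M^T\xi)\,\widehat a(\xi+2\pi\omega)=\delta(\omega)\widehat v(\xi)+O(\|\xi\|^m),\qquad \xi\to0 .$$ For $\psi=(\psi_1,\dots,\psi_s)^T$ with compactly supported entries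 in $L^2(\mathbb{R}^d)$, $\mathrm{vmo}(\psi)$ is the largest integer $m$ such that $\int p(x)\psi_\ell(x)\,dx=0$ for all $\ell$ and all polynomials $p$ of degree at most $m-1$. With $\psi_{\ell;j,k}=|\det M|^{j/2}\psi_\ell(M^j\cdot-k)$, the pair $\{\eta;\psi\}$ in $L^2(\mathbb{R}^d)$ is an $M$-framelet if there are $C_1,C_2>0$ such that for all $f\in L^2(\mathbb{R}^d)$ $$C_1\|f\|^2\le\sum_{k\in\mathbb{Z}^d}|\langle f,\eta(\cdot-k)\rangle|^2+\sum_{j=0}^\infty\sum_{k\in\mathbb{Z}^d}\sum_{\ell=1}^s|\langle f,\psi_{\ell;j,k}\rangle|^2\le C_2\|f\|^2 ,$$ and $(\{\eta;\psi\},\{\tilde\eta;\tilde\psi\})$ is a dual $M$-framelet in $L^2(\mathbb{R}^d)$ if both pairs are $M$-framelets and, for all $f\in L^2(\mathbb{R}^d)$, with unconditional convergence in $L^2(\mathbb{R}^d)$, $$f=\sum_{k\in\mathbb{Z}^d}\langle f,\eta(\cdot-k)\rangle\,\tilde\eta(\cdot-k)+\sum_{j=0}^\infty\sum_{k\in\mathbb{Z}^d}\sum_{\ell=1}^s\langle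 f,\psi_{\ell;j,k}\rangle\,\tilde\psi_{\ell;j,k} .$$ Corollary 3.3. Let $M$ be a $d\times d$ dilation matrix and let $\phi,\tilde\phi\in L^2(\mathbb{R}^d)$ be compactly supported functions with $\widehat\phi(M^T\xi)=\widehat a(\xi)\widehat\phi(\xi)$ and $\widehat{\tilde\phi}(M^T\xi)=\widehat{\tilde a}(\xi)\widehat{\tilde\phi}(\xi)$ for all $\xi\in\mathbb{R}^d$, where $a,\tilde a\in l_0(\mathbb{Z}^d)$ have sum rules of orders $\tilde m\ge1$ and $m\ge1$ with respect to $M$, with matching filters $v,\tilde v\in l_0(\mathbb{Z}^d)$ respectively. Suppose that $\widehat v(0)\widehat\phi(0)=\widehat{\tilde v}(0)\widehat{\tilde\phi}(0)=1$. Then there exist $s\in\mathbb{N}$, $s\times1$ vectors $b,\tilde b$ of filters in $l_0(\mathbb{Z}^d)$, and $\theta,\tilde\theta\in l_0(\mathbb{Z}^d)$ such that: (1) $(\{a;b\},\{\tilde a;\tilde b\})_{\Theta}$ with $\Theta=\theta^\star*\tilde\theta$ is an OEP-based dual $M$-framelet filter bank, i.e. for all $\xi\in\mathbb{R}^d$ and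 $\omega\in\Omega_M$, $$\overline{\widehat a(\xi)}\,\widehat\Theta(M^T\xi)\,\widehat{\tilde a}(\xi+2\pi\omega)+\overline{\widehat b(\xi)}^{T}\,\widehat{\tilde b}(\xi+2\pi\omega)=\delta(\omega)\widehat\Theta(\xi);$$ (2) there are compactly supported $\eta,\tilde\eta\in L^2(\mathbb{R}^d)$ and $\psi,\tilde\psi\in(L^2(\mathbb{R}^d))^{s}$ given by $$\widehat\eta(\xi)=\widehat\theta(\xi)\widehat\phi(\xi),\quad \widehat\psi(\xi)=\widehat b(M^{-T}\xi)\widehat\phi(M^{-T}\xi),\quad \widehat{\tilde\eta}(\xi)=\widehat{\tilde\theta}(\xi)\widehat{\tilde\phi}(\xi),\quad \widehat{\tilde\psi}(\xi)=\widehat{\tilde b}(M^{-T}\xi)\widehat{\tilde\phi}(M^{-T}\xi),$$ such that $(\{\eta;\psi\},\{\tilde\eta;\tilde\psi\})$ is a dual $M$-framelet in $L^2(\mathbb{R}^d)$, with $\mathrm{vmo}(\psi)=m$ and $\mathrm{vmo}(\tilde\psi)=\tilde m$. -/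

import Mathlib

open scoped ComplexConjugate Matrix Topology ENNReal
open MeasureTheory Filter Asymptotics

noncomputable section

namespace OEPFramelet

/-- The space `ℝ^d`, with the Euclidean norm and Lebesgue measure. -/
abbrev RSpace (d : ℕ) : Type := EuclideanSpace ℝ (Fin d)

/-- The lattice `ℤ^d`. -/
abbrev IntLattice (d : ℕ) : Type := Fin d → ℤ

/-- A lattice point, viewed as a point of `ℝ^d`. -/
def latticeVec {d : ℕ} (k : IntLattice d) : RSpace d := WithLp.toLp 2 (fun i => (k i : ℝ))

/-- The action of an integer matrix on `ℝ^d`. -/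
def act {d : ℕ} (A : Matrix (Fin d) (Fin d) ℤ) (x : RSpace d) : RSpace d :=
  WithLp.toLp 2 (A.map (Int.cast : ℤ → ℝ) *ᵥ WithLp.ofLp x)

/-- `M^{-T} ξ`, the action of the inverse of the transpose of an integer matrix on `ℝ^d`. -/
def actInvTranspose {d : ℕ} (M : Matrix (Fin d) (Fin d) ℤ) (ξ : RSpace d) : RSpace d :=
  WithLp.toLp 2 (((M.map (Int.cast : ℤ → ℝ))ᵀ)⁻¹ *ᵥ WithLp.ofLp ξ)

/-- A dilation matrix: an integer matrix all of whose (complex) eigenvalues are greater than one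
in modulus. -/
def IsDilation {d : ℕ} (M : Matrix (Fin d) (Fin d) ℤ) : Prop :=
  ∀ z ∈ spectrum ℂ (M.map (Int.cast : ℤ → ℂ)), 1 < ‖z‖

/-- `Ω_M = (M^{-T} ℤ^d) ∩ [0,1)^d`. -/
def Omega {d : ℕ} (M : Matrix (Fin d) (Fin d) ℤ) : Set (RSpace d) :=
  {ω | (∃ k : IntLattice d, act Mᵀ ω = latticeVec k) ∧ ∀ i, 0 ≤ ω i ∧ ω i < 1}

/-- Scalar finitely supported filters (masks) `u : ℤ^d → ℂ`. -/
abbrev Mask (d : ℕ) : Type := IntLattice d →₀ ℂ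

/-- The Fourier series `∑ k, u(k) e^{-i k·ξ}` of a finitely supported filter. -/
def maskHat {d : ℕ} (u : Mask d) (ξ : RSpace d) : ℂ :=
  u.sum fun k c => c * Complex.exp (-(Complex.I * ((inner ℝ (latticeVec k) ξ : ℝ) : ℂ)))

/-- The adjoint filter `u^⋆(k) = conj (u(-k))`. -/
def maskStar {d : ℕ} (u : Mask d) : Mask d :=
  u.sum fun k c => Finsupp.single (-k) (conj c)

/-- The convolution `(v * u)(n) = ∑ k, v(k) u(n-k)` of finitely supported filters. -/
def maskConv {d : ℕ} (v u : Mask d) : Mask d :=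
  v.sum fun k c => u.sum fun l e => Finsupp.single (k + l) (c * e)

/-- The Fourier transform `∫ f(x) e^{-i x·ξ} dx`; it is only used for compactly supported
`L²` functions, which are integrable. -/
def fnHat {d : ℕ} (f : RSpace d → ℂ) (ξ : RSpace d) : ℂ :=
  ∫ x, f x * Complex.exp (-(Complex.I * ((inner ℝ x ξ : ℝ) : ℂ)))

/-- The filter `a` has order `m` sum rules with respect to `M` with the matching filter `v`:
`v̂(0) ≠ 0` and `v̂(Mᵀξ) â(ξ + 2πω) = δ(ω) v̂(ξ) + O(‖ξ‖^m)` as `ξ → 0`, for all `ω ∈ Ω_M`. -/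
def HasSumRules {d : ℕ} (M : Matrix (Fin d) (Fin d) ℤ) (a : Mask d) (m : ℕ) (v : Mask d) :
    Prop :=
  maskHat v 0 ≠ 0 ∧
    ∀ ω ∈ Omega M,
      (fun ξ : RSpace d => maskHat v (act Mᵀ ξ) * maskHat a (ξ + (2 * Real.pi) • ω)
          - (open Classical in if ω = 0 then (1 : ℂ) else 0) * maskHat v ξ)
        =O[𝓝 0] fun ξ => ‖ξ‖ ^ m

/-- `({a;b},{a';b'})_Θ` is an OEP-based dual `M`-framelet filter bank, for scalar low-pass filters
`a, a', Θ` and `s × 1` high-pass filters `b, b'`. -/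
def IsDualFrameletFilterBank {d s : ℕ} (M : Matrix (Fin d) (Fin d) ℤ)
    (a : Mask d) (b : Fin s → Mask d) (a' : Mask d) (b' : Fin s → Mask d) (Θ : Mask d) : Prop :=
  ∀ ξ : RSpace d, ∀ ω ∈ Omega M,
    conj (maskHat a ξ) * maskHat Θ (act Mᵀ ξ) * maskHat a' (ξ + (2 * Real.pi) • ω)
        + ∑ l, conj (maskHat (b l) ξ) * maskHat (b' l) (ξ + (2 * Real.pi) • ω)
      = (open Classical in if ω = 0 then (1 : ℂ) else 0) * maskHat Θ ξ

/-- The pairing `⟨f, g⟩ = ∫ f(x) conj(g(x)) dx`. -/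
def pairing {d : ℕ} (f g : RSpace d → ℂ) : ℂ := ∫ x, f x * conj (g x)

/-- Indices of the elements of the framelet system: `η(· - k)` is indexed by `k`, and the `l`-th
component of `ψ_{M^j;k}` by `(j, k, l)`. -/
abbrev SystemIndex (d s : ℕ) : Type := IntLattice d ⊕ (ℕ × IntLattice d × Fin s)

/-- The elements of the framelet system generated by `{η; ψ}`: the functions `η(· - k)` and
`|det M|^{j/2} ψ_l(M^j · - k)` for `j ≥ 0`. -/
def frameletSystem {d s : ℕ} (M : Matrix (Fin d) (Fin d) ℤ) (η : RSpace d → ℂ)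
    (ψ : Fin s → RSpace d → ℂ) : SystemIndex d s → RSpace d → ℂ
  | Sum.inl k => fun x => η (x - latticeVec k)
  | Sum.inr (j, k, l) => fun x =>
      (((M.det.natAbs : ℝ) ^ ((j : ℝ) / 2) : ℝ) : ℂ) * ψ l (act (M ^ j) x - latticeVec k)

/-- `{η; ψ}` is an `M`-framelet in `L²(ℝ^d)`. The sums of squares are taken in `[0, ∞]`. -/
def IsFramelet {d s : ℕ} (M : Matrix (Fin d) (Fin d) ℤ) (η : RSpace d → ℂ)
    (ψ : Fin s → RSpace d → ℂ) : Prop :=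
  MemLp η 2 volume ∧ (∀ l, MemLp (ψ l) 2 volume) ∧
    ∃ C₁ C₂ : ℝ, 0 < C₁ ∧ 0 < C₂ ∧ ∀ f : RSpace d → ℂ, MemLp f 2 volume →
      ENNReal.ofReal C₁ * eLpNorm f 2 volume ^ 2
          ≤ ∑' i, ‖pairing f (frameletSystem M η ψ i)‖ₑ ^ 2 ∧
        ∑' i, ‖pairing f (frameletSystem M η ψ i)‖ₑ ^ 2
          ≤ ENNReal.ofReal C₂ * eLpNorm f 2 volume ^ 2

/-- `({η;ψ},{η';ψ'})` is a dual `M`-framelet in `L²(ℝ^d)`: both are `M`-framelets, and every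
`f ∈ L²` is the unconditional `L²` sum of `⟨f, g_i⟩ g'_i`, where `g`, `g'` are the two systems
(unconditional convergence is convergence along the net of finite sets of indices). -/
def IsDualFramelet {d s : ℕ} (M : Matrix (Fin d) (Fin d) ℤ)
    (η : RSpace d → ℂ) (ψ : Fin s → RSpace d → ℂ)
    (η' : RSpace d → ℂ) (ψ' : Fin s → RSpace d → ℂ) : Prop :=
  IsFramelet M η ψ ∧ IsFramelet M η' ψ' ∧
    ∀ f : RSpace d → ℂ, MemLp f 2 volume →
      Tendsto (fun F : Finset (SystemIndex d s) =>
          eLpNorm (fun x => f x - ∑ i ∈ F,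
            pairing f (frameletSystem M η ψ i) * frameletSystem M η' ψ' i x) 2 volume)
        atTop (𝓝 0)

/-- `ψ` has `m` vanishing moments: `∫ p(x) ψ(x) dx = 0` for all polynomials `p` of (total) degree
at most `m - 1`. -/
def HasVanishingMoments {d s : ℕ} (ψ : Fin s → RSpace d → ℂ) (m : ℕ) : Prop :=
  ∀ p : MvPolynomial (Fin d) ℂ, p.totalDegree < m →
    ∀ l, ∫ x : RSpace d, MvPolynomial.eval (fun i => (x i : ℂ)) p * ψ l x = 0

/-- `vmo(ψ) = m`: `m` is the largest integer such that `ψ` has `m` vanishing moments. -/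
def VmoEq {d s : ℕ} (ψ : Fin s → RSpace d → ℂ) (m : ℕ) : Prop :=
  IsGreatest {n : ℕ | HasVanishingMoments ψ n} m

/-- `η, ψ` are compactly supported functions in `L²(ℝ^d)` with `η̂(ξ) = θ̂(ξ) φ̂(ξ)` and
`ψ̂(ξ) = b̂(M^{-T}ξ) φ̂(M^{-T}ξ)`; by injectivity of the Fourier transform this determines `η` and
`ψ` almost everywhere. -/
def AreOEPGenerators {d s : ℕ} (M : Matrix (Fin d) (Fin d) ℤ) (φ : RSpace d → ℂ)
    (θ : Mask d) (b : Fin s → Mask d) (η : RSpace d → ℂ) (ψ : Fin s → RSpace d → ℂ) : Prop :=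
  MemLp η 2 volume ∧ HasCompactSupport η ∧
    (∀ l, MemLp (ψ l) 2 volume ∧ HasCompactSupport (ψ l)) ∧
    (∀ ξ, fnHat η ξ = maskHat θ ξ * fnHat φ ξ) ∧
    ∀ l ξ, fnHat (ψ l) ξ
      = maskHat (b l) (actInvTranspose M ξ) * fnHat φ (actInvTranspose M ξ)

end OEPFramelet

end

open OEPFramelet

/-!
The construction is the oblique extension principle for scalar refinable functions, with filters
treated as Laurent polynomials and `I` denoting the augmentation ideal, the Laurent polynomials that
vanish at `ξ = 0`.

*The filter bank.* The Fourier transform of a compactly supported integrable function agrees, to any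
order at the origin, with a trigonometric polynomial (`isTrigJet_fnHat`). A geometric series then
gives `θ` and `θ'` with `θ̂ φ̂ = 1 + O(‖ξ‖^(m+m'))` and the same for `φ'`
(`IsTrigJet.exists_inverse`). With these, `Θ̂(ξ) - conj â(ξ) Θ̂(Mᵀξ) â'(ξ)` is `O(‖ξ‖^(m+m'))`, and a
Laurent polynomial that is `O(‖ξ‖^n)` lies in `I ^ n` (`mem_augIdeal_pow_of_isBigO`). Since
`I ^ (m+m') = I ^ m * I ^ m'`, and the sum rules put the shifted low-pass filters in `I ^ m` and
`I ^ m'`, what is left of the filter bank identity is, for each `ω ∈ Ω_M`, a sum of products of an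
element of `I ^ m` and a shifted element of `I ^ m'`. The characters of `ℤ^d / M ℤ^d` separate the
shifts, so these products can be realized one `ω` at a time by high-pass filters `b` in `I ^ m` and
`b'` in `I ^ m'` (`exists_highpass`). Filters in `I ^ m` produce `m` vanishing moments, because
multiplication by an affine sequence maps `I ^ (n+1)` to `I ^ n`; the filter `(z_0 - 1)^m` is
adjoined, with its contribution cancelled, so that the number of vanishing moments is exactly `m`.

*The Bessel property.* The autocorrelation of a compactly supported refinable `φ ∈ L²`, sampled along
`M^{-n} q + ℤ^d`, is the orbit of a linear map in finite dimension and converges, hence converges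
geometrically. Thus `‖φ(· - M^{-n} q) - φ‖` is summable (`summable_norm_transL_sub`), which makes the
levels of the wavelet system almost orthogonal, since the coefficients of `ψ` sum to zero
(`exists_isBessel_wav`).

*Reconstruction.* The filter bank identity telescopes the scales (`tsum_inner_wav_add`), which
reduces the pairing of the two systems on continuous functions with compact support to the limit of
the sampling operators at fine scales (`tendsto_tsum_inner_wav`). That limit is the inner product,
because `θ̂(0) φ̂(0) = θ̂'(0) φ̂'(0) = 1`. Two Bessel systems that reproduce inner products on a dense
set reproduce every vector unconditionally, and satisfy lower frame bounds by duality
(`IsBessel.hasSum_of_dense`, `IsBessel.lower_bound`).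
-/

noncomputable section

namespace OEPFramelet

/-! ### Laurent polynomials -/

/-- Laurent polynomials in `d` variables: masks with the convolution product. -/
abbrev Laurent (d : ℕ) : Type := AddMonoidAlgebra ℂ (IntLattice d)

/-- The character `k ↦ e^{-i k·ξ}` of the lattice. -/
def expChar {d : ℕ} (ξ : RSpace d) : Multiplicative (IntLattice d) →* ℂ where
  toFun k := Complex.exp (-(Complex.I * ((inner ℝ (latticeVec k.toAdd) ξ : ℝ) : ℂ)))
  map_one' := by
    have : latticeVec (0 : IntLattice d) = 0 := by ext i; simp [latticeVec]
    simp [this]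
  map_mul' k l := by
    have : latticeVec (k.toAdd + l.toAdd) = latticeVec k.toAdd + latticeVec l.toAdd := by
      ext i; simp [latticeVec]
    rw [toAdd_mul, this, inner_add_left, ← Complex.exp_add]
    push_cast
    ring_nf

/-- Evaluation of a Laurent polynomial at `z = e^{-iξ}`. -/
def ev {d : ℕ} (ξ : RSpace d) : Laurent d →ₐ[ℂ] ℂ :=
  AddMonoidAlgebra.lift ℂ ℂ (IntLattice d) (expChar ξ)

lemma latticeVec_add {d : ℕ} (k l : IntLattice d) :
    latticeVec (k + l) = latticeVec k + latticeVec l := by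
  ext i; simp [latticeVec]

lemma latticeVec_neg {d : ℕ} (k : IntLattice d) : latticeVec (-k) = -latticeVec k := by
  ext i; simp [latticeVec]

lemma latticeVec_sub {d : ℕ} (k l : IntLattice d) :
    latticeVec (k - l) = latticeVec k - latticeVec l := by
  rw [sub_eq_add_neg, latticeVec_add, latticeVec_neg, sub_eq_add_neg]

@[simp] lemma latticeVec_zero {d : ℕ} : latticeVec (0 : IntLattice d) = 0 := by
  ext i; simp [latticeVec]

lemma expChar_apply {d : ℕ} (ξ : RSpace d) (k : IntLattice d) :
    expChar ξ (Multiplicative.ofAdd k)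
      = Complex.exp (-(Complex.I * ((inner ℝ (latticeVec k) ξ : ℝ) : ℂ))) := rfl

lemma expChar_add {d : ℕ} (ξ ζ : RSpace d) (k : Multiplicative (IntLattice d)) :
    expChar (ξ + ζ) k = expChar ξ k * expChar ζ k := by
  change Complex.exp _ = Complex.exp _ * Complex.exp _
  rw [inner_add_right, ← Complex.exp_add]
  push_cast
  ring_nf

lemma expChar_neg {d : ℕ} (ξ : RSpace d) (k : Multiplicative (IntLattice d)) :
    expChar (-ξ) k = conj (expChar ξ k) := by
  change Complex.exp _ = conj (Complex.exp _)
  rw [← Complex.exp_conj, inner_neg_right]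
  simp

lemma expChar_inv {d : ℕ} (ξ : RSpace d) (k : IntLattice d) :
    expChar ξ (Multiplicative.ofAdd (-k)) = conj (expChar ξ (Multiplicative.ofAdd k)) := by
  rw [← expChar_neg, expChar_apply, expChar_apply, latticeVec_neg, inner_neg_left, inner_neg_right]

lemma expChar_mul_conj {d : ℕ} (ξ : RSpace d) (k : Multiplicative (IntLattice d)) :
    expChar ξ k * conj (expChar ξ k) = 1 := by
  rw [← expChar_neg, ← expChar_add, add_neg_cancel]
  change Complex.exp _ = 1
  simp

@[simp] lemma ev_single {d : ℕ} (ξ : RSpace d) (k : IntLattice d) (c : ℂ) :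
    ev ξ (AddMonoidAlgebra.single k c) = c * expChar ξ (Multiplicative.ofAdd k) := by
  simp [ev, AddMonoidAlgebra.lift_single]

lemma maskHat_eq_ev {d : ℕ} (u : Mask d) (ξ : RSpace d) :
    maskHat u ξ = ev ξ (AddMonoidAlgebra.ofCoeff u) := by
  rw [ev, AddMonoidAlgebra.lift_apply]
  rfl

lemma inner_latticeVec {d : ℕ} (k : IntLattice d) (ξ : RSpace d) :
    inner ℝ (latticeVec k) ξ = ∑ i, (k i : ℝ) * ξ i := by
  simp [latticeVec, PiLp.inner_apply, mul_comm]

lemma expChar_injective {d : ℕ} {k l : IntLattice d}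
    (h : ∀ ξ, expChar ξ (Multiplicative.ofAdd k) = expChar ξ (Multiplicative.ofAdd l)) : k = l := by
  have h1 : ∀ ξ, expChar ξ (Multiplicative.ofAdd (k - l)) = 1 := by
    intro ξ
    rw [sub_eq_add_neg, ofAdd_add, map_mul, expChar_inv, h, expChar_mul_conj]
  ext i
  have h2 := h1 (EuclideanSpace.single i 1)
  rw [expChar_apply, Complex.exp_eq_one_iff] at h2
  obtain ⟨n, hn⟩ := h2
  rw [inner_latticeVec] at hn
  simp at hn
  -- `k i - l i` is an integer multiple of `2π`, hence zero
  have h3 : ((k i - l i : ℤ) : ℝ) = -(n * (2 * Real.pi)) := by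
    have h5 : Complex.I * (((k i - l i : ℤ) : ℝ) : ℂ)
        = Complex.I * ((-(n * (2 * Real.pi)) : ℝ) : ℂ) := by
      push_cast
      linear_combination -hn
    exact_mod_cast mul_left_cancel₀ Complex.I_ne_zero h5
  by_contra hne
  have hn0 : n ≠ 0 := by
    rintro rfl
    simp at h3
    have : ((k i - l i : ℤ) : ℝ) = 0 := by push_cast; linarith
    have : k i - l i = 0 := by exact_mod_cast this
    omega
  have h6 : Irrational (-((n : ℤ) * (2 * Real.pi)) : ℝ) := by
    have := (irrational_pi.intCast_mul (m := 2) (by norm_num)).intCast_mul hn0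
    simpa using this.neg
  rw [← h3] at h6
  exact h6.ne_int _ rfl

/-- A Laurent polynomial is determined by its trigonometric polynomial. -/
lemma ev_injective {d : ℕ} {u w : Laurent d} (h : ∀ ξ, ev ξ u = ev ξ w) : u = w := by
  have key : LinearIndependent ℂ
      (fun (k : IntLattice d) (ξ : Multiplicative (RSpace d)) =>
        expChar (Multiplicative.toAdd ξ) (Multiplicative.ofAdd k)) := by
    have h0 := linearIndependent_monoidHom (Multiplicative (RSpace d)) ℂ
    let F : IntLattice d → (Multiplicative (RSpace d) →* ℂ) := fun k =>
      { toFun := fun ξ => expChar (Multiplicative.toAdd ξ) (Multiplicative.ofAdd k)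
        map_one' := by
          change Complex.exp _ = 1
          simp
        map_mul' := fun ξ ζ => expChar_add _ _ _ }
    refine h0.comp F fun k l hkl => expChar_injective fun ξ => ?_
    exact DFunLike.congr_fun hkl (Multiplicative.ofAdd ξ)
  rw [← sub_eq_zero]
  have h1 : ∀ ξ, ev ξ (u - w) = 0 := fun ξ => by rw [map_sub, h, sub_self]
  have h2 := (linearIndependent_iff.1 key) (u - w).coeff (by
    ext ξ
    have := h1 (Multiplicative.toAdd ξ)
    rw [ev, AddMonoidAlgebra.lift_apply] at this
    rw [Finsupp.linearCombination_apply, Finsupp.sum_apply']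
    simpa [Finsupp.sum] using this)
  exact AddMonoidAlgebra.coeff_eq_zero.1 h2

/-- The adjoint `u^⋆(k) = conj (u(-k))`, as a ring homomorphism. -/
def adj {d : ℕ} : Laurent d →+* Laurent d :=
  (AddMonoidAlgebra.mapDomainRingHom ℂ (-AddMonoidHom.id (IntLattice d))).comp
    (AddMonoidAlgebra.mapRingHom (IntLattice d) (starRingEnd ℂ))

lemma adj_single {d : ℕ} (k : IntLattice d) (c : ℂ) :
    adj (AddMonoidAlgebra.single k c) = AddMonoidAlgebra.single (-k) (conj c) := by
  simp [adj]

/-- The modulation `u ↦ (k ↦ u(k) e^{-i k·ζ})`, which shifts the trigonometric polynomial by `ζ`. -/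
def modul {d : ℕ} (ζ : RSpace d) : Laurent d →ₐ[ℂ] Laurent d :=
  AddMonoidAlgebra.lift ℂ (Laurent d) (IntLattice d)
    { toFun := fun k => AddMonoidAlgebra.single k.toAdd (expChar ζ k)
      map_one' := by simp [AddMonoidAlgebra.one_def]
      map_mul' := fun k l => by simp }

lemma modul_single {d : ℕ} (ζ : RSpace d) (k : IntLattice d) (c : ℂ) :
    modul ζ (AddMonoidAlgebra.single k c)
      = AddMonoidAlgebra.single k (c * expChar ζ (Multiplicative.ofAdd k)) := by
  simp [modul, AddMonoidAlgebra.lift_single]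

/-- The action of an integer matrix on the lattice. -/
def latMap {d : ℕ} (M : Matrix (Fin d) (Fin d) ℤ) : IntLattice d →+ IntLattice d :=
  M.mulVecLin.toAddMonoidHom

/-- The substitution `u(z) ↦ u(z^M)`. -/
def up {d : ℕ} (M : Matrix (Fin d) (Fin d) ℤ) : Laurent d →ₐ[ℂ] Laurent d :=
  AddMonoidAlgebra.mapDomainAlgHom ℂ ℂ (latMap M)

lemma up_single {d : ℕ} (M : Matrix (Fin d) (Fin d) ℤ) (k : IntLattice d) (c : ℂ) :
    up M (AddMonoidAlgebra.single k c) = AddMonoidAlgebra.single (latMap M k) c := by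
  simp [up]

lemma latticeVec_latMap {d : ℕ} (M : Matrix (Fin d) (Fin d) ℤ) (k : IntLattice d) :
    latticeVec (latMap M k) = act M (latticeVec k) := by
  ext i
  simp [latticeVec, latMap, act, Matrix.mulVec, dotProduct]

lemma inner_act_left {d : ℕ} (M : Matrix (Fin d) (Fin d) ℤ) (x y : RSpace d) :
    inner ℝ (act M x) y = inner ℝ x (act Mᵀ y) := by
  simp only [PiLp.inner_apply, act, Matrix.mulVec, dotProduct, Matrix.map_apply,
    Matrix.transpose_apply, RCLike.inner_apply, conj_trivial, Finset.mul_sum, Finset.sum_mul]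
  rw [Finset.sum_comm]
  exact Finset.sum_congr rfl fun i _ => Finset.sum_congr rfl fun j _ => by ring

lemma ev_up {d : ℕ} (M : Matrix (Fin d) (Fin d) ℤ) (ξ : RSpace d) (u : Laurent d) :
    ev ξ (up M u) = ev (act Mᵀ ξ) u := by
  induction u using AddMonoidAlgebra.induction_linear with
  | zero => simp
  | add u w hu hw => simp [hu, hw]
  | single k c =>
    rw [up_single, ev_single, ev_single, expChar_apply, expChar_apply, latticeVec_latMap,
      inner_act_left]

lemma ev_modul {d : ℕ} (ξ ζ : RSpace d) (u : Laurent d) :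
    ev ξ (modul ζ u) = ev (ξ + ζ) u := by
  induction u using AddMonoidAlgebra.induction_linear with
  | zero => simp
  | add u w hu hw => simp [hu, hw]
  | single k c => rw [modul_single, ev_single, ev_single, expChar_add]; ring

lemma ev_adj {d : ℕ} (ξ : RSpace d) (u : Laurent d) :
    ev ξ (adj u) = conj (ev ξ u) := by
  induction u using AddMonoidAlgebra.induction_linear with
  | zero => simp
  | add u w hu hw => simp [hu, hw]
  | single k c => rw [adj_single, ev_single, ev_single, expChar_inv, map_mul]

lemma coeff_adj {d : ℕ} (u : Laurent d) (k : IntLattice d) :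
    (adj u).coeff k = conj (u.coeff (-k)) := by
  induction u using AddMonoidAlgebra.induction_linear with
  | zero => simp
  | add u w hu hw => simp [hu, hw]
  | single l c =>
    classical
    rw [adj_single, AddMonoidAlgebra.coeff_single, AddMonoidAlgebra.coeff_single,
      Finsupp.single_apply, Finsupp.single_apply]
    simp only [neg_eq_iff_eq_neg]
    split_ifs <;> simp

lemma adj_adj {d : ℕ} (u : Laurent d) : adj (adj u) = u :=
  ev_injective fun ξ => by simp [ev_adj]

lemma adj_up {d : ℕ} (M : Matrix (Fin d) (Fin d) ℤ) (u : Laurent d) :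
    adj (up M u) = up M (adj u) :=
  ev_injective fun ξ => by simp [ev_adj, ev_up]

lemma adj_modul {d : ℕ} (ζ : RSpace d) (u : Laurent d) :
    adj (modul ζ u) = modul ζ (adj u) :=
  ev_injective fun ξ => by simp [ev_adj, ev_modul]

lemma adj_smul {d : ℕ} (c : ℂ) (u : Laurent d) : adj (c • u) = conj c • adj u :=
  ev_injective fun ξ => by simp [ev_adj]

lemma modul_zero {d : ℕ} (u : Laurent d) : modul 0 u = u :=
  ev_injective fun ξ => by simp [ev_modul]

lemma ofCoeff_maskStar {d : ℕ} (u : Mask d) :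
    (AddMonoidAlgebra.ofCoeff (maskStar u) : Laurent d) = adj (AddMonoidAlgebra.ofCoeff u) := by
  unfold maskStar
  induction u using Finsupp.induction_linear with
  | zero => simp
  | add u w hu hw =>
    rw [Finsupp.sum_add_index' (by simp) (by simp), AddMonoidAlgebra.ofCoeff_add, hu, hw,
      AddMonoidAlgebra.ofCoeff_add, map_add]
  | single k c =>
    rw [Finsupp.sum_single_index (by simp)]
    exact (adj_single k c).symm

lemma ofCoeff_maskConv {d : ℕ} (u w : Mask d) :
    (AddMonoidAlgebra.ofCoeff (maskConv u w) : Laurent d)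
      = AddMonoidAlgebra.ofCoeff u * AddMonoidAlgebra.ofCoeff w := by
  rw [AddMonoidAlgebra.mul_def]
  unfold maskConv
  simp only [Finsupp.sum, ← AddMonoidAlgebra.coeffAddEquiv_symm_apply, map_sum]
  rfl

/-- Downsampling `(↓u)(n) = u(Mn)`. -/
def down {d : ℕ} (M : Matrix (Fin d) (Fin d) ℤ) (hM : Function.Injective (latMap M))
    (u : Laurent d) : Laurent d :=
  AddMonoidAlgebra.ofCoeff (u.coeff.comapDomain (latMap M) hM.injOn)

section down
variable {d : ℕ} {M : Matrix (Fin d) (Fin d) ℤ} (hM : Function.Injective (latMap M))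

@[simp] lemma coeff_down (u : Laurent d) (n : IntLattice d) :
    (down M hM u).coeff n = u.coeff (latMap M n) := rfl

lemma coeff_up_latMap (hM : Function.Injective (latMap M)) (u : Laurent d) (n : IntLattice d) :
    (up M u).coeff (latMap M n) = u.coeff n := by
  induction u using AddMonoidAlgebra.induction_linear with
  | zero => simp
  | add u w hu hw => simp [hu, hw]
  | single l c =>
    classical
    rw [up_single, AddMonoidAlgebra.coeff_single, AddMonoidAlgebra.coeff_single,
      Finsupp.single_apply, Finsupp.single_apply]
    simp only [hM.eq_iff]

lemma coeff_up_of_notMem (u : Laurent d) {k : IntLattice d}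
    (hk : k ∉ (latMap M).range) : (up M u).coeff k = 0 := by
  induction u using AddMonoidAlgebra.induction_linear with
  | zero => simp
  | add u w hu hw => simp [hu, hw]
  | single l c =>
    classical
    rw [up_single, AddMonoidAlgebra.coeff_single, Finsupp.single_apply, if_neg]
    rintro rfl
    exact hk ⟨l, rfl⟩

/-- The noble identity: downsampling commutes with the multiplication by an upsampled filter. -/
lemma down_mul_up (x y : Laurent d) : down M hM (x * up M y) = down M hM x * y := by
  induction y using AddMonoidAlgebra.induction_linear with
  | zero => rw [map_zero, mul_zero, mul_zero]; ext; simp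
  | add u w hu hw =>
    rw [map_add, mul_add, mul_add, ← hu, ← hw]; ext; simp
  | single l c =>
    ext n
    rw [up_single, coeff_down]
    have h1 : ∀ (y : Laurent d) (p q : IntLattice d),
        (y * AddMonoidAlgebra.single q c).coeff p = y.coeff (p - q) * c := by
      intro y p q
      exact AddMonoidAlgebra.coeff_mul_single_eq_coeff_mul _
        fun m' _ => eq_sub_iff_add_eq.symm
    rw [h1, h1, coeff_down, map_sub (latMap M)]

end down

/-! ### Characters of the quotient lattice -/

section characters
variable {d : ℕ} {M : Matrix (Fin d) (Fin d) ℤ}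

/-- The quotient lattice `ℤ^d / M ℤ^d`. -/
abbrev QuotLattice (M : Matrix (Fin d) (Fin d) ℤ) : Type := IntLattice d ⧸ (latMap M).range

lemma latMap_injective (hM : M.det ≠ 0) : Function.Injective (latMap M) :=
  Matrix.mulVec_injective_of_det_ne_zero hM

lemma card_quotLattice (hM : M.det ≠ 0) : Nat.card (QuotLattice M) = M.det.natAbs := by
  have hinj := latMap_injective hM
  have h := Submodule.natAbs_det_equiv (LinearMap.range M.mulVecLin)
    (LinearEquiv.ofInjective M.mulVecLin hinj)
  have h2 : (LinearMap.range M.mulVecLin).subtype ∘ₗ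
      AddMonoidHom.toIntLinearMap
        ((LinearEquiv.ofInjective M.mulVecLin hinj : IntLattice d ≃ₗ[ℤ] _) : IntLattice d →+ _)
      = Matrix.toLin' M := by
    refine LinearMap.ext fun k => ?_
    rfl
  rw [h2, LinearMap.det_toLin'] at h
  rw [h]
  rfl

lemma finite_quotLattice (hM : M.det ≠ 0) : Finite (QuotLattice M) :=
  Nat.finite_of_card_ne_zero (by rw [card_quotLattice hM]; simpa using hM)

lemma expChar_latMap (ζ : RSpace d) (k : IntLattice d) :
    expChar ζ (Multiplicative.ofAdd (latMap M k)) = expChar (act Mᵀ ζ) (Multiplicative.ofAdd k) := by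
  rw [expChar_apply, expChar_apply, latticeVec_latMap, inner_act_left]

lemma expChar_two_pi_latticeVec (k l : IntLattice d) :
    expChar ((2 * Real.pi) • latticeVec k) (Multiplicative.ofAdd l) = 1 := by
  rw [expChar_apply, Complex.exp_eq_one_iff, inner_smul_right, inner_latticeVec]
  refine ⟨-∑ i, l i * k i, ?_⟩
  simp only [latticeVec]
  push_cast
  ring

lemma act_smul (A : Matrix (Fin d) (Fin d) ℤ) (c : ℝ) (x : RSpace d) :
    act A (c • x) = c • act A x := by
  ext i
  simp [act, Matrix.mulVec_smul]

lemma act_add (A : Matrix (Fin d) (Fin d) ℤ) (x y : RSpace d) :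
    act A (x + y) = act A x + act A y := by
  ext i
  simp [act, Matrix.mulVec_add]

/-- Points of the half-open unit cube are separated by the characters `k ↦ e^{-2πi k·ω}`. -/
lemma expChar_two_pi_injective {s t : RSpace d}
    (hs : ∀ i, 0 ≤ s i ∧ s i < 1) (ht : ∀ i, 0 ≤ t i ∧ t i < 1)
    (h : ∀ k, expChar ((2 * Real.pi) • s) (Multiplicative.ofAdd k)
      = expChar ((2 * Real.pi) • t) (Multiplicative.ofAdd k)) : s = t := by
  ext i
  have h1 := h (Pi.single i 1)
  rw [expChar_apply, expChar_apply, Complex.exp_eq_exp_iff_exists_int] at h1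
  obtain ⟨n, hn⟩ := h1
  rw [inner_smul_right, inner_smul_right, inner_latticeVec, inner_latticeVec] at hn
  simp [Pi.single_apply] at hn
  have h2 : s i = t i - n := by
    have h3 : (2 * Real.pi * Complex.I) * ((s i : ℝ) : ℂ)
        = (2 * Real.pi * Complex.I) * ((t i - n : ℝ) : ℂ) := by
      push_cast
      linear_combination -hn
    have h4 : (2 * (Real.pi : ℂ) * Complex.I) ≠ 0 := by simp [Real.pi_ne_zero]
    exact_mod_cast mul_left_cancel₀ h4 h3
  have h5 : n = 0 := by
    have a1 := hs i; have a2 := ht i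
    have b1 : (n : ℝ) < 1 := by linarith
    have b2 : (-1 : ℝ) < n := by linarith
    have b1 : n < 1 := by exact_mod_cast b1
    have b2 : -1 < n := by exact_mod_cast b2
    omega
  simpa [h5] using h2

/-- The character of `ℤ^d / M ℤ^d` attached to a point of `Ω_M`. -/
def omegaChar (ω : Omega M) : AddChar (QuotLattice M) ℂ :=
  AddChar.toAddMonoidHomEquiv.symm
    (QuotientAddGroup.lift (latMap M).range
      (MonoidHom.toAdditiveRight (expChar ((2 * Real.pi) • ω.1))) (by
        rintro _ ⟨k, rfl⟩
        obtain ⟨l, hl⟩ := ω.2.1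
        change expChar ((2 * Real.pi) • ω.1) (Multiplicative.ofAdd (latMap M k)) = 1
        rw [expChar_latMap, act_smul, hl, expChar_two_pi_latticeVec]))

lemma omegaChar_mk (ω : Omega M) (k : IntLattice d) :
    omegaChar ω (QuotientAddGroup.mk k)
      = expChar ((2 * Real.pi) • ω.1) (Multiplicative.ofAdd k) := rfl

lemma omegaChar_injective : Function.Injective (omegaChar (M := M)) := by
  intro ω ω' h
  refine Subtype.ext (expChar_two_pi_injective ω.2.2 ω'.2.2 fun k => ?_)
  rw [← omegaChar_mk, ← omegaChar_mk, h]

/-- Characters of `ℤ^d` that are trivial on `M ℤ^d` are given by points of `Ω_M`. -/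
lemma omegaChar_surjective (hM : M.det ≠ 0) : Function.Surjective (omegaChar (M := M)) := by
  intro χ
  have := finite_quotLattice hM
  have hnorm : ∀ x, ‖χ x‖ = 1 := fun x => AddChar.norm_apply χ x
  let e : Fin d → IntLattice d := fun i => Pi.single i 1
  let t : Fin d → ℝ := fun i => Int.fract (-(Complex.arg (χ (e i : QuotLattice M))) / (2 * Real.pi))
  let ω : RSpace d := WithLp.toLp 2 t
  have hω : ∀ k : IntLattice d, expChar ((2 * Real.pi) • ω) (Multiplicative.ofAdd k)
      = χ (k : QuotLattice M) := by
    have hadd : (MonoidHom.toAdditiveRight (expChar ((2 * Real.pi) • ω))) =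
        (AddChar.toAddMonoidHomEquiv χ).comp (QuotientAddGroup.mk' (latMap M).range) := by
      refine AddMonoidHom.functions_ext' (M := fun _ : Fin d => ℤ) _ _ _ fun i => ?_
      ext
      change expChar ((2 * Real.pi) • ω) (Multiplicative.ofAdd (e i)) = χ (e i : QuotLattice M)
      rw [expChar_apply, inner_smul_right, inner_latticeVec]
      have h1 : ∑ j, ((e i j : ℤ) : ℝ) * ω j = t i := by simp [e, ω, Pi.single_apply]
      rw [h1]
      have hpi : (2 * Real.pi) ≠ 0 := by positivity
      have h2 : 2 * Real.pi * t i = -Complex.arg (χ (e i : QuotLattice M))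
          - 2 * Real.pi * ⌊-(Complex.arg (χ (e i : QuotLattice M))) / (2 * Real.pi)⌋ := by
        simp only [t, Int.fract]
        rw [mul_sub, mul_div_cancel₀ _ hpi]
      rw [h2]
      conv_rhs => rw [← Complex.norm_mul_exp_arg_mul_I (χ (e i : QuotLattice M)), hnorm,
        Complex.ofReal_one, one_mul]
      rw [Complex.exp_eq_exp_iff_exists_int]
      refine ⟨⌊-(Complex.arg (χ (e i : QuotLattice M))) / (2 * Real.pi)⌋, ?_⟩
      push_cast
      ring
    intro k
    exact DFunLike.congr_fun hadd k
  have hmem : ω ∈ Omega M := by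
    refine ⟨?_, fun i => ⟨Int.fract_nonneg _, Int.fract_lt_one _⟩⟩
    -- `χ` is trivial on the columns of `M`, so the coordinates of `Mᵀ ω` are integers
    have h1 : ∀ i, ∃ n : ℤ, act Mᵀ ω i = n := by
      intro i
      have h2 := hω (latMap M (e i))
      rw [(QuotientAddGroup.eq_zero_iff (latMap M (e i))).2 (AddMonoidHom.mem_range.2 ⟨e i, rfl⟩), AddChar.map_zero_eq_one, expChar_latMap,
        expChar_apply, act_smul, inner_smul_right, inner_latticeVec, Complex.exp_eq_one_iff] at h2
      obtain ⟨n, hn⟩ := h2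
      refine ⟨-n, ?_⟩
      have h1 : ∑ j, ((e i j : ℤ) : ℝ) * act Mᵀ ω j = act Mᵀ ω i := by simp [e, Pi.single_apply]
      rw [h1] at hn
      have h3 : (2 * Real.pi * Complex.I) * ((act Mᵀ ω i : ℝ) : ℂ)
          = (2 * Real.pi * Complex.I) * ((((-n : ℤ) : ℝ)) : ℂ) := by
        push_cast at hn ⊢
        linear_combination -hn
      have h4 : (2 * (Real.pi : ℂ) * Complex.I) ≠ 0 := by simp [Real.pi_ne_zero]
      exact_mod_cast mul_left_cancel₀ h4 h3
    choose n hn using h1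
    exact ⟨n, by ext i; simp [latticeVec, hn]⟩
  refine ⟨⟨ω, hmem⟩, ?_⟩
  ext x
  obtain ⟨k, rfl⟩ := QuotientAddGroup.mk_surjective x
  rw [omegaChar_mk, hω]

/-- `Ω_M` is the dual group of `ℤ^d / M ℤ^d`. -/
def omegaEquiv (hM : M.det ≠ 0) : Omega M ≃ AddChar (QuotLattice M) ℂ :=
  Equiv.ofBijective omegaChar ⟨omegaChar_injective, omegaChar_surjective hM⟩

lemma finite_omega (hM : M.det ≠ 0) : Finite (Omega M) := by
  have := finite_quotLattice hM
  exact Finite.of_equiv _ (omegaEquiv hM).symm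

lemma sum_expChar_omega [Fintype (Omega M)] (hM : M.det ≠ 0) (k : IntLattice d) :
    ∑ ω : Omega M, expChar ((2 * Real.pi) • ω.1) (Multiplicative.ofAdd k)
      = open Classical in if k ∈ (latMap M).range then (M.det.natAbs : ℂ) else 0 := by
  classical
  have := finite_quotLattice hM
  have := Fintype.ofFinite (QuotLattice M)
  have h := AddChar.sum_apply_eq_ite (k : QuotLattice M)
  rw [← (omegaEquiv hM).sum_comp] at h
  rw [← card_quotLattice hM, Nat.card_eq_fintype_card, ← QuotientAddGroup.eq_zero_iff]
  convert h using 1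
  · rfl
  · congr!

lemma sum_quotLattice_expChar [Fintype (QuotLattice M)] (hM : M.det ≠ 0) (ω ω' : Omega M) :
    ∑ r : QuotLattice M, conj (expChar ((2 * Real.pi) • ω.1) (Multiplicative.ofAdd r.out))
        * expChar ((2 * Real.pi) • ω'.1) (Multiplicative.ofAdd r.out)
      = open Classical in if ω = ω' then (M.det.natAbs : ℂ) else 0 := by
  classical
  have h : ∀ (ω : Omega M) (r : QuotLattice M),
      expChar ((2 * Real.pi) • ω.1) (Multiplicative.ofAdd r.out) = omegaChar ω r := by
    intro ω r
    rw [← omegaChar_mk, QuotientAddGroup.out_eq']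
  simp only [h]
  rw [← card_quotLattice hM, Nat.card_eq_fintype_card]
  have h2 : ∀ r, conj (omegaChar ω r) * omegaChar ω' r = (omegaChar ω' - omegaChar ω) r := by
    intro r
    rw [AddChar.sub_apply', mul_comm, div_eq_mul_inv, ← AddChar.map_neg_eq_conj,
      AddChar.map_neg_eq_inv]
  simp only [h2]
  rw [AddChar.sum_eq_ite]
  simp only [sub_eq_zero, omegaChar_injective.eq_iff, eq_comm]

end characters

section telescoping
variable {d : ℕ} {M : Matrix (Fin d) (Fin d) ℤ}

lemma zero_mem_Omega (M : Matrix (Fin d) (Fin d) ℤ) : (0 : RSpace d) ∈ Omega M :=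
  ⟨⟨0, by ext i; simp [act, latticeVec]⟩, fun i => by simp⟩

/-- Downsampling followed by upsampling averages over the modulations by `2πω`, `ω ∈ Ω_M`. -/
lemma natAbs_det_smul_up_down [Fintype (Omega M)] (hM : M.det ≠ 0) (u : Laurent d) :
    (M.det.natAbs : ℂ) • up M (down M (latMap_injective hM) u)
      = ∑ ω : Omega M, modul ((2 * Real.pi) • ω.1) u := by
  classical
  have hcoeff : ∀ (ζ : RSpace d) (u : Laurent d) (k : IntLattice d),
      (modul ζ u).coeff k = u.coeff k * expChar ζ (Multiplicative.ofAdd k) := by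
    intro ζ u k
    induction u using AddMonoidAlgebra.induction_linear with
    | zero => simp
    | add u w hu hw => simp [hu, hw, add_mul]
    | single l c =>
      rw [modul_single, AddMonoidAlgebra.coeff_single, AddMonoidAlgebra.coeff_single,
        Finsupp.single_apply, Finsupp.single_apply]
      split_ifs with h
      · rw [h]
      · simp
  ext k
  rw [AddMonoidAlgebra.coeff_smul, AddMonoidAlgebra.coeff_sum, Finsupp.smul_apply,
    Finsupp.finsetSum_apply]
  simp only [hcoeff]
  rw [← Finset.mul_sum, sum_expChar_omega hM]
  split_ifs with h
  · obtain ⟨n, rfl⟩ := h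
    rw [coeff_up_latMap (latMap_injective hM), coeff_down, smul_eq_mul, mul_comm]
  · rw [coeff_up_of_notMem _ h, smul_zero, mul_zero]

lemma coeff_zero_down_mul [Fintype (Omega M)] (hM : M.det ≠ 0) (x y t : Laurent d) :
    (M.det.natAbs : ℂ) * (down M (latMap_injective hM) x * t
        * adj (down M (latMap_injective hM) y)).coeff 0
      = ∑ ω : Omega M, (x * up M t * modul ((2 * Real.pi) • ω.1) (adj y)).coeff 0 := by
  have h0 : ∀ z, (down M (latMap_injective hM) z).coeff 0 = z.coeff 0 := by
    intro z; rw [coeff_down, map_zero]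
  rw [mul_assoc, ← down_mul_up, h0, map_mul, ← adj_up, ← smul_eq_mul, ← Finsupp.smul_apply,
    ← AddMonoidAlgebra.coeff_smul, ← mul_assoc, ← mul_smul_comm]
  have h1 : (M.det.natAbs : ℂ) • adj (up M (down M (latMap_injective hM) y))
      = ∑ ω : Omega M, modul ((2 * Real.pi) • ω.1) (adj y) := by
    have := congrArg adj (natAbs_det_smul_up_down hM y)
    rw [adj_smul, map_sum] at this
    simpa [adj_modul] using this
  rw [h1, Finset.mul_sum, AddMonoidAlgebra.coeff_sum, Finsupp.finsetSum_apply]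

lemma mul_add_sum_mul {R : Type*} [CommRing R] {s : ℕ} (A C U A' E : R) (B B' : Fin s → R) :
    A * C * U * (A' * E) + ∑ l, B l * C * (B' l * E) = C * E * (A * U * A' + ∑ l, B l * B' l) := by
  rw [mul_add, Finset.mul_sum]
  congr 1
  · ring
  · exact Finset.sum_congr rfl fun l _ => by ring

/-- One step of the telescoping: the pairing of two coefficient sequences at the fine level is
the sum of the low-pass and the high-pass pairings at the coarse level. -/
lemma coeff_zero_filterBank {s : ℕ} (hM : M.det ≠ 0) {a a' Θ : Laurent d} {b b' : Fin s → Laurent d}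
    (h : ∀ ω ∈ Omega M, adj a * up M Θ * modul ((2 * Real.pi) • ω) a'
        + ∑ l, adj (b l) * modul ((2 * Real.pi) • ω) (b' l)
      = (open Classical in if ω = 0 then (1 : ℂ) else 0) • Θ) (c e : Laurent d) :
    (M.det.natAbs : ℂ) * (down M (latMap_injective hM) (adj a * c) * Θ
        * adj (down M (latMap_injective hM) (adj a' * e))).coeff 0
      + ∑ l, (M.det.natAbs : ℂ) * (down M (latMap_injective hM) (adj (b l) * c)
        * adj (down M (latMap_injective hM) (adj (b' l) * e))).coeff 0
      = (c * Θ * adj e).coeff 0 := by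
  classical
  have := finite_omega hM
  have := Fintype.ofFinite (Omega M)
  have h1 := fun l => coeff_zero_down_mul hM (adj (b l) * c) (adj (b' l) * e) 1
  simp only [mul_one, map_one] at h1
  simp only [coeff_zero_down_mul hM, h1]
  rw [Finset.sum_comm, ← Finset.sum_add_distrib]
  have h2 : ∀ ω : Omega M, (adj a * c * up M Θ
        * modul ((2 * Real.pi) • ω.1) (adj (adj a' * e))).coeff 0
      + ∑ l, (adj (b l) * c * modul ((2 * Real.pi) • ω.1) (adj (adj (b' l) * e))).coeff 0
      = if ω = ⟨0, zero_mem_Omega M⟩ then (c * Θ * adj e).coeff 0 else 0 := by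
    intro ω
    have h3 := mul_add_sum_mul (adj a) c (up M Θ) (modul ((2 * Real.pi) • ω.1) a')
      (modul ((2 * Real.pi) • ω.1) (adj e)) (fun l => adj (b l))
      (fun l => modul ((2 * Real.pi) • ω.1) (b' l))
    rw [h _ ω.2] at h3
    have h4 := congrArg (fun u : Laurent d => u.coeff 0) h3
    simp only [AddMonoidAlgebra.coeff_add, AddMonoidAlgebra.coeff_sum, Finsupp.add_apply,
      Finsupp.finsetSum_apply] at h4
    simp only [map_mul, adj_adj]
    rw [h4]
    by_cases hω : ω = ⟨0, zero_mem_Omega M⟩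
    · subst hω
      simp only [if_true, one_smul, smul_zero, modul_zero]
      rw [mul_right_comm]
    · have : ω.1 ≠ 0 := fun h => hω (Subtype.ext h)
      simp [hω, this]
  rw [Finset.sum_congr rfl fun ω _ => h2 ω]
  simp

end telescoping

/-! ### Existence of the high-pass filters -/

/-- The augmentation ideal: Laurent polynomials that vanish at `z = 1`, i.e. at `ξ = 0`. -/
def augIdeal (d : ℕ) : Ideal (Laurent d) := RingHom.ker (ev (0 : RSpace d)).toRingHom

lemma mem_augIdeal {d : ℕ} {u : Laurent d} : u ∈ augIdeal d ↔ ev 0 u = 0 := Iff.rfl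

lemma adj_mem_augIdeal_pow {d m : ℕ} {u : Laurent d} (hu : u ∈ augIdeal d ^ m) :
    adj u ∈ augIdeal d ^ m := by
  have h1 : augIdeal d ≤ (augIdeal d).comap adj := by
    intro u hu
    rw [Ideal.mem_comap, mem_augIdeal, ev_adj, mem_augIdeal.1 hu, map_zero]
  exact Ideal.le_comap_pow adj m (Ideal.pow_right_mono h1 m hu)

section filterBank
variable {d : ℕ} {M : Matrix (Fin d) (Fin d) ℤ}

/-- `Ω_M` is closed under negation modulo `ℤ^d`, and shifts by `2πℤ^d` act trivially. -/
lemma exists_neg_omega {ω : RSpace d} (hω : ω ∈ Omega M) (h0 : ω ≠ 0) :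
    ∃ ω' ∈ Omega M, ω' ≠ 0 ∧ ∀ u : Laurent d,
      modul ((2 * Real.pi) • ω) (modul ((2 * Real.pi) • ω') u) = u := by
  obtain ⟨⟨k, hk⟩, hω1⟩ := hω
  let n : IntLattice d := fun i => -⌊-ω i⌋
  have hn : ∀ i, Int.fract (-ω i) = -ω i + n i := by
    intro i; simp [n, Int.fract, sub_eq_add_neg]
  let ω' : RSpace d := WithLp.toLp 2 fun i => Int.fract (-ω i)
  have hω' : ω' = -ω + latticeVec n := by
    ext i; simp [ω', latticeVec, hn]
  refine ⟨ω', ⟨⟨-k + latMap Mᵀ n, ?_⟩, fun i => ⟨Int.fract_nonneg _, Int.fract_lt_one _⟩⟩, ?_, ?_⟩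
  · have : -ω = (-1 : ℝ) • ω := by simp
    rw [hω', act_add, this, act_smul, hk, latticeVec_add, latticeVec_neg, latticeVec_latMap]
    simp
  · intro h
    apply h0
    ext i
    have h1 : Int.fract (-ω i) = 0 := congrArg (fun x : RSpace d => x i) h
    rw [Int.fract_eq_iff] at h1
    obtain ⟨-, -, z, hz⟩ := h1
    have h2 := hω1 i
    have h3 : (z : ℝ) ≤ 0 := by linarith
    have h4 : (-1 : ℝ) < z := by linarith
    have h3 : z ≤ 0 := by exact_mod_cast h3
    have h4 : -1 < z := by exact_mod_cast h4
    have : z = 0 := by omega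
    simpa [this] using hz
  · intro u
    induction u using AddMonoidAlgebra.induction_linear with
    | zero => simp
    | add u w hu hw => simp [hu, hw]
    | single l c =>
      rw [modul_single, modul_single, mul_assoc, ← expChar_add, hω', ← smul_add,
        neg_add_eq_sub, sub_add_cancel, expChar_two_pi_latticeVec, mul_one]

/-- The additive monoid generated by the elementary products `p(ξ) q(ξ + 2πω)`, as functions
of `ω`, where `p` vanishes to order `m` and `q` to order `m'` at the origin. -/
def elementaryProducts (M : Matrix (Fin d) (Fin d) ℤ) (m m' : ℕ) :
    AddSubmonoid (Omega M → Laurent d) :=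
  AddSubmonoid.closure {N | ∃ p ∈ augIdeal d ^ m, ∃ q ∈ augIdeal d ^ m',
    N = fun ω => p * modul ((2 * Real.pi) • ω.1) q}

lemma exists_of_mem_elementaryProducts {m m' : ℕ} {N : Omega M → Laurent d}
    (hN : N ∈ elementaryProducts M m m') :
    ∃ (s : ℕ) (b b' : Fin s → Laurent d), (∀ l, b l ∈ augIdeal d ^ m) ∧
      (∀ l, b' l ∈ augIdeal d ^ m') ∧
      ∀ ω, N ω = ∑ l, adj (b l) * modul ((2 * Real.pi) • ω.1) (b' l) := by
  induction hN using AddSubmonoid.closure_induction with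
  | mem N h =>
    obtain ⟨p, hp, q, hq, rfl⟩ := h
    exact ⟨1, fun _ => adj p, fun _ => q, fun _ => adj_mem_augIdeal_pow hp, fun _ => hq,
      fun ω => by simp [adj_adj]⟩
  | zero => exact ⟨0, Fin.elim0, Fin.elim0, fun l => l.elim0, fun l => l.elim0, fun ω => by simp⟩
  | add N₁ N₂ _ _ h₁ h₂ =>
    obtain ⟨s₁, b₁, b₁', hb₁, hb₁', e₁⟩ := h₁
    obtain ⟨s₂, b₂, b₂', hb₂, hb₂', e₂⟩ := h₂
    refine ⟨s₁ + s₂, Fin.append b₁ b₂, Fin.append b₁' b₂', ?_, ?_, ?_⟩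
    · exact fun l => Fin.addCases (fun i => by simpa using hb₁ i) (fun i => by simpa using hb₂ i) l
    · exact fun l => Fin.addCases (fun i => by simpa using hb₁' i) (fun i => by simpa using hb₂' i) l
    · intro ω
      rw [Pi.add_apply, e₁, e₂, Fin.sum_univ_add]
      simp

/-- Products concentrated at a single `ω₀` are sums of elementary products, because the indicator
of `ω₀` is a character sum over `ℤ^d / M ℤ^d`. -/
lemma single_mem_elementaryProducts (hM : M.det ≠ 0) {m m' : ℕ} {p q : Laurent d}
    (hp : p ∈ augIdeal d ^ m) (hq : q ∈ augIdeal d ^ m') (ω₀ : Omega M) :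
    (fun ω => open Classical in if ω₀ = ω then p * modul ((2 * Real.pi) • ω₀.1) q else 0)
      ∈ elementaryProducts M m m' := by
  classical
  have := finite_quotLattice hM
  have := Fintype.ofFinite (QuotLattice M)
  have key : (fun ω => if ω₀ = ω then p * modul ((2 * Real.pi) • ω₀.1) q else 0)
      = ∑ r : QuotLattice M, fun ω : Omega M =>
        (AddMonoidAlgebra.single (-r.out) ((M.det.natAbs : ℂ)⁻¹ *
          conj (expChar ((2 * Real.pi) • ω₀.1) (Multiplicative.ofAdd r.out))) * p)
        * modul ((2 * Real.pi) • ω.1) (AddMonoidAlgebra.single r.out 1 * q) := by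
    funext ω
    rw [Finset.sum_apply]
    have h1 : ∀ r : QuotLattice M,
        (AddMonoidAlgebra.single (-r.out) ((M.det.natAbs : ℂ)⁻¹ *
          conj (expChar ((2 * Real.pi) • ω₀.1) (Multiplicative.ofAdd r.out))) * p)
        * modul ((2 * Real.pi) • ω.1) (AddMonoidAlgebra.single r.out 1 * q)
        = ((M.det.natAbs : ℂ)⁻¹ * (conj (expChar ((2 * Real.pi) • ω₀.1) (Multiplicative.ofAdd r.out))
          * expChar ((2 * Real.pi) • ω.1) (Multiplicative.ofAdd r.out))) •
          (p * modul ((2 * Real.pi) • ω.1) q) := by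
      intro r
      rw [map_mul, modul_single, mul_mul_mul_comm, AddMonoidAlgebra.single_mul_single,
        neg_add_cancel, one_mul]
      have h2 : ∀ c : ℂ, AddMonoidAlgebra.single (0 : IntLattice d) c = c • (1 : Laurent d) := by
        intro c
        rw [AddMonoidAlgebra.one_def, AddMonoidAlgebra.smul_single, smul_eq_mul, mul_one]
      rw [h2, smul_one_mul, mul_assoc]
    simp only [h1]
    rw [← Finset.sum_smul, ← Finset.mul_sum, sum_quotLattice_expChar hM]
    have hdet : (M.det.natAbs : ℂ) ≠ 0 := by
      simpa using hM
    by_cases h : ω₀ = ω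
    · subst h
      rw [if_pos rfl, if_pos rfl, inv_mul_cancel₀ hdet, one_smul]
    · simp [h]
  rw [key]
  refine sum_mem fun r _ => AddSubmonoid.subset_closure ⟨_, Ideal.mul_mem_left _ _ hp, _,
    Ideal.mul_mem_left _ _ hq, rfl⟩

/-- Existence of high-pass filters with prescribed vanishing orders. The pairs `(p, q)` and
`(p, -q)` may be added to any filter bank, so that `p` and `q` can be made to occur. -/
lemma exists_highpass (hM : M.det ≠ 0) {a a' Θ : Laurent d} {m m' : ℕ}
    (ha : ∀ ω ∈ Omega M, ω ≠ 0 → modul ((2 * Real.pi) • ω) a ∈ augIdeal d ^ m')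
    (ha' : ∀ ω ∈ Omega M, ω ≠ 0 → modul ((2 * Real.pi) • ω) a' ∈ augIdeal d ^ m)
    (h0 : Θ - adj a * up M Θ * a' ∈ augIdeal d ^ (m + m'))
    {p q : Laurent d} (hp : p ∈ augIdeal d ^ m) (hq : q ∈ augIdeal d ^ m') :
    ∃ (s : ℕ) (b b' : Fin s → Laurent d), (∀ l, b l ∈ augIdeal d ^ m) ∧
      (∀ l, b' l ∈ augIdeal d ^ m') ∧ (∃ l, b l = p) ∧ (∃ l, b' l = q) ∧
      ∀ ω ∈ Omega M, adj a * up M Θ * modul ((2 * Real.pi) • ω) a'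
        + ∑ l, adj (b l) * modul ((2 * Real.pi) • ω) (b' l)
      = (open Classical in if ω = 0 then (1 : ℂ) else 0) • Θ := by
  classical
  have := finite_omega hM
  have := Fintype.ofFinite (Omega M)
  let N : Omega M → Laurent d := fun ω => (if ω.1 = 0 then (1 : ℂ) else 0) • Θ
    - adj a * up M Θ * modul ((2 * Real.pi) • ω.1) a'
  -- `N` is the part of the filter bank identity left to the high-pass filters; it is treated one
  -- shift `ω₀` at a time
  have hN : N ∈ elementaryProducts M m m' := by
    have hsum : N = ∑ ω₀, fun ω => if ω₀ = ω then N ω₀ else 0 := by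
      funext ω
      simp
    rw [hsum]
    refine sum_mem fun ω₀ _ => ?_
    -- for `ω₀ = 0` the hypothesis `h0` splits into products because `I ^ (m + m') = I ^ m * I ^ m'`
    by_cases hω : ω₀.1 = 0
    · have h1 : N ω₀ = Θ - adj a * up M Θ * a' := by simp [N, hω, modul_zero]
      rw [h1]
      rw [pow_add] at h0
      refine Submodule.mul_induction_on' (C := fun x _ =>
        (fun ω => if ω₀ = ω then x else 0) ∈ elementaryProducts M m m') ?_ ?_ h0
      · intro p hp q hq
        have := single_mem_elementaryProducts hM hp hq ω₀
        simpa [hω, modul_zero] using this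
      · intro x _ y _ hx hy
        convert add_mem hx hy using 1
        funext ω
        by_cases h : ω₀ = ω <;> simp [h]
    -- for `ω₀ ≠ 0` the sum rules of `a'` give the factor in `I ^ m` and those of `a`, shifted by
    -- `-ω₀`, the factor in `I ^ m'`
    · obtain ⟨ω', hω', hω'0, hinv⟩ := exists_neg_omega ω₀.2 hω
      have h1 : N ω₀ = (-(modul ((2 * Real.pi) • ω₀.1) a' * up M Θ))
          * modul ((2 * Real.pi) • ω₀.1) (modul ((2 * Real.pi) • ω') (adj a)) := by
        rw [hinv]
        simp only [N, hω, if_false, zero_smul]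
        ring
      rw [h1]
      refine single_mem_elementaryProducts hM ?_ ?_ ω₀
      · exact neg_mem (Ideal.mul_mem_right _ _ (ha' _ ω₀.2 hω))
      · rw [← adj_modul]
        exact adj_mem_augIdeal_pow (ha _ hω' hω'0)
  obtain ⟨s, b, b', hb, hb', e⟩ := exists_of_mem_elementaryProducts hN
  refine ⟨s + 2, Fin.append b ![p, p], Fin.append b' ![q, -q], ?_, ?_, ?_, ?_, ?_⟩
  · exact fun l => Fin.addCases (fun i => by simpa using hb i)
      (fun i => by fin_cases i <;> simpa using hp) l
  · exact fun l => Fin.addCases (fun i => by simpa using hb' i)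
      (fun i => by fin_cases i <;> simpa using hq) l
  · exact ⟨Fin.natAdd s 0, by simp⟩
  · exact ⟨Fin.natAdd s 0, by simp⟩
  · intro ω hω
    have h2 := e ⟨ω, hω⟩
    simp only [N] at h2
    rw [Fin.sum_univ_add]
    simp only [Fin.append_left, Fin.append_right, ← h2]
    simp

end filterBank

/-! ### Order of vanishing at the origin -/

section vanishing
variable {d : ℕ}

lemma continuous_ev (u : Laurent d) : Continuous fun ξ => ev ξ u := by
  induction u using AddMonoidAlgebra.induction_linear with
  | zero => simpa using continuous_const
  | add u w hu hw => simp only [map_add]; exact hu.add hw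
  | single k c =>
    simp only [ev_single, expChar_apply]
    fun_prop

lemma ev_isBigO_of_mem_augIdeal {u : Laurent d} (hu : u ∈ augIdeal d) :
    (fun ξ => ev ξ u) =O[𝓝 0] fun ξ => ‖ξ‖ := by
  have h1 : DifferentiableAt ℝ (fun ξ : RSpace d => ev ξ u) 0 := by
    clear hu
    induction u using AddMonoidAlgebra.induction_linear with
    | zero => simp
    | add u w hu hw => simp only [map_add]; exact hu.add hw
    | single k c =>
      simp only [ev_single, expChar_apply]
      refine DifferentiableAt.const_mul (DifferentiableAt.cexp (DifferentiableAt.neg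
        (DifferentiableAt.const_mul ?_ _))) _
      exact Complex.ofRealCLM.differentiableAt.comp _
        ((differentiableAt_const _).inner ℝ differentiableAt_id)
  have h2 := h1.isBigO_sub
  simp only [sub_zero, mem_augIdeal.1 hu] at h2
  exact h2.norm_right

lemma ev_isBigO_of_mem_augIdeal_pow {n : ℕ} {u : Laurent d} (hu : u ∈ augIdeal d ^ n) :
    (fun ξ => ev ξ u) =O[𝓝 0] fun ξ => ‖ξ‖ ^ n := by
  induction n generalizing u with
  | zero =>
    simpa using ((continuous_ev u).tendsto 0).isBigO_one ℝ
  | succ n ih =>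
    rw [pow_succ] at hu
    refine Submodule.mul_induction_on hu (fun p hp q hq => ?_) (fun x y hx hy => ?_)
    · simpa only [map_mul, pow_succ] using (ih hp).mul (ev_isBigO_of_mem_augIdeal hq)
    · simpa only [map_add] using hx.add hy

/-- `z_i - 1`. -/
def augGen (i : Fin d) : Laurent d := AddMonoidAlgebra.single (Pi.single i 1) 1 - 1

lemma ev_augGen (ξ : RSpace d) (i : Fin d) :
    ev ξ (augGen i) = Complex.exp (-(Complex.I * (ξ i : ℂ))) - 1 := by
  rw [augGen, map_sub, ev_single, map_one, expChar_apply, inner_latticeVec]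
  simp [Pi.single_apply]

lemma augGen_mem (i : Fin d) : augGen i ∈ augIdeal d := by
  rw [mem_augIdeal, ev_augGen]; simp

/-- First order Taylor expansion of a monomial: both `k ↦ z^k - 1` and `k ↦ ∑ k_i (z_i - 1)` are
additive modulo `I ^ 2`, and they agree on the generators of the lattice. -/
lemma single_sub_one_mem (k : IntLattice d) :
    AddMonoidAlgebra.single k 1 - ∑ i, (k i : ℂ) • augGen i - 1 ∈ augIdeal d ^ 2 := by
  let F : IntLattice d →+ (Laurent d ⧸ augIdeal d ^ 2) :=
    { toFun := fun k => Ideal.Quotient.mk _ (AddMonoidAlgebra.single k 1 - 1)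
      map_zero' := by simp [AddMonoidAlgebra.one_def]
      map_add' := fun k l => by
        rw [← map_add, Ideal.Quotient.eq, sq]
        have h : (AddMonoidAlgebra.single (k + l) 1 - 1 : Laurent d)
            - (AddMonoidAlgebra.single k 1 - 1 + (AddMonoidAlgebra.single l 1 - 1))
            = (AddMonoidAlgebra.single k 1 - 1) * (AddMonoidAlgebra.single l 1 - 1) := by
          have : (AddMonoidAlgebra.single (k + l) 1 : Laurent d)
              = AddMonoidAlgebra.single k 1 * AddMonoidAlgebra.single l 1 := by simp
          rw [this]; ring
        rw [h]
        have hm : ∀ k : IntLattice d, (AddMonoidAlgebra.single k 1 - 1 : Laurent d) ∈ augIdeal d := by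
          intro k
          rw [mem_augIdeal, map_sub, ev_single, map_one, expChar_apply]
          simp
        exact Ideal.mul_mem_mul (hm k) (hm l) }
  let G : IntLattice d →+ (Laurent d ⧸ augIdeal d ^ 2) :=
    { toFun := fun k => Ideal.Quotient.mk _ (∑ i, (k i : ℂ) • augGen i)
      map_zero' := by simp
      map_add' := fun k l => by
        rw [← map_add]
        congr 1
        simp [add_smul, Finset.sum_add_distrib] }
  have hFG : F = G := by
    refine AddMonoidHom.functions_ext' (M := fun _ : Fin d => ℤ) _ _ _ fun i => ?_
    ext
    change Ideal.Quotient.mk _ _ = Ideal.Quotient.mk _ _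
    congr 1
    rw [Finset.sum_eq_single i]
    · simp [augGen]
    · intro j _ hj; simp [hj]
    · simp
  have := DFunLike.congr_fun hFG k
  rw [← Ideal.Quotient.eq_zero_iff_mem]
  have h2 : Ideal.Quotient.mk (augIdeal d ^ 2) (AddMonoidAlgebra.single k 1 - 1)
    = Ideal.Quotient.mk (augIdeal d ^ 2) (∑ i, (k i : ℂ) • augGen i) := this
  rw [sub_right_comm, map_sub, h2, sub_self]

/-- The leading homogeneous part of an element of `I ^ n`, as a polynomial in the `z_i - 1`. -/
lemma exists_homogeneous_of_mem {n : ℕ} {u : Laurent d} (hu : u ∈ augIdeal d ^ n) :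
    ∃ P : MvPolynomial (Fin d) ℂ, P.IsHomogeneous n ∧
      u - MvPolynomial.aeval augGen P ∈ augIdeal d ^ (n + 1) := by
  have hone : ∀ q ∈ augIdeal d, ∃ P : MvPolynomial (Fin d) ℂ, P.IsHomogeneous 1 ∧
      q - MvPolynomial.aeval augGen P ∈ augIdeal d ^ 2 := by
    have hgen : ∀ q : Laurent d, ∃ P : MvPolynomial (Fin d) ℂ, P.IsHomogeneous 1 ∧
      q - ev 0 q • 1 - MvPolynomial.aeval augGen P ∈ augIdeal d ^ 2 := by
      intro q
      induction q using AddMonoidAlgebra.induction_linear with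
      | zero => exact ⟨0, MvPolynomial.isHomogeneous_zero _ _ _, by simp⟩
      | add q r hq hr =>
        obtain ⟨P, hP, h1⟩ := hq
        obtain ⟨Q, hQ, h2⟩ := hr
        refine ⟨P + Q, hP.add hQ, ?_⟩
        convert add_mem h1 h2 using 1
        simp only [map_add, add_smul]
        ring
      | single k c =>
        refine ⟨∑ i, MvPolynomial.C (c * (k i : ℂ)) * MvPolynomial.X i,
          MvPolynomial.IsHomogeneous.sum _ _ _ fun i _ => MvPolynomial.isHomogeneous_C_mul_X _ i, ?_⟩
        have h := (augIdeal d ^ 2).smul_of_tower_mem c (single_sub_one_mem k)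
        convert h using 1
        have e1 : (AddMonoidAlgebra.single k c : Laurent d) = c • AddMonoidAlgebra.single k 1 := by
          rw [AddMonoidAlgebra.smul_single, smul_eq_mul, mul_one]
        have e2 : ev 0 (AddMonoidAlgebra.single k c) = c := by
          rw [ev_single, expChar_apply]; simp
        rw [e2, e1, map_sum, smul_sub, smul_sub, Finset.smul_sum, sub_right_comm]
        congr 2
        refine Finset.sum_congr rfl fun i _ => ?_
        rw [map_mul, MvPolynomial.aeval_X, MvPolynomial.aeval_C, Algebra.algebraMap_eq_smul_one,
          smul_one_mul, smul_smul]
    intro q hq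
    obtain ⟨P, hP, h⟩ := hgen q
    exact ⟨P, hP, by simpa [mem_augIdeal.1 hq] using h⟩
  have haeval : ∀ {n : ℕ} {P : MvPolynomial (Fin d) ℂ}, P.IsHomogeneous n →
      MvPolynomial.aeval augGen P ∈ augIdeal d ^ n := by
    intro n P hP
    rw [MvPolynomial.aeval_def, MvPolynomial.eval₂_eq']
    refine sum_mem fun s hs => Ideal.mul_mem_left _ _ ?_
    have hs' : ∑ i, s i = n := by
      have := hP (MvPolynomial.mem_support_iff.1 hs)
      rw [← this, Finsupp.weight_apply, Finsupp.sum_fintype _ _ (by simp)]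
      simp
    rw [← hs', ← Finset.prod_pow_eq_pow_sum]
    exact Ideal.prod_mem_prod fun i _ => Ideal.pow_mem_pow (augGen_mem i) _
  induction n generalizing u with
  | zero =>
    refine ⟨MvPolynomial.C (ev 0 u), MvPolynomial.isHomogeneous_C _ _, ?_⟩
    rw [zero_add, pow_one, mem_augIdeal]
    simp
  | succ n ih =>
    rw [pow_succ] at hu
    refine Submodule.mul_induction_on hu (fun p hp q hq => ?_) (fun x y hx hy => ?_)
    · obtain ⟨P, hP, h1⟩ := ih hp
      obtain ⟨Q, hQ, h2⟩ := hone q hq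
      refine ⟨P * Q, hP.mul hQ, ?_⟩
      have e : p * q - MvPolynomial.aeval augGen (P * Q)
          = (p - MvPolynomial.aeval augGen P) * q
            + MvPolynomial.aeval augGen P * (q - MvPolynomial.aeval augGen Q) := by
        rw [map_mul]; ring
      rw [e]
      refine add_mem ?_ ?_
      · rw [pow_succ]; exact Ideal.mul_mem_mul h1 hq
      · rw [add_assoc, pow_add]; exact Ideal.mul_mem_mul (haeval hP) h2
    · obtain ⟨P, hP, h1⟩ := hx
      obtain ⟨Q, hQ, h2⟩ := hy
      refine ⟨P + Q, hP.add hQ, ?_⟩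
      convert add_mem h1 h2 using 1
      rw [map_add]; ring

lemma eval_smul_of_isHomogeneous {n : ℕ} {P : MvPolynomial (Fin d) ℂ} (hP : P.IsHomogeneous n)
    (c : ℂ) (x : Fin d → ℂ) :
    MvPolynomial.eval (c • x) P = c ^ n * MvPolynomial.eval x P := by
  rw [MvPolynomial.eval_eq', MvPolynomial.eval_eq', Finset.mul_sum]
  refine Finset.sum_congr rfl fun s hs => ?_
  have hs' : ∑ i, s i = n := by
    have := hP (MvPolynomial.mem_support_iff.1 hs)
    rw [← this, Finsupp.weight_apply, Finsupp.sum_fintype _ _ (by simp)]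
    simp
  simp only [Pi.smul_apply, smul_eq_mul, mul_pow, Finset.prod_mul_distrib]
  rw [Finset.prod_pow_eq_pow_sum, hs']
  ring

/-- A Laurent polynomial whose trigonometric polynomial is `O(‖ξ‖^n)` lies in the `n`-th power of
the augmentation ideal: the leading homogeneous part vanishes along every line. -/
lemma mem_augIdeal_pow_of_isBigO {n : ℕ} {u : Laurent d}
    (hu : (fun ξ => ev ξ u) =O[𝓝 0] fun ξ => ‖ξ‖ ^ n) : u ∈ augIdeal d ^ n := by
  suffices h : ∀ k ≤ n, u ∈ augIdeal d ^ k from h n le_rfl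
  intro k
  induction k with
  | zero => simp
  | succ k ih =>
    intro hk
    obtain ⟨P, hP, hw⟩ := exists_homogeneous_of_mem (ih (by omega))
    suffices hP0 : P = 0 by simpa [hP0] using hw
    have hO : (fun ξ => ev ξ (MvPolynomial.aeval augGen P)) =O[𝓝 0] fun ξ => ‖ξ‖ ^ (k + 1) := by
      have h1 : (fun ξ : RSpace d => ‖ξ‖ ^ n) =O[𝓝 0] fun ξ => ‖ξ‖ ^ (k + 1) := by
        refine IsBigO.of_bound 1 ?_
        filter_upwards [Metric.ball_mem_nhds (0 : RSpace d) one_pos] with ξ hξ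
        rw [mem_ball_zero_iff] at hξ
        simp only [norm_pow, norm_norm, one_mul]
        exact pow_le_pow_of_le_one (norm_nonneg _) hξ.le hk
      have h2 := (hu.trans h1).sub (ev_isBigO_of_mem_augIdeal_pow hw)
      simpa only [map_sub, sub_sub_cancel] using h2
    refine MvPolynomial.funext_set (fun _ => Set.range (fun x : ℝ => (x : ℂ)))
      (fun _ => Set.infinite_range_of_injective Complex.ofReal_injective) fun x hx => ?_
    have hx' : ∀ i, ∃ y : ℝ, (y : ℂ) = x i := fun i => hx i (Set.mem_univ i)
    choose y hy using hx'
    let ξ : RSpace d := WithLp.toLp 2 y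
    -- rescaled increments of the generators along the line through `ξ`
    let g : ℝ → Fin d → ℂ := fun t i => (t : ℂ)⁻¹ * ev (t • ξ) (augGen i)
    have hg : Tendsto g (𝓝[≠] 0) (𝓝 (-Complex.I • x)) := by
      rw [tendsto_pi_nhds]
      intro i
      have h3 : HasDerivAt (fun t : ℝ => ev (t • ξ) (augGen i)) (-Complex.I * x i) 0 := by
        simp only [ev_augGen]
        have h4 : HasDerivAt (fun t : ℝ => -(Complex.I * (((t • ξ) i : ℝ) : ℂ)))
            (-Complex.I * x i) 0 := by
          have : (fun t : ℝ => -(Complex.I * (((t • ξ) i : ℝ) : ℂ)))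
              = fun t : ℝ => (-Complex.I * x i) * (t : ℂ) := by
            funext t; simp [ξ, hy]; ring
          rw [this]
          simpa using (Complex.ofRealCLM.hasDerivAt (x := (0 : ℝ))).const_mul (-Complex.I * x i)
        simpa using (h4.cexp).sub_const 1
      have h5 := h3.tendsto_slope_zero
      simp only [zero_add, zero_smul, mem_augIdeal.1 (augGen_mem i), sub_zero] at h5
      simpa [g] using h5
    have h6 : Tendsto (fun t => MvPolynomial.eval (g t) P) (𝓝[≠] 0)
        (𝓝 (MvPolynomial.eval (-Complex.I • x) P)) :=
      ((MvPolynomial.continuous_eval P).tendsto _).comp hg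
    have h7 : ∀ t : ℝ, MvPolynomial.eval (g t) P
        = (t : ℂ)⁻¹ ^ k * ev (t • ξ) (MvPolynomial.aeval augGen P) := by
      intro t
      have : g t = (t : ℂ)⁻¹ • fun i => ev (t • ξ) (augGen i) := by funext i; simp [g]
      rw [this, eval_smul_of_isHomogeneous hP, ← MvPolynomial.coe_aeval_eq_eval]
      congr 1
      change MvPolynomial.aeval _ P = _
      rw [← MvPolynomial.comp_aeval_apply]
    have h8 : Tendsto (fun t => MvPolynomial.eval (g t) P) (𝓝[≠] 0) (𝓝 0) := by
      have h9 : Tendsto (fun t : ℝ => t • ξ) (𝓝[≠] 0) (𝓝 0) := by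
        have : Tendsto (fun t : ℝ => t • ξ) (𝓝 0) (𝓝 ((0 : ℝ) • ξ)) := by
          exact (continuous_id.smul continuous_const).tendsto _
        rw [zero_smul] at this
        exact this.mono_left nhdsWithin_le_nhds
      obtain ⟨C, hC⟩ := (hO.comp_tendsto h9).bound
      have h10 : Tendsto (fun t : ℝ => C * ‖ξ‖ ^ (k + 1) * |t|) (𝓝[≠] 0) (𝓝 0) := by
        have : Tendsto (fun t : ℝ => C * ‖ξ‖ ^ (k + 1) * |t|) (𝓝 0)
            (𝓝 (C * ‖ξ‖ ^ (k + 1) * |0|)) := (continuous_const.mul continuous_abs).tendsto _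
        simp only [abs_zero, mul_zero] at this
        exact this.mono_left nhdsWithin_le_nhds
      refine squeeze_zero_norm' ?_ h10
      filter_upwards [hC, self_mem_nhdsWithin] with t ht ht0
      have ht0 : t ≠ 0 := ht0
      have hpos : 0 < |t| := abs_pos.2 ht0
      rw [h7, norm_mul, norm_pow, norm_inv, Complex.norm_real, Real.norm_eq_abs]
      simp only [Function.comp_apply, norm_pow, norm_smul, Real.norm_eq_abs, abs_mul, abs_abs,
        abs_norm] at ht
      calc |t|⁻¹ ^ k * ‖ev (t • ξ) (MvPolynomial.aeval augGen P)‖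
          ≤ |t|⁻¹ ^ k * (C * (|t| * ‖ξ‖) ^ (k + 1)) := by gcongr
        _ = C * ‖ξ‖ ^ (k + 1) * |t| := by
          rw [inv_pow, mul_pow, pow_succ |t|]
          field_simp
    -- hence `P` vanishes at `-i x` for every real `x`
    have h11 := tendsto_nhds_unique h6 h8
    rw [eval_smul_of_isHomogeneous hP] at h11
    have h12 : (-Complex.I) ^ k ≠ 0 := pow_ne_zero _ (by simp)
    simpa [h12] using h11

end vanishing

/-! ### Approximation by trigonometric polynomials at the origin -/

section jets
variable {d : ℕ}

/-- `f` agrees with a trigonometric polynomial up to `O(‖ξ‖^n)` at the origin. -/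
def IsTrigJet (n : ℕ) (f : RSpace d → ℂ) : Prop :=
  ∃ u : Laurent d, (fun ξ => f ξ - ev ξ u) =O[𝓝 0] fun ξ => ‖ξ‖ ^ n

lemma ev_isBigO_one (u : Laurent d) : (fun ξ => ev ξ u) =O[𝓝 0] fun _ => (1 : ℝ) :=
  ((continuous_ev u).tendsto 0).isBigO_one ℝ

lemma norm_pow_isBigO_one (n : ℕ) : (fun ξ : RSpace d => ‖ξ‖ ^ n) =O[𝓝 0] fun _ => (1 : ℝ) :=
  ((continuous_norm.pow n).tendsto (0 : RSpace d)).isBigO_one ℝ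

lemma IsTrigJet.isBigO_one {n : ℕ} {f : RSpace d → ℂ} (hf : IsTrigJet n f) :
    f =O[𝓝 0] fun _ => (1 : ℝ) := by
  obtain ⟨u, hu⟩ := hf
  simpa using (hu.trans (norm_pow_isBigO_one n)).add (ev_isBigO_one u)

lemma IsTrigJet.add {n : ℕ} {f g : RSpace d → ℂ} (hf : IsTrigJet n f) (hg : IsTrigJet n g) :
    IsTrigJet n (fun ξ => f ξ + g ξ) := by
  obtain ⟨u, hu⟩ := hf
  obtain ⟨w, hw⟩ := hg
  exact ⟨u + w, (hu.add hw).congr_left fun ξ => by simp only [map_add]; ring⟩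

lemma IsTrigJet.mul {n : ℕ} {f g : RSpace d → ℂ} (hf : IsTrigJet n f) (hg : IsTrigJet n g) :
    IsTrigJet n (fun ξ => f ξ * g ξ) := by
  have hg1 := hg.isBigO_one
  obtain ⟨u, hu⟩ := hf
  obtain ⟨w, hw⟩ := hg
  refine ⟨u * w, ?_⟩
  have h1 := hu.mul hg1
  have h2 := (ev_isBigO_one u).mul hw
  simp only [mul_one, one_mul] at h1 h2
  exact (h1.add h2).congr_left fun ξ => by simp only [map_mul]; ring

lemma isTrigJet_const (n : ℕ) (c : ℂ) : IsTrigJet n (fun _ : RSpace d => c) :=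
  ⟨c • 1, by simpa using isBigO_zero _ _⟩

lemma isTrigJet_sum {ι : Type*} (s : Finset ι) {n : ℕ} {f : ι → RSpace d → ℂ}
    (hf : ∀ i ∈ s, IsTrigJet n (f i)) : IsTrigJet n (fun ξ => ∑ i ∈ s, f i ξ) := by
  classical
  induction s using Finset.induction_on with
  | empty => simpa using isTrigJet_const n 0
  | insert i s hi ih =>
    simp only [Finset.sum_insert hi]
    exact (hf i (by simp)).add (ih fun j hj => hf j (by simp [hj]))

lemma isTrigJet_prod {ι : Type*} (s : Finset ι) {n : ℕ} {f : ι → RSpace d → ℂ}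
    (hf : ∀ i ∈ s, IsTrigJet n (f i)) : IsTrigJet n (fun ξ => ∏ i ∈ s, f i ξ) := by
  classical
  induction s using Finset.induction_on with
  | empty => simpa using isTrigJet_const n 1
  | insert i s hi ih =>
    simp only [Finset.prod_insert hi]
    exact (hf i (by simp)).mul (ih fun j hj => hf j (by simp [hj]))

lemma IsTrigJet.of_isBigO {n : ℕ} {f g : RSpace d → ℂ} (hg : IsTrigJet n g)
    (h : (fun ξ => f ξ - g ξ) =O[𝓝 0] fun ξ => ‖ξ‖ ^ n) : IsTrigJet n f := by
  obtain ⟨u, hu⟩ := hg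
  exact ⟨u, by simpa using h.add hu⟩

/-- The coordinate functions are approximated by the truncated series
`-iξ_j = log(1 + (z_j - 1)) = ∑ (-1)^(k+1) (z_j - 1)^k / k`. -/
lemma isTrigJet_coord (n : ℕ) (i : Fin d) : IsTrigJet n (fun ξ : RSpace d => (ξ i : ℂ)) := by
  suffices h : IsTrigJet n (fun ξ : RSpace d => -(Complex.I * (ξ i : ℂ))) by
    convert (isTrigJet_const n Complex.I).mul h using 2 with ξ
    rw [mul_neg, ← mul_assoc, Complex.I_mul_I]; simp
  let u : Laurent d := ∑ j ∈ Finset.range (n + 1), ((-1 : ℂ) ^ (j + 1) / j) • augGen i ^ j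
  have hev : ∀ ξ, ev ξ u = Complex.logTaylor (n + 1) (ev ξ (augGen i)) := by
    intro ξ
    simp only [u, map_sum, map_smul, map_pow, smul_eq_mul, Complex.logTaylor]
    exact Finset.sum_congr rfl fun j _ => by ring
  refine ⟨u, ?_⟩
  have hO := ev_isBigO_of_mem_augIdeal (augGen_mem i)
  have htend : Tendsto (fun ξ : RSpace d => ev ξ (augGen i)) (𝓝 0) (𝓝 0) := by
    have := (continuous_ev (augGen i)).tendsto 0
    rwa [mem_augIdeal.1 (augGen_mem i)] at this
  have h1 : (fun ξ : RSpace d => -(Complex.I * (ξ i : ℂ)) - ev ξ u)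
      =O[𝓝 0] fun ξ => ‖ev ξ (augGen i)‖ ^ (n + 1) := by
    refine IsBigO.of_bound 2 ?_
    have hball : ∀ᶠ ξ : RSpace d in 𝓝 0, ‖ev ξ (augGen i)‖ < 1 / 2 := by
      have := htend.norm
      rw [norm_zero] at this
      exact this.eventually_lt_const (by norm_num)
    have hcoord : ∀ᶠ ξ : RSpace d in 𝓝 0, |ξ i| < Real.pi := by
      have : Continuous fun ξ : RSpace d => |ξ i| := by fun_prop
      have := this.tendsto 0
      simp only [PiLp.zero_apply, abs_zero] at this
      exact this.eventually_lt_const Real.pi_pos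
    filter_upwards [hball, hcoord] with ξ h2 h3
    rw [abs_lt] at h3
    have hlog : Complex.log (1 + ev ξ (augGen i)) = -(Complex.I * (ξ i : ℂ)) := by
      rw [ev_augGen, add_sub_cancel, Complex.log_exp] <;> simp <;> linarith
    rw [hev, ← hlog]
    refine (Complex.norm_log_sub_logTaylor_le n (h2.trans (by norm_num))).trans ?_
    simp only [norm_pow, norm_norm]
    have h4 : (1 - ‖ev ξ (augGen i)‖)⁻¹ ≤ 2 := by
      rw [inv_le_comm₀ (by linarith) (by norm_num)]; linarith
    have h5 : (1 : ℝ) ≤ n + 1 := by linarith [Nat.cast_nonneg (α := ℝ) n]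
    calc _ ≤ ‖ev ξ (augGen i)‖ ^ (n + 1) * 2 / 1 := by gcongr
      _ = _ := by ring
  refine h1.trans ?_
  have h2 := (hO.norm_left.pow (n + 1)).mul (isBigO_refl (fun _ : RSpace d => (1 : ℝ)) (𝓝 0))
  have h3 : (fun ξ : RSpace d => ‖ξ‖ ^ (n + 1)) =O[𝓝 0] fun ξ => ‖ξ‖ ^ n := by
    have := (norm_pow_isBigO_one (d := d) 1).mul (isBigO_refl (fun ξ : RSpace d => ‖ξ‖ ^ n) (𝓝 0))
    refine (this.congr (fun ξ => ?_) (fun ξ => ?_)) <;> ring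
  simp only [mul_one] at h2
  exact h2.trans h3

/-- A compactly supported integrable function remains integrable after multiplication by a
continuous function. -/
lemma integrable_mul_continuous {f : RSpace d → ℂ} (hf : Integrable f) (hfc : HasCompactSupport f)
    {g : RSpace d → ℂ} (hg : Continuous g) : Integrable fun x => f x * g x := by
  have h := IntegrableOn.mul_continuousOn (K := tsupport f) hf.integrableOn hg.continuousOn hfc
  rwa [integrableOn_iff_integrable_of_support_subset] at h
  intro x hx
  refine subset_tsupport f fun h0 => hx ?_
  simp [h0]

/-- The Fourier transform of a compactly supported integrable function is approximated by
trigonometric polynomials to any order, by way of its Taylor polynomial. -/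
lemma isTrigJet_fnHat {f : RSpace d → ℂ} (hf : Integrable f) (hfc : HasCompactSupport f) (n : ℕ) :
    IsTrigJet n (fnHat f) := by
  have hint : ∀ j : ℕ, ∀ ξ : RSpace d,
      Integrable fun x => f x * ((-(Complex.I * ((inner ℝ x ξ : ℝ) : ℂ))) ^ j / (j.factorial : ℂ)) :=
    fun j ξ => integrable_mul_continuous hf hfc (by fun_prop)
  let T : RSpace d → ℂ := fun ξ => ∑ j ∈ Finset.range n,
    ∫ x, f x * ((-(Complex.I * ((inner ℝ x ξ : ℝ) : ℂ))) ^ j / (j.factorial : ℂ))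
  have hT : IsTrigJet n T := by
    refine isTrigJet_sum _ fun j _ => ?_
    have h1 : ∀ ξ : RSpace d,
        ∫ x, f x * ((-(Complex.I * ((inner ℝ x ξ : ℝ) : ℂ))) ^ j / (j.factorial : ℂ))
        = ∑ p : Fin j → Fin d, (∫ x, f x * (((-Complex.I) ^ j / (j.factorial : ℂ))
            * ∏ i, (x (p i) : ℂ))) * ∏ i, (ξ (p i) : ℂ) := by
      intro ξ
      simp only [← integral_mul_const]
      rw [← integral_finsetSum]
      · refine integral_congr_ae (Eventually.of_forall fun x => ?_)
        have h2 : ((inner ℝ x ξ : ℝ) : ℂ) = ∑ i, (x i : ℂ) * (ξ i : ℂ) := by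
          simp [PiLp.inner_apply, mul_comm]
        simp only
        rw [← neg_mul, mul_pow, h2, Fintype.sum_pow, mul_div_right_comm, Finset.mul_sum,
          Finset.mul_sum]
        refine Finset.sum_congr rfl fun p _ => ?_
        rw [Finset.prod_mul_distrib]
        ring
      · intro p _
        exact (integrable_mul_continuous hf hfc (by fun_prop)).mul_const _
    simp only [h1]
    exact isTrigJet_sum _ fun p _ => (isTrigJet_const n _).mul
      (isTrigJet_prod _ fun i _ => isTrigJet_coord n _)
  refine hT.of_isBigO ?_
  obtain ⟨R, hR⟩ := hfc.isBounded.exists_norm_le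
  have hR0 : ∀ x, f x ≠ 0 → ‖x‖ ≤ max R 0 := fun x hx =>
    (hR x (subset_tsupport f hx)).trans (le_max_left _ _)
  set R' := max R 0
  have hR'0 : 0 ≤ R' := le_max_right _ _
  refine IsBigO.of_bound ((∫ x, ‖f x‖) * (R' ^ n * Real.exp R')) ?_
  filter_upwards [Metric.ball_mem_nhds (0 : RSpace d) one_pos] with ξ hξ
  rw [mem_ball_zero_iff] at hξ
  have h3 : fnHat f ξ - T ξ = ∫ x, f x * (Complex.exp (-(Complex.I * ((inner ℝ x ξ : ℝ) : ℂ)))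
      - ∑ j ∈ Finset.range n, (-(Complex.I * ((inner ℝ x ξ : ℝ) : ℂ))) ^ j / (j.factorial : ℂ)) := by
    simp only [T, fnHat]
    rw [← integral_finsetSum _ fun j _ => hint j ξ, ← integral_sub]
    · refine integral_congr_ae (Eventually.of_forall fun x => ?_)
      simp only [mul_sub, Finset.mul_sum]
    · exact integrable_mul_continuous hf hfc (by fun_prop)
    · exact integrable_finsetSum _ fun j _ => hint j ξ
  rw [h3, norm_pow, norm_norm]
  refine (norm_integral_le_integral_norm _).trans ?_
  rw [mul_assoc, ← integral_mul_const]
  refine integral_mono (integrable_mul_continuous hf hfc (by fun_prop)).norm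
    (hf.norm.mul_const _) fun x => ?_
  simp only [norm_mul]
  by_cases hx : f x = 0
  · simp [hx]
  gcongr
  refine (Complex.norm_exp_sub_sum_le_norm_mul_exp _ n).trans ?_
  have h4 : ‖-(Complex.I * ((inner ℝ x ξ : ℝ) : ℂ))‖ ≤ R' * ‖ξ‖ := by
    rw [norm_neg, norm_mul, Complex.norm_I, one_mul, Complex.norm_real]
    exact (norm_inner_le_norm x ξ).trans (by gcongr; exact hR0 x hx)
  calc _ ≤ (R' * ‖ξ‖) ^ n * Real.exp (R' * 1) := by
        gcongr
        exact h4.trans (by gcongr)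
    _ = _ := by rw [mul_one]; ring

/-- A function with nonzero value at the origin that is approximated by trigonometric polynomials
has an approximate inverse among them, given by a geometric series. -/
lemma IsTrigJet.exists_inverse {n : ℕ} (hn : n ≠ 0) {f : RSpace d → ℂ} (hf : IsTrigJet n f)
    (h0 : f 0 ≠ 0) :
    ∃ θ : Laurent d, (fun ξ => ev ξ θ * f ξ - 1) =O[𝓝 0] fun ξ => ‖ξ‖ ^ n := by
  obtain ⟨u, hu⟩ := hf
  have hu0 : ev 0 u = f 0 := by
    have := hu.eq_zero_imp.self_of_nhds (by simp [hn])
    exact (sub_eq_zero.1 this).symm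
  let w : Laurent d := 1 - (f 0)⁻¹ • u
  have hw : w ∈ augIdeal d := by
    rw [mem_augIdeal, map_sub, map_smul, hu0, map_one, smul_eq_mul, inv_mul_cancel₀ h0, sub_self]
  let θ : Laurent d := (f 0)⁻¹ • ∑ j ∈ Finset.range n, w ^ j
  refine ⟨θ, ?_⟩
  have h1 : θ * u - 1 = -w ^ n := by
    have h2 := geom_sum_mul_neg w n
    have h3 : 1 - w = (f 0)⁻¹ • u := by simp [w]
    rw [h3, mul_smul_comm] at h2
    rw [show θ * u = 1 - w ^ n by rw [← h2, smul_mul_assoc]]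
    ring
  have h4 : (fun ξ => ev ξ (θ * u - 1)) =O[𝓝 0] fun ξ => ‖ξ‖ ^ n := by
    rw [h1]
    exact ev_isBigO_of_mem_augIdeal_pow (neg_mem (Ideal.pow_mem_pow hw n))
  have h5 := (ev_isBigO_one θ).mul hu
  simp only [one_mul] at h5
  exact (h5.add h4).congr_left fun ξ => by simp only [map_sub, map_mul, map_one]; ring

end jets

/-! ### The moment-correcting filters -/

section correction
variable {d : ℕ} {M : Matrix (Fin d) (Fin d) ℤ}

lemma continuous_act (A : Matrix (Fin d) (Fin d) ℤ) : Continuous (act A) := by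
  unfold act
  fun_prop

lemma act_zero (A : Matrix (Fin d) (Fin d) ℤ) : act A (0 : RSpace d) = 0 := by
  ext i; simp [act]

lemma act_isBigO (A : Matrix (Fin d) (Fin d) ℤ) : (fun ξ => act A ξ) =O[𝓝 0] fun ξ => ξ := by
  let F : RSpace d →ₗ[ℝ] RSpace d :=
    { toFun := act A, map_add' := act_add A, map_smul' := act_smul A }
  exact F.toContinuousLinearMap.isBigO_id _

/-- The sum rules say that the modulated mask lies in a power of the augmentation ideal. -/
lemma modul_mem_of_hasSumRules {a : Mask d} {m : ℕ} {v : Mask d} (h : HasSumRules M a m v) :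
    ∀ ω ∈ Omega M, ω ≠ 0 →
      modul ((2 * Real.pi) • ω) (AddMonoidAlgebra.ofCoeff a) ∈ augIdeal d ^ m := by
  intro ω hω h0
  refine mem_augIdeal_pow_of_isBigO ?_
  have h1 := h.2 ω hω
  simp only [h0, if_false, zero_mul, sub_zero] at h1
  simp only [ev_modul, ← maskHat_eq_ev]
  have h2 : Tendsto (fun ξ : RSpace d => (maskHat v (act Mᵀ ξ))⁻¹) (𝓝 0) (𝓝 (maskHat v 0)⁻¹) := by
    refine Tendsto.inv₀ ?_ h.1
    simp only [maskHat_eq_ev]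
    have := ((continuous_ev (AddMonoidAlgebra.ofCoeff v)).comp (continuous_act Mᵀ)).tendsto 0
    simpa [act_zero, Function.comp_def] using this
  have h3 := (h2.isBigO_one ℝ).mul h1
  simp only [one_mul] at h3
  refine h3.congr' ?_ EventuallyEq.rfl
  have h4 := h2.eventually_ne (inv_ne_zero h.1)
  filter_upwards [h4] with ξ hξ
  rw [← mul_assoc, inv_mul_cancel₀ (fun h => hξ (by rw [h, inv_zero])), one_mul]

/-- If `θ̂ ≈ 1/φ̂` and `θ̂' ≈ 1/φ̂'` to order `n`, then `Θ = θ^⋆ * θ'` satisfies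
`Θ̂(ξ) - conj â(ξ) Θ̂(Mᵀξ) â'(ξ) = O(‖ξ‖^n)`. -/
lemma sub_mem_augIdeal_pow {n : ℕ} {f f' : RSpace d → ℂ} {a a' θ θ' : Laurent d}
    (hf : ContinuousAt f 0) (hf' : ContinuousAt f' 0) (h0 : f 0 ≠ 0) (h0' : f' 0 ≠ 0)
    (href : ∀ ξ, f (act Mᵀ ξ) = ev ξ a * f ξ) (href' : ∀ ξ, f' (act Mᵀ ξ) = ev ξ a' * f' ξ)
    (hθ : (fun ξ => ev ξ θ * f ξ - 1) =O[𝓝 0] fun ξ => ‖ξ‖ ^ n)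
    (hθ' : (fun ξ => ev ξ θ' * f' ξ - 1) =O[𝓝 0] fun ξ => ‖ξ‖ ^ n) :
    adj θ * θ' - adj a * up M (adj θ * θ') * a' ∈ augIdeal d ^ n := by
  refine mem_augIdeal_pow_of_isBigO ?_
  let P : RSpace d → ℂ := fun ξ => conj (ev ξ θ * f ξ) * (ev ξ θ' * f' ξ) - 1
  have hP : P =O[𝓝 0] fun ξ => ‖ξ‖ ^ n := by
    have h1 : (fun ξ => conj (ev ξ θ * f ξ - 1)) =O[𝓝 0] fun ξ => ‖ξ‖ ^ n := by
      refine (IsBigO.of_bound 1 (Eventually.of_forall fun ξ => ?_)).trans hθ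
      rw [RCLike.norm_conj, one_mul]
    have h2 : (fun ξ => ev ξ θ' * f' ξ) =O[𝓝 0] fun _ => (1 : ℝ) :=
      (((continuous_ev θ').continuousAt.mul hf').tendsto).isBigO_one ℝ
    have h3 := h1.mul h2
    simp only [mul_one] at h3
    refine (h3.add hθ').congr_left fun ξ => ?_
    simp only [P, map_sub, map_mul, map_one]
    ring
  have hPM : (fun ξ => P (act Mᵀ ξ)) =O[𝓝 0] fun ξ => ‖ξ‖ ^ n := by
    have ht : Tendsto (fun ξ : RSpace d => act Mᵀ ξ) (𝓝 0) (𝓝 0) := by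
      simpa [act_zero] using (continuous_act Mᵀ).tendsto (0 : RSpace d)
    exact (hP.comp_tendsto ht).trans ((act_isBigO Mᵀ).norm_norm.pow n)
  have hQ : ContinuousAt (fun ξ => (conj (f ξ) * f' ξ)⁻¹) 0 :=
    ((Complex.continuous_conj.continuousAt.comp hf).mul hf').inv₀ (by simp [h0, h0'])
  have h4 := (hP.sub hPM).mul (hQ.tendsto.isBigO_one ℝ)
  simp only [mul_one] at h4
  -- `θ̂ φ̂` and `θ̂' φ̂'` are `1 + O(‖ξ‖^n)`, both at `ξ` and at `Mᵀ ξ`; the refinement equations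
  -- allow the division of the difference by `conj φ̂(ξ) φ̂'(ξ)`
  refine h4.congr' ?_ EventuallyEq.rfl
  filter_upwards [hf.eventually_ne h0, hf'.eventually_ne h0'] with ξ h5 h6
  have h7 : conj (f ξ) ≠ 0 := by simpa using h5
  simp only [P, map_sub, map_mul, ev_adj, ev_up, href, href']
  field_simp
  ring

end correction

/-! ### Translations and dilations of `L²` -/

/-- The Hilbert space `L²(ℝ^d)`. -/
abbrev L2Space (d : ℕ) : Type := Lp ℂ 2 (volume : Measure (RSpace d))

section operators
variable {d : ℕ}

lemma inner_toLp {f g : RSpace d → ℂ} (hf : MemLp f 2 volume) (hg : MemLp g 2 volume) :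
    inner ℂ (hg.toLp g) (hf.toLp f) = pairing f g := by
  rw [L2.inner_def, pairing]
  refine integral_congr_ae ?_
  filter_upwards [hf.coeFn_toLp, hg.coeFn_toLp] with x h1 h2
  rw [h1, h2, RCLike.inner_apply]

lemma norm_sq_eq_integral (f : L2Space d) : ‖f‖ ^ 2 = ∫ x, ‖f x‖ ^ 2 := by
  have h := inner_self_eq_norm_sq_to_K (𝕜 := ℂ) f
  rw [L2.inner_def] at h
  have h2 : ∀ x, inner ℂ (f x) (f x) = ((‖f x‖ ^ 2 : ℝ) : ℂ) := by
    intro x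
    rw [inner_self_eq_norm_sq_to_K]; norm_cast
  simp only [h2] at h
  rw [integral_complex_ofReal] at h
  refine (Complex.ofReal_injective (h.trans ?_)).symm
  push_cast
  rfl

/-- Translation `g ↦ g(· - t)`. -/
def transL (t : RSpace d) : L2Space d →ₗᵢ[ℂ] L2Space d :=
  Lp.compMeasurePreservingₗᵢ ℂ (fun x => x - t) (measurePreserving_sub_right volume t)

lemma memLp_trans {g : RSpace d → ℂ} (hg : MemLp g 2 volume) (t : RSpace d) :
    MemLp (fun x => g (x - t)) 2 volume :=
  hg.comp_measurePreserving (measurePreserving_sub_right volume t)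

lemma transL_toLp {g : RSpace d → ℂ} (hg : MemLp g 2 volume) (t : RSpace d) :
    transL t (hg.toLp g) = (memLp_trans hg t).toLp _ := rfl

lemma exists_toLp (g : L2Space d) : ∃ (f : RSpace d → ℂ) (hf : MemLp f 2 volume), hf.toLp f = g :=
  ⟨g, Lp.memLp g, Lp.toLp_coeFn g (Lp.memLp g)⟩

lemma transL_add (s t : RSpace d) (g : L2Space d) : transL (s + t) g = transL s (transL t g) := by
  obtain ⟨f, hf, rfl⟩ := exists_toLp g
  simp only [transL_toLp]
  exact MemLp.toLp_congr _ _ (Eventually.of_forall fun x => by simp only [sub_sub])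

@[simp] lemma transL_zero (g : L2Space d) : transL 0 g = g := by
  obtain ⟨f, hf, rfl⟩ := exists_toLp g
  simp only [transL_toLp]
  exact MemLp.toLp_congr _ _ (Eventually.of_forall fun x => by simp only [sub_zero])

lemma inner_transL_left (t : RSpace d) (f g : L2Space d) :
    inner ℂ (transL t f) g = inner ℂ f (transL (-t) g) := by
  rw [← (transL (-t)).inner_map_map, ← transL_add, neg_add_cancel, transL_zero]

lemma continuous_transL (g : L2Space d) : Continuous fun t => transL t g := by
  let F : RSpace d → C(RSpace d, RSpace d) := fun t => ⟨fun x => x - t, by fun_prop⟩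
  have hF : Continuous F := ContinuousMap.continuous_of_continuous_uncurry _ (by
    simp only [F, Function.uncurry_def, ContinuousMap.coe_mk]; fun_prop)
  have hm : ∀ t, MeasurePreserving (F t) volume volume :=
    fun t => measurePreserving_sub_right volume t
  exact Continuous.compMeasurePreservingLp (p := 2) (continuous_const (y := g)) hF hm (by norm_num)

/-- The action of an integer matrix on `ℝ^d`, as a linear map. -/
def actLin (A : Matrix (Fin d) (Fin d) ℤ) : RSpace d →ₗ[ℝ] RSpace d :=
  Matrix.toLpLin 2 2 (A.map (Int.cast : ℤ → ℝ))

lemma det_actLin (A : Matrix (Fin d) (Fin d) ℤ) : LinearMap.det (actLin A) = (A.det : ℝ) := by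
  rw [actLin, LinearMap.det_toLpLin]
  exact (Int.castRingHom ℝ).map_det A |>.symm

lemma map_act_volume {A : Matrix (Fin d) (Fin d) ℤ} (hA : A.det ≠ 0) :
    Measure.map (act A) volume = ENNReal.ofReal (|(A.det : ℝ)|⁻¹) • (volume : Measure (RSpace d)) := by
  have h : LinearMap.det (actLin A) ≠ 0 := by rw [det_actLin]; exact_mod_cast hA
  have := Measure.map_linearMap_addHaar_eq_smul_addHaar volume h
  rw [det_actLin, abs_inv] at this
  exact this

lemma measurable_act (A : Matrix (Fin d) (Fin d) ℤ) : Measurable (act A : RSpace d → RSpace d) :=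
  (continuous_act A).measurable

lemma quasiMeasurePreserving_act {A : Matrix (Fin d) (Fin d) ℤ} (hA : A.det ≠ 0) :
    Measure.QuasiMeasurePreserving (act A : RSpace d → RSpace d) volume volume :=
  ⟨measurable_act A, by
    rw [map_act_volume hA]; exact Measure.smul_absolutelyContinuous⟩

lemma act_mul (A B : Matrix (Fin d) (Fin d) ℤ) (x : RSpace d) : act (A * B) x = act A (act B x) := by
  ext i
  simp only [act]
  rw [Matrix.mulVec_mulVec, ← Matrix.map_mul_intCast]

lemma act_one (x : RSpace d) : act (1 : Matrix (Fin d) (Fin d) ℤ) x = x := by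
  ext i
  simp [act]

lemma integral_comp_act {A : Matrix (Fin d) (Fin d) ℤ} (hA : A.det ≠ 0) (f : RSpace d → ℂ) :
    ∫ x, f (act A x) = (|(A.det : ℝ)|⁻¹ : ℝ) • ∫ x, f x := by
  have h : LinearMap.det (actLin A) ≠ 0 := by rw [det_actLin]; exact_mod_cast hA
  have hemb : MeasurableEmbedding (act A : RSpace d → RSpace d) := by
    let e := LinearMap.equivOfDetNeZero _ h
    exact e.toContinuousLinearEquiv.toHomeomorph.measurableEmbedding
  rw [← hemb.integral_map, map_act_volume hA, integral_smul_measure,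
    ENNReal.toReal_ofReal (by positivity)]

/-- The normalized dilation `|det A|^{1/2} g(A ·)` of a function. -/
def dilFun (A : Matrix (Fin d) (Fin d) ℤ) (g : RSpace d → ℂ) : RSpace d → ℂ :=
  fun x => ((√(|(A.det : ℝ)|) : ℝ) : ℂ) * g (act A x)

lemma eLpNorm_dilFun {A : Matrix (Fin d) (Fin d) ℤ} (hA : A.det ≠ 0) {g : RSpace d → ℂ}
    (hg : AEStronglyMeasurable g volume) : eLpNorm (dilFun A g) 2 volume = eLpNorm g 2 volume := by
  have h1 : dilFun A g = ((√(|(A.det : ℝ)|) : ℝ) : ℂ) • (g ∘ act A) := rfl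
  have h2 : eLpNorm (g ∘ act A) 2 volume
      = eLpNorm g 2 (ENNReal.ofReal (|(A.det : ℝ)|⁻¹) • (volume : Measure (RSpace d))) := by
    rw [← map_act_volume hA, eLpNorm_map_measure _ (measurable_act A).aemeasurable]
    rw [map_act_volume hA]
    exact hg.smul_measure _
  have hpos : 0 < |(A.det : ℝ)| := abs_pos.2 (by exact_mod_cast hA)
  rw [h1, eLpNorm_const_smul, h2, eLpNorm_smul_measure_of_ne_top (by norm_num), smul_eq_mul,
    ← mul_assoc]
  have h3 : ‖((√(|(A.det : ℝ)|) : ℝ) : ℂ)‖ₑ = ENNReal.ofReal (√(|(A.det : ℝ)|)) := by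
    rw [← ofReal_norm, Complex.norm_real, Real.norm_of_nonneg (Real.sqrt_nonneg _)]
  have h4 : ENNReal.ofReal (|(A.det : ℝ)|⁻¹) ^ (1 / (2 : ℝ≥0∞)).toReal
      = ENNReal.ofReal (√(|(A.det : ℝ)|))⁻¹ := by
    rw [ENNReal.ofReal_rpow_of_nonneg (by positivity) (by positivity), ← Real.sqrt_inv,
      Real.sqrt_eq_rpow]
    simp
  rw [h3, h4, ← ENNReal.ofReal_mul (by positivity), mul_inv_cancel₀ (by positivity),
    ENNReal.ofReal_one, one_mul]

lemma memLp_dilFun {A : Matrix (Fin d) (Fin d) ℤ} (hA : A.det ≠ 0) {g : RSpace d → ℂ}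
    (hg : MemLp g 2 volume) : MemLp (dilFun A g) 2 volume := by
  refine ⟨?_, ?_⟩
  · exact (hg.1.comp_quasiMeasurePreserving (quasiMeasurePreserving_act hA)).const_mul _
  · rw [eLpNorm_dilFun hA hg.1]
    exact hg.2

lemma dilFun_congr {A : Matrix (Fin d) (Fin d) ℤ} (hA : A.det ≠ 0) {f g : RSpace d → ℂ}
    (h : f =ᵐ[volume] g) : dilFun A f =ᵐ[volume] dilFun A g := by
  filter_upwards [(quasiMeasurePreserving_act hA).ae_eq_comp h] with x hx
  have hx : f (act A x) = g (act A x) := hx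
  simp only [dilFun, hx]

/-- The unitary dilation `g ↦ |det A|^{1/2} g(A ·)`. -/
def dil (A : Matrix (Fin d) (Fin d) ℤ) (hA : A.det ≠ 0) : L2Space d →ₗᵢ[ℂ] L2Space d where
  toFun g := (memLp_dilFun hA (Lp.memLp g)).toLp _
  map_add' f g := by
    rw [← MemLp.toLp_add]
    refine MemLp.toLp_congr _ _ ((dilFun_congr hA (Lp.coeFn_add f g)).trans ?_)
    exact Eventually.of_forall fun x => by simp [dilFun, mul_add]
  map_smul' c g := by
    rw [RingHom.id_apply, ← MemLp.toLp_const_smul]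
    refine MemLp.toLp_congr _ _ ((dilFun_congr hA (Lp.coeFn_smul c g)).trans ?_)
    exact Eventually.of_forall fun x => by simp [dilFun]; ring
  norm_map' g := by
    change ‖(memLp_dilFun hA (Lp.memLp g)).toLp _‖ = _
    rw [Lp.norm_toLp, eLpNorm_dilFun hA (Lp.aestronglyMeasurable g), Lp.norm_def]

lemma dil_toLp {A : Matrix (Fin d) (Fin d) ℤ} (hA : A.det ≠ 0) {g : RSpace d → ℂ}
    (hg : MemLp g 2 volume) : dil A hA (hg.toLp g) = (memLp_dilFun hA hg).toLp _ :=
  MemLp.toLp_congr (memLp_dilFun hA (Lp.memLp _)) _ (dilFun_congr hA hg.coeFn_toLp)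

lemma act_sub (A : Matrix (Fin d) (Fin d) ℤ) (x y : RSpace d) :
    act A (x - y) = act A x - act A y := map_sub (actLin A) x y

lemma act_neg (A : Matrix (Fin d) (Fin d) ℤ) (x : RSpace d) : act A (-x) = -act A x :=
  map_neg (actLin A) x

lemma transL_dil {A : Matrix (Fin d) (Fin d) ℤ} (hA : A.det ≠ 0) (t : RSpace d) (g : L2Space d) :
    transL t (dil A hA g) = dil A hA (transL (act A t) g) := by
  obtain ⟨f, hf, rfl⟩ := exists_toLp g
  simp only [dil_toLp, transL_toLp]
  exact MemLp.toLp_congr _ _ (Eventually.of_forall fun x => by simp only [dilFun, act_sub])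

lemma dil_mul {A B : Matrix (Fin d) (Fin d) ℤ} (hA : A.det ≠ 0) (hB : B.det ≠ 0)
    (hAB : (A * B).det ≠ 0) (g : L2Space d) :
    dil (A * B) hAB g = dil B hB (dil A hA g) := by
  obtain ⟨f, hf, rfl⟩ := exists_toLp g
  simp only [dil_toLp]
  refine MemLp.toLp_congr _ _ (Eventually.of_forall fun x => ?_)
  simp only [dilFun, act_mul]
  rw [Matrix.det_mul, Int.cast_mul, abs_mul, Real.sqrt_mul (abs_nonneg _)]
  push_cast
  ring

end operators

/-! ### Bessel bounds for lattice translates -/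

section translates
variable {d : ℕ}

lemma coeFn_transL (t : RSpace d) (g : L2Space d) :
    transL t g =ᵐ[volume] fun x => g (x - t) :=
  Lp.coeFn_compMeasurePreserving g (measurePreserving_sub_right volume t)

/-- `g` vanishes almost everywhere outside the ball of radius `R`. -/
def SuppIn (R : ℝ) (g : L2Space d) : Prop := ∀ᵐ x, R < ‖x‖ → g x = 0

lemma SuppIn.transL {R : ℝ} {g : L2Space d} (hg : SuppIn R g) (t : RSpace d) :
    ∀ᵐ x, R < ‖x - t‖ → transL t g x = 0 := by
  have h := (measurePreserving_sub_right (volume : Measure (RSpace d)) t).quasiMeasurePreserving.ae hg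
  filter_upwards [coeFn_transL t g, h] with x h1 h2 h3
  rw [h1, h2 h3]

lemma SuppIn.transL' {R : ℝ} {g : L2Space d} (hg : SuppIn R g) (t : RSpace d) :
    SuppIn (R + ‖t‖) (OEPFramelet.transL t g) := by
  filter_upwards [hg.transL t] with x h1 h2
  refine h1 ?_
  have := norm_sub_norm_le x t
  linarith

lemma SuppIn.mono {R R' : ℝ} {g : L2Space d} (hg : SuppIn R g) (h : R ≤ R') : SuppIn R' g := by
  filter_upwards [hg] with x h1 h2 using h1 (h.trans_lt h2)

lemma SuppIn.sub {R : ℝ} {f g : L2Space d} (hf : SuppIn R f) (hg : SuppIn R g) :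
    SuppIn R (f - g) := by
  filter_upwards [hf, hg, Lp.coeFn_sub f g] with x h1 h2 h3 h4
  rw [h3, Pi.sub_apply, h1 h4, h2 h4, sub_zero]

lemma exists_suppIn {f : RSpace d → ℂ} (hf : MemLp f 2 volume) (hfc : HasCompactSupport f) :
    ∃ R, 0 ≤ R ∧ SuppIn R (hf.toLp f) := by
  obtain ⟨R, hR⟩ := hfc.isBounded.exists_norm_le
  refine ⟨max R 0, le_max_right _ _, ?_⟩
  filter_upwards [hf.coeFn_toLp] with x h1 h2
  rw [h1]
  by_contra h
  exact absurd (hR x (subset_tsupport f h)) (not_le.2 ((le_max_left _ _).trans_lt h2))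

/-- A bound for the number of lattice points in a ball of radius `R`. -/
def overlap (d : ℕ) (R : ℝ) : ℝ := ((2 * ⌈R⌉₊ + 1) ^ d : ℕ)

lemma overlap_nonneg (d : ℕ) (R : ℝ) : 0 ≤ overlap d R := Nat.cast_nonneg _

lemma abs_apply_le_norm (x : RSpace d) (i : Fin d) : |x i| ≤ ‖x‖ := PiLp.norm_apply_le x i

open Classical in
lemma card_filter_le_overlap (F : Finset (IntLattice d)) (x : RSpace d) (R : ℝ) :
    ((F.filter fun k => ‖x - latticeVec k‖ ≤ R).card : ℝ) ≤ overlap d R := by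
  unfold overlap
  set n := ⌈R⌉₊
  have hn : R ≤ n := Nat.le_ceil R
  have hsub : (F.filter fun k => ‖x - latticeVec k‖ ≤ R)
      ⊆ Fintype.piFinset fun i => Finset.Icc (⌈x i⌉ - n) (⌊x i⌋ + n) := by
    intro k hk
    rw [Finset.mem_filter] at hk
    rw [Fintype.mem_piFinset]
    intro i
    have h1 : |x i - k i| ≤ n := ((abs_apply_le_norm (x - latticeVec k) i).trans hk.2).trans hn
    rw [abs_le] at h1
    rw [Finset.mem_Icc]
    constructor
    · have : ⌈x i⌉ ≤ k i + n := by
        rw [Int.ceil_le]; push_cast; linarith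
      linarith
    · have : k i - n ≤ ⌊x i⌋ := by
        rw [Int.le_floor]; push_cast; linarith
      linarith
  refine Nat.cast_le.2 ((Finset.card_le_card hsub).trans ?_)
  rw [Fintype.card_piFinset]
  calc _ ≤ ∏ _i : Fin d, (2 * n + 1) := by
        refine Finset.prod_le_prod' fun i _ => ?_
        rw [Int.card_Icc]
        have := Int.floor_le_ceil (x i)
        omega
    _ = _ := by simp

/-- Bessel bound for the lattice translates of a compactly supported function. -/
lemma sum_norm_inner_transL_sq_le {R : ℝ} {g : L2Space d} (hg : SuppIn R g) (f : L2Space d)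
    (F : Finset (IntLattice d)) :
    ∑ k ∈ F, ‖inner ℂ (transL (latticeVec k) g) f‖ ^ 2 ≤ overlap d R * ‖g‖ ^ 2 * ‖f‖ ^ 2 := by
  classical
  let B : IntLattice d → Set (RSpace d) := fun k => Metric.closedBall (latticeVec k) R
  have hB : ∀ k, MeasurableSet (B k) := fun k => Metric.isClosed_closedBall.measurableSet
  let fk : IntLattice d → L2Space d := fun k => ((Lp.memLp f).indicator (hB k)).toLp _
  have hfk : ∀ k, fk k =ᵐ[volume] (B k).indicator f := fun k => MemLp.coeFn_toLp _
  have hint : Integrable fun x => ‖f x‖ ^ 2 := (Lp.memLp f).norm.integrable_sq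
  have h1 : ∀ k, inner ℂ (transL (latticeVec k) g) f = inner ℂ (transL (latticeVec k) g) (fk k) := by
    intro k
    rw [L2.inner_def, L2.inner_def]
    refine integral_congr_ae ?_
    filter_upwards [hg.transL (latticeVec k), hfk k] with x h2 h3
    rw [h3]
    by_cases hx : x ∈ B k
    · rw [Set.indicator_of_mem hx]
    · rw [h2 (by simpa [B, dist_eq_norm] using hx)]; simp
  have h2 : ∀ k, ‖fk k‖ ^ 2 = ∫ x, (B k).indicator (fun x => ‖f x‖ ^ 2) x := by
    intro k
    rw [norm_sq_eq_integral]
    refine integral_congr_ae ?_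
    filter_upwards [hfk k] with x h3
    rw [h3]
    by_cases hx : x ∈ B k <;> simp [hx]
  calc ∑ k ∈ F, ‖inner ℂ (transL (latticeVec k) g) f‖ ^ 2
      ≤ ∑ k ∈ F, ‖g‖ ^ 2 * ∫ x, (B k).indicator (fun x => ‖f x‖ ^ 2) x := by
        refine Finset.sum_le_sum fun k _ => ?_
        rw [h1, ← h2, ← mul_pow]
        gcongr
        simpa using norm_inner_le_norm (𝕜 := ℂ) (transL (latticeVec k) g) (fk k)
    _ = ‖g‖ ^ 2 * ∫ x, ∑ k ∈ F, (B k).indicator (fun x => ‖f x‖ ^ 2) x := by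
        rw [← Finset.mul_sum, integral_finsetSum]
        exact fun k _ => hint.indicator (hB k)
    _ ≤ ‖g‖ ^ 2 * ∫ x, overlap d R * ‖f x‖ ^ 2 := by
        refine mul_le_mul_of_nonneg_left (integral_mono (integrable_finsetSum _ fun k _ =>
          hint.indicator (hB k)) (hint.const_mul _) fun x => ?_) (sq_nonneg _)
        have h3 : ∑ k ∈ F, (B k).indicator (fun x => ‖f x‖ ^ 2) x
            = (F.filter fun k => ‖x - latticeVec k‖ ≤ R).card * ‖f x‖ ^ 2 := by
          rw [← nsmul_eq_mul, ← Finset.sum_const, Finset.sum_filter]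
          refine Finset.sum_congr rfl fun k _ => ?_
          simp [Set.indicator_apply, B, dist_eq_norm]
        simp only
        rw [h3]
        exact mul_le_mul_of_nonneg_right (card_filter_le_overlap F x R) (sq_nonneg _)
    _ = _ := by rw [integral_const_mul, ← norm_sq_eq_integral]; ring

/-- A Bessel bound also bounds the synthesis operator, which is the adjoint of the analysis
operator. -/
lemma norm_sum_smul_sq_le_of_bessel {H ι : Type*} [NormedAddCommGroup H] [InnerProductSpace ℂ H]
    (g : ι → H) (F : Finset ι) {B : ℝ} (hB0 : 0 ≤ B)
    (hB : ∀ f, ∑ i ∈ F, ‖inner ℂ (g i) f‖ ^ 2 ≤ B * ‖f‖ ^ 2)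
    (c : ι → ℂ) : ‖∑ i ∈ F, c i • g i‖ ^ 2 ≤ B * ∑ i ∈ F, ‖c i‖ ^ 2 := by
  set h := ∑ i ∈ F, c i • g i with hh
  have h1 : ‖h‖ ^ 2 ≤ ∑ i ∈ F, ‖c i‖ * ‖inner ℂ (g i) h‖ := by
    have h2 : ‖h‖ ^ 2 = ‖inner ℂ h h‖ := by
      rw [inner_self_eq_norm_sq_to_K]; simp
    rw [h2]
    conv_lhs => enter [1, 2]; rw [hh]
    rw [sum_inner]
    refine (norm_sum_le _ _).trans (Finset.sum_le_sum fun i _ => ?_)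
    rw [inner_smul_left, norm_mul, RCLike.norm_conj]
  have h3 := Finset.sum_mul_sq_le_sq_mul_sq F (fun i => ‖c i‖) (fun i => ‖inner ℂ (g i) h‖)
  have h4 := hB h
  have h5 : 0 ≤ ∑ i ∈ F, ‖c i‖ ^ 2 := Finset.sum_nonneg fun i _ => sq_nonneg _
  have h6 : (‖h‖ ^ 2) ^ 2 ≤ (B * ∑ i ∈ F, ‖c i‖ ^ 2) * ‖h‖ ^ 2 := by
    calc (‖h‖ ^ 2) ^ 2 ≤ (∑ i ∈ F, ‖c i‖ * ‖inner ℂ (g i) h‖) ^ 2 := by gcongr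
      _ ≤ _ := h3
      _ ≤ (∑ i ∈ F, ‖c i‖ ^ 2) * (B * ‖h‖ ^ 2) := by gcongr
      _ = _ := by ring
  by_cases h0 : ‖h‖ = 0
  · rw [h0]; simpa using mul_nonneg hB0 h5
  · have : 0 < ‖h‖ ^ 2 := by positivity
    nlinarith

end translates

/-! ### Exponential decay of linear recurrences -/

/-- In finite dimension, an orbit of a linear map that tends to zero does so geometrically. -/
lemma exists_geometric_bound {E : Type*} [NormedAddCommGroup E] [NormedSpace ℂ E]
    [FiniteDimensional ℂ E] (U : E →ₗ[ℂ] E) (x : ℕ → E) (hx : ∀ n, x (n + 1) = U (x n))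
    (h0 : Tendsto x atTop (𝓝 0)) :
    ∃ C ρ : ℝ, 0 < ρ ∧ ρ < 1 ∧ ∀ n, ‖x n‖ ≤ C * ρ ^ n := by
  have hxU : ∀ n m, x (n + m) = (U ^ n) (x m) := by
    intro n m
    induction n with
    | zero => simp
    | succ n ih => rw [Nat.succ_add, hx, ih, pow_succ']; rfl
  let W : Submodule ℂ E := Submodule.span ℂ (Set.range x)
  have hWU : ∀ w ∈ W, U w ∈ W := by
    intro w hw
    induction hw using Submodule.span_induction with
    | mem w h => obtain ⟨n, rfl⟩ := h; rw [← hx]; exact Submodule.subset_span ⟨_, rfl⟩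
    | zero => simp
    | add a b _ _ ha hb => rw [map_add]; exact add_mem ha hb
    | smul c a _ ha => rw [map_smul]; exact Submodule.smul_mem _ _ ha
  have hlim : ∀ w ∈ W, Tendsto (fun n => (U ^ n) w) atTop (𝓝 0) := by
    intro w hw
    induction hw using Submodule.span_induction with
    | mem w h =>
      obtain ⟨m, rfl⟩ := h
      simp only [← hxU]
      exact h0.comp (tendsto_add_atTop_nat m)
    | zero => simp
    | add a b _ _ ha hb => simpa using ha.add hb
    | smul c a _ ha => simpa using ha.const_smul c
  let V : W →ₗ[ℂ] W := U.restrict hWU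
  have hV : ∀ (n : ℕ) (w : W), ((V ^ n) w : E) = (U ^ n) w := by
    intro n w
    induction n with
    | zero => simp
    | succ n ih => rw [pow_succ', pow_succ', Module.End.mul_apply, Module.End.mul_apply, ← ih]; rfl
  -- some power of the restricted map is a contraction
  obtain ⟨N, hN0, hN⟩ : ∃ N, 0 < N ∧ ∀ w : W, ‖(V ^ N) w‖ ≤ 1 / 2 * ‖w‖ := by
    let b := Module.finBasis ℂ W
    obtain ⟨K, hK0, hK⟩ := b.exists_opNorm_le (F := W)
    have hev : ∀ᶠ n in atTop, ∀ i, ‖(V ^ n) (b i)‖ ≤ 1 / (2 * K) := by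
      rw [eventually_all]
      intro i
      have h1 := (hlim (b i) (b i).2).norm
      rw [norm_zero] at h1
      filter_upwards [h1.eventually_le_const (show (0 : ℝ) < 1 / (2 * K) by positivity)] with n hn
      rw [← hV] at hn
      exact hn
    obtain ⟨N, hN, hN0⟩ := (hev.and (eventually_gt_atTop 0)).exists
    refine ⟨N, hN0, fun w => ?_⟩
    have h2 := hK (u := LinearMap.toContinuousLinearMap (V ^ N)) (M := 1 / (2 * K)) (by positivity) hN
    calc ‖(V ^ N) w‖ ≤ ‖LinearMap.toContinuousLinearMap (V ^ N)‖ * ‖w‖ :=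
          (LinearMap.toContinuousLinearMap (V ^ N)).le_opNorm w
      _ ≤ (K * (1 / (2 * K))) * ‖w‖ := by gcongr
      _ = 1 / 2 * ‖w‖ := by field_simp
  have hstep : ∀ n, ‖x (N + n)‖ ≤ 1 / 2 * ‖x n‖ := by
    intro n
    have := hN ⟨x n, Submodule.subset_span ⟨n, rfl⟩⟩
    rw [hxU, ← hV N ⟨x n, Submodule.subset_span ⟨n, rfl⟩⟩]
    exact this
  let ρ : ℝ := (1 / 2 : ℝ) ^ (1 / N : ℝ)
  have hρ0 : 0 < ρ := by positivity
  have hρ1 : ρ < 1 := Real.rpow_lt_one (by norm_num) (by norm_num) (by positivity)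
  have hρN : ρ ^ N = 1 / 2 := by
    rw [← Real.rpow_natCast, ← Real.rpow_mul (by norm_num), one_div_mul_cancel (by positivity),
      Real.rpow_one]
  -- the norm halves every `N` steps, and `ρ ^ N = 1 / 2`
  refine ⟨∑ r ∈ Finset.range N, ‖x r‖ / ρ ^ r, ρ, hρ0, hρ1, fun n => ?_⟩
  induction n using Nat.strong_induction_on with
  | _ n ih =>
    by_cases hn : n < N
    · have := Finset.single_le_sum (f := fun r => ‖x r‖ / ρ ^ r) (fun r _ => by positivity)
        (Finset.mem_range.2 hn)
      calc ‖x n‖ = ‖x n‖ / ρ ^ n * ρ ^ n := by field_simp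
        _ ≤ _ := by gcongr
    · obtain ⟨r, rfl⟩ := Nat.exists_eq_add_of_le (not_lt.1 hn)
      calc ‖x (N + r)‖ ≤ 1 / 2 * ‖x r‖ := hstep r
        _ ≤ 1 / 2 * ((∑ r ∈ Finset.range N, ‖x r‖ / ρ ^ r) * ρ ^ r) := by
          gcongr; exact ih r (by omega)
        _ = _ := by rw [pow_add, hρN]; ring

/-! ### Smoothness of refinable functions -/

section smoothness
variable {d : ℕ} {M : Matrix (Fin d) (Fin d) ℤ}

/-- The autocorrelation `⟨φ(· - t), φ⟩`, with the arguments in the order of Mathlib. -/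
def autocorr (φ : L2Space d) (t : RSpace d) : ℂ := inner ℂ φ (transL t φ)

lemma continuous_autocorr (φ : L2Space d) : Continuous (autocorr φ) :=
  continuous_const.inner (continuous_transL φ)

lemma autocorr_eq_zero {R : ℝ} {φ : L2Space d} (hφ : SuppIn R φ) {t : RSpace d}
    (ht : 2 * R < ‖t‖) : autocorr φ t = 0 := by
  rw [autocorr, L2.inner_def]
  refine integral_eq_zero_of_ae ?_
  filter_upwards [hφ, hφ.transL t] with x h1 h2
  by_cases hx : R < ‖x‖
  · simp [h1 hx]
  · rw [h2 ?_]
    · simp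
    have := norm_sub_norm_le t x
    rw [norm_sub_rev] at this
    linarith

lemma norm_transL_sub_sq (φ : L2Space d) (t : RSpace d) :
    ‖transL t φ - φ‖ ^ 2 = 2 * (autocorr φ 0 - autocorr φ t).re := by
  have h := norm_sub_sq (𝕜 := ℂ) φ (transL t φ)
  rw [norm_sub_rev, h, LinearIsometry.norm_map, autocorr, autocorr, transL_zero,
    inner_self_eq_norm_sq_to_K, Complex.sub_re]
  have : (((‖φ‖ : ℂ)) ^ 2).re = ‖φ‖ ^ 2 := by norm_cast
  simp only [RCLike.re_to_complex, Complex.coe_algebraMap, this]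
  ring

/-- Two-scale relation of the autocorrelation of a refinable function. -/
lemma autocorr_refine (hM : M.det ≠ 0) {φ : L2Space d} (S : Finset (IntLattice d))
    (α : IntLattice d → ℂ)
    (hφ : φ = ∑ k ∈ S, α k • dil M hM (transL (latticeVec k) φ)) {s t : RSpace d}
    (hst : act M s = t) :
    autocorr φ s = ∑ l ∈ S, ∑ k ∈ S, conj (α l) * α k *
      autocorr φ (t + latticeVec k - latticeVec l) := by
  have h1 : autocorr φ s = inner ℂ (∑ l ∈ S, α l • dil M hM (transL (latticeVec l) φ))
      (transL s (∑ k ∈ S, α k • dil M hM (transL (latticeVec k) φ))) := by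
    rw [← hφ]; rfl
  rw [h1, sum_inner]
  refine Finset.sum_congr rfl fun l _ => ?_
  rw [map_sum, inner_sum]
  refine Finset.sum_congr rfl fun k _ => ?_
  rw [map_smul, inner_smul_left, inner_smul_right, transL_dil, LinearIsometry.inner_map_map,
    inner_transL_left, hst, ← transL_add, ← transL_add, autocorr, mul_assoc]
  congr 5
  abel

/-- A compactly supported refinable function in `L²` has some smoothness: its translates by
`M^{-n} q` converge to it geometrically fast. The autocorrelation, sampled along the orbit on
lattice cosets, satisfies a linear recurrence in finite dimension, and tends to its value at `0`
because translation is continuous in `L²`. -/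
lemma summable_norm_transL_sub (hM : M.det ≠ 0) {R : ℝ} {φ : L2Space d} (hR : SuppIn R φ)
    (S : Finset (IntLattice d)) (α : IntLattice d → ℂ)
    (hφ : φ = ∑ k ∈ S, α k • dil M hM (transL (latticeVec k) φ)) {t : ℕ → RSpace d}
    (ht : ∀ n, act M (t (n + 1)) = t n) (ht0 : Tendsto t atTop (𝓝 0)) :
    Summable fun n => ‖transL (t n) φ - φ‖ := by
  classical
  obtain ⟨T, hT⟩ : ∃ T, ∀ n, ‖t n‖ ≤ T := by
    obtain ⟨T, hT⟩ := (Metric.isBounded_range_of_tendsto t ht0).exists_norm_le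
    exact ⟨T, fun n => hT _ ⟨n, rfl⟩⟩
  have hT0 : 0 ≤ T := (norm_nonneg _).trans (hT 0)
  -- the lattice points at which the sampled autocorrelations can be nonzero
  let n₀ := ⌈2 * R + T⌉₊
  let B : Finset (IntLattice d) := Fintype.piFinset fun _ => Finset.Icc (-(n₀ : ℤ)) n₀
  have hB : ∀ (s : RSpace d) (r : IntLattice d), ‖s‖ ≤ T → r ∉ B →
      autocorr φ (s + latticeVec r) = 0 := by
    intro s r hs hr
    refine autocorr_eq_zero hR ?_
    by_contra hcon
    rw [not_lt] at hcon
    apply hr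
    rw [Fintype.mem_piFinset]
    intro i
    have h1 : ‖latticeVec r‖ ≤ 2 * R + T := by
      have := norm_sub_le (s + latticeVec r) s
      rw [add_sub_cancel_left] at this
      linarith
    have h2 : |(r i : ℝ)| ≤ n₀ := ((abs_apply_le_norm (latticeVec r) i).trans h1).trans (Nat.le_ceil _)
    rw [abs_le] at h2
    rw [Finset.mem_Icc]
    exact ⟨by exact_mod_cast h2.1, by exact_mod_cast h2.2⟩
  -- the two-scale relation of the autocorrelation, as a linear map `U` of the finite-dimensional
  -- space `B → ℂ` that takes the samples on `t n + ℤ^d` to those on `t (n + 1) + ℤ^d`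
  let ext : (B → ℂ) → IntLattice d → ℂ := fun y r => if h : r ∈ B then y ⟨r, h⟩ else 0
  let U : (B → ℂ) →ₗ[ℂ] (B → ℂ) :=
    { toFun := fun y r => ∑ l ∈ S, ∑ k ∈ S, conj (α l) * α k * ext y (latMap M r.1 + k - l)
      map_add' := fun y z => by
        funext r
        simp only [Pi.add_apply, ← Finset.sum_add_distrib]
        refine Finset.sum_congr rfl fun l _ => Finset.sum_congr rfl fun k _ => ?_
        simp only [ext]
        split_ifs <;> simp [mul_add]
      map_smul' := fun c y => by
        funext r
        simp only [RingHom.id_apply, Pi.smul_apply, smul_eq_mul, Finset.mul_sum]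
        refine Finset.sum_congr rfl fun l _ => Finset.sum_congr rfl fun k _ => ?_
        simp only [ext]
        split_ifs <;> simp; ring }
  let y : RSpace d → B → ℂ := fun s r => autocorr φ (s + latticeVec r.1)
  have hext : ∀ (s : RSpace d), ‖s‖ ≤ T → ∀ r, ext (y s) r = autocorr φ (s + latticeVec r) := by
    intro s hs r
    simp only [ext, y]
    split_ifs with h
    · rfl
    · exact (hB s r hs h).symm
  have hU : ∀ s s' : RSpace d, act M s' = s → ‖s‖ ≤ T → U (y s) = y s' := by
    intro s s' hs hsT
    funext r
    change ∑ l ∈ S, ∑ k ∈ S, conj (α l) * α k * ext (y s) (latMap M r.1 + k - l)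
      = autocorr φ (s' + latticeVec r.1)
    have h1 : act M (s' + latticeVec r.1) = s + latticeVec (latMap M r.1) := by
      rw [act_add, hs, latticeVec_latMap]
    rw [autocorr_refine hM S α hφ h1]
    refine Finset.sum_congr rfl fun l _ => Finset.sum_congr rfl fun k _ => ?_
    rw [hext s hsT, latticeVec_sub, latticeVec_add]
    congr 2
    abel
  -- the samples on `ℤ^d` itself are a fixed point of `U`, so the differences form an orbit
  obtain ⟨C, ρ, hρ0, hρ1, hC⟩ := exists_geometric_bound U (fun n => y (t n) - y 0)
    (fun n => by rw [map_sub, hU _ _ (ht n) (hT n), hU 0 0 (act_zero M) (by simpa using hT0)])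
    (by
      have hc : Continuous y := by
        refine continuous_pi fun r => (continuous_autocorr φ).comp (by fun_prop)
      have := (hc.tendsto 0).comp ht0
      simpa using this.sub_const (y 0))
  have h0B : (0 : IntLattice d) ∈ B := by
    rw [Fintype.mem_piFinset]; intro i; simp
  have hbound : ∀ n, ‖transL (t n) φ - φ‖ ≤ √(2 * C) * (√ρ) ^ n := by
    intro n
    have h1 : ‖transL (t n) φ - φ‖ ^ 2 ≤ 2 * C * ρ ^ n := by
      rw [norm_transL_sub_sq]
      have h2 := norm_le_pi_norm (y (t n) - y 0) ⟨0, h0B⟩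
      have h3 : (y (t n) - y 0) ⟨0, h0B⟩ = autocorr φ (t n) - autocorr φ 0 := by simp [y]
      rw [h3, norm_sub_rev] at h2
      have h4 := (Complex.re_le_norm (autocorr φ 0 - autocorr φ (t n))).trans (h2.trans (hC n))
      linarith
    rw [← Real.sqrt_sq (norm_nonneg (transL (t n) φ - φ))]
    refine (Real.sqrt_le_sqrt h1).trans ?_
    have hC0 : 0 ≤ 2 * C := by
      have := (norm_nonneg _).trans (hC 0)
      simp at this
      linarith
    have h5 : √(ρ ^ n) = √ρ ^ n := by
      rw [Real.sqrt_eq_iff_mul_self_eq (by positivity) (by positivity), ← mul_pow,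
        Real.mul_self_sqrt hρ0.le]
    rw [Real.sqrt_mul hC0, h5]
  refine Summable.of_nonneg_of_le (fun n => norm_nonneg _) hbound
    ((summable_geometric_of_lt_one (Real.sqrt_nonneg _) ?_).mul_left _)
  rw [Real.sqrt_lt' one_pos]
  simpa using hρ1

end smoothness

/-! ### Almost orthogonality and the Bessel property of the wavelets -/

/-- `ε (max i j - min i j)` is `ε |i - j|`, without truncated subtraction. -/
lemma sum_dist_le {ε : ℕ → ℝ} (hε0 : ∀ n, 0 ≤ ε n) (hε : Summable ε) (i J : ℕ) :
    ∑ j ∈ Finset.range J, ε (max i j - min i j) ≤ 2 * ∑' n, ε n := by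
  have h1 : ∀ j, ε (max i j - min i j)
      ≤ (if j < i + 1 then ε (i - j) else 0) + (if i ≤ j then ε (j - i) else 0) := by
    intro j
    rcases le_total i j with h | h
    · rw [max_eq_right h, min_eq_left h, if_pos h]
      split_ifs
      · linarith [hε0 (i - j)]
      · simp
    · rw [max_eq_left h, min_eq_right h, if_pos (by omega)]
      split_ifs
      · linarith [hε0 (j - i)]
      · simp
  refine (Finset.sum_le_sum fun j _ => h1 j).trans ?_
  rw [Finset.sum_add_distrib, two_mul]
  refine add_le_add ?_ ?_
  · calc ∑ j ∈ Finset.range J, (if j < i + 1 then ε (i - j) else 0)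
        = ∑ j ∈ (Finset.range J).filter (· < i + 1), ε (i - j) := (Finset.sum_filter _ _).symm
      _ ≤ ∑ j ∈ Finset.range (i + 1), ε (i - j) :=
          Finset.sum_le_sum_of_subset_of_nonneg (fun j hj => by simp at hj ⊢; omega)
            fun _ _ _ => hε0 _
      _ = ∑ j ∈ Finset.range (i + 1), ε j := by
          rw [← Finset.sum_range_reflect]
          refine Finset.sum_congr rfl fun j hj => ?_
          rw [Finset.mem_range] at hj
          congr 1
          omega
      _ ≤ _ := hε.sum_le_tsum _ fun n _ => hε0 n
  · calc ∑ j ∈ Finset.range J, (if i ≤ j then ε (j - i) else 0)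
        = ∑ j ∈ (Finset.range J).filter (i ≤ ·), ε (j - i) := (Finset.sum_filter _ _).symm
      _ = ∑ j ∈ Finset.Ico i J, ε (j - i) := by
          refine Finset.sum_congr ?_ fun _ _ => rfl
          ext j; simp; omega
      _ = ∑ j ∈ Finset.range (J - i), ε j := by
          rw [Finset.sum_Ico_eq_sum_range]
          exact Finset.sum_congr rfl fun j _ => by congr 1; omega
      _ ≤ _ := hε.sum_le_tsum _ fun n _ => hε0 n

/-- Schur's test for a kernel that depends on the distance of the indices. -/
lemma sum_sum_mul_le {ε : ℕ → ℝ} (hε0 : ∀ n, 0 ≤ ε n) (hε : Summable ε) (J : ℕ) (x : ℕ → ℝ) :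
    ∑ i ∈ Finset.range J, ∑ j ∈ Finset.range J, ε (max i j - min i j) * (x i * x j)
      ≤ 2 * (∑' n, ε n) * ∑ j ∈ Finset.range J, x j ^ 2 := by
  have h1 : ∀ i j, ε (max i j - min i j) * (x i * x j)
      ≤ ε (max i j - min i j) * (x i ^ 2 / 2) + ε (max j i - min j i) * (x j ^ 2 / 2) := by
    intro i j
    rw [max_comm j i, min_comm j i, ← mul_add]
    exact mul_le_mul_of_nonneg_left (by nlinarith [sq_nonneg (x i - x j)]) (hε0 _)
  have h2 : ∀ i, ∑ j ∈ Finset.range J, ε (max i j - min i j) * (x i ^ 2 / 2)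
      ≤ 2 * (∑' n, ε n) * (x i ^ 2 / 2) := by
    intro i
    rw [← Finset.sum_mul]
    exact mul_le_mul_of_nonneg_right (sum_dist_le hε0 hε i J) (by positivity)
  calc _ ≤ ∑ i ∈ Finset.range J, ∑ j ∈ Finset.range J, (ε (max i j - min i j) * (x i ^ 2 / 2)
          + ε (max j i - min j i) * (x j ^ 2 / 2)) :=
        Finset.sum_le_sum fun i _ => Finset.sum_le_sum fun j _ => h1 i j
    _ = (∑ i ∈ Finset.range J, ∑ j ∈ Finset.range J, ε (max i j - min i j) * (x i ^ 2 / 2))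
        + ∑ j ∈ Finset.range J, ∑ i ∈ Finset.range J, ε (max j i - min j i) * (x j ^ 2 / 2) := by
        simp only [Finset.sum_add_distrib]
        congr 1
        rw [Finset.sum_comm]
    _ ≤ (∑ i ∈ Finset.range J, 2 * (∑' n, ε n) * (x i ^ 2 / 2))
        + ∑ i ∈ Finset.range J, 2 * (∑' n, ε n) * (x i ^ 2 / 2) :=
        add_le_add (Finset.sum_le_sum fun i _ => h2 i) (Finset.sum_le_sum fun i _ => h2 i)
    _ = _ := by rw [← Finset.mul_sum, ← Finset.sum_div]; ring

/-- `g` is a Bessel family with bound `B`. -/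
def IsBessel {H ι : Type*} [NormedAddCommGroup H] [InnerProductSpace ℂ H] (g : ι → H) (B : ℝ) :
    Prop :=
  ∀ (f : H) (F : Finset ι), ∑ i ∈ F, ‖inner ℂ (g i) f‖ ^ 2 ≤ B * ‖f‖ ^ 2

/-- Almost orthogonality: if the synthesis operators of the levels have inner products that decay
summably in the distance of the levels, then the whole family is Bessel. -/
lemma isBessel_of_almost_orthogonal {H κ : Type*} [NormedAddCommGroup H] [InnerProductSpace ℂ H]
    (g : ℕ → κ → H) {ε : ℕ → ℝ} (hε0 : ∀ n, 0 ≤ ε n) (hε : Summable ε)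
    (hcross : ∀ (i n : ℕ) (c e : κ → ℂ) (F : Finset κ),
      ‖inner ℂ (∑ l ∈ F, e l • g i l) (∑ k ∈ F, c k • g (i + n) k)‖
        ≤ ε n * (√(∑ l ∈ F, ‖e l‖ ^ 2) * √(∑ k ∈ F, ‖c k‖ ^ 2))) :
    IsBessel (fun p : ℕ × κ => g p.1 p.2) (2 * ∑' n, ε n) := by
  classical
  intro f F
  obtain ⟨J, hJ⟩ : ∃ J, F ⊆ Finset.range J ×ˢ F.image Prod.snd := by
    refine ⟨F.sup Prod.fst + 1, fun p hp => ?_⟩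
    rw [Finset.mem_product, Finset.mem_range]
    exact ⟨Nat.lt_succ_of_le (Finset.le_sup (f := Prod.fst) hp), Finset.mem_image_of_mem _ hp⟩
  set G := F.image Prod.snd
  refine (Finset.sum_le_sum_of_subset_of_nonneg hJ fun _ _ _ => sq_nonneg _).trans ?_
  rw [Finset.sum_product]
  let c : ℕ → κ → ℂ := fun j k => inner ℂ (g j k) f
  -- `h j` is the component of the frame operator applied to `f` at level `j`
  let h : ℕ → H := fun j => ∑ k ∈ G, c j k • g j k
  let x : ℕ → ℝ := fun j => √(∑ k ∈ G, ‖c j k‖ ^ 2)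
  have hx : ∀ j, x j ^ 2 = ∑ k ∈ G, ‖c j k‖ ^ 2 := fun j =>
    Real.sq_sqrt (Finset.sum_nonneg fun _ _ => sq_nonneg _)
  change ∑ j ∈ Finset.range J, ∑ k ∈ G, ‖c j k‖ ^ 2 ≤ _
  simp only [← hx]
  set X := ∑ j ∈ Finset.range J, x j ^ 2 with hX
  set K := 2 * ∑' n, ε n
  have hK : 0 ≤ K := mul_nonneg zero_le_two (tsum_nonneg hε0)
  have hX0 : 0 ≤ X := Finset.sum_nonneg fun _ _ => sq_nonneg _
  have hcr : ∀ i j, ‖inner ℂ (h i) (h j)‖ ≤ ε (max i j - min i j) * (x i * x j) := by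
    intro i j
    rcases le_total i j with hij | hij
    · obtain ⟨n, rfl⟩ := Nat.exists_eq_add_of_le hij
      rw [max_eq_right hij, min_eq_left hij, Nat.add_sub_cancel_left]
      exact hcross i n (c (i + n)) (c i) G
    · obtain ⟨n, rfl⟩ := Nat.exists_eq_add_of_le hij
      rw [max_eq_left hij, min_eq_right hij, Nat.add_sub_cancel_left, norm_inner_symm, mul_comm (x _)]
      exact hcross j n (c (j + n)) (c j) G
  have hnorm : ‖∑ j ∈ Finset.range J, h j‖ ^ 2 ≤ K * X := by
    have h1 : ‖∑ j ∈ Finset.range J, h j‖ ^ 2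
        = ‖inner ℂ (∑ j ∈ Finset.range J, h j) (∑ j ∈ Finset.range J, h j)‖ := by
      rw [inner_self_eq_norm_sq_to_K]; simp
    rw [h1, sum_inner]
    refine (norm_sum_le _ _).trans ((Finset.sum_le_sum fun i _ => ?_).trans
      (sum_sum_mul_le hε0 hε J x))
    rw [inner_sum]
    exact (norm_sum_le _ _).trans (Finset.sum_le_sum fun j _ => hcr i j)
  -- `X = ⟨∑ h j, f⟩`, and the norm of `∑ h j` is controlled by `√X`
  have hXle : X ≤ ‖∑ j ∈ Finset.range J, h j‖ * ‖f‖ := by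
    have h1 : inner ℂ (∑ j ∈ Finset.range J, h j) f = ((X : ℝ) : ℂ) := by
      rw [sum_inner, hX]
      push_cast
      refine Finset.sum_congr rfl fun j _ => ?_
      rw [sum_inner, ← Complex.ofReal_pow, hx]
      push_cast
      refine Finset.sum_congr rfl fun k _ => ?_
      rw [inner_smul_left]
      exact Complex.conj_mul' _
    have h2 := norm_inner_le_norm (𝕜 := ℂ) (∑ j ∈ Finset.range J, h j) f
    rw [h1, Complex.norm_real, Real.norm_of_nonneg hX0] at h2
    exact h2
  by_cases hX00 : X = 0
  · rw [hX00]; positivity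
  · have h1 : X ^ 2 ≤ (K * X) * ‖f‖ ^ 2 := by
      calc X ^ 2 ≤ (‖∑ j ∈ Finset.range J, h j‖ * ‖f‖) ^ 2 := by gcongr
        _ = ‖∑ j ∈ Finset.range J, h j‖ ^ 2 * ‖f‖ ^ 2 := by ring
        _ ≤ _ := by gcongr
    have hpos : 0 < X := lt_of_le_of_ne hX0 (Ne.symm hX00)
    nlinarith

section dilation
variable {d : ℕ} {M : Matrix (Fin d) (Fin d) ℤ}

/-- `M⁻¹ x`. -/
def actInv (M : Matrix (Fin d) (Fin d) ℤ) (x : RSpace d) : RSpace d :=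
  WithLp.toLp 2 ((M.map (Int.cast : ℤ → ℝ))⁻¹ *ᵥ WithLp.ofLp x)

lemma isUnit_det_map (hM : M.det ≠ 0) : IsUnit (M.map (Int.cast : ℤ → ℝ)).det := by
  have : (M.map (Int.cast : ℤ → ℝ)).det = (M.det : ℝ) :=
    ((Int.castRingHom ℝ).map_det M).symm
  rw [this, isUnit_iff_ne_zero]
  exact_mod_cast hM

lemma act_actInv (hM : M.det ≠ 0) (x : RSpace d) : act M (actInv M x) = x := by
  ext i
  simp only [act, actInv]
  rw [Matrix.mulVec_mulVec, Matrix.mul_nonsing_inv _ (isUnit_det_map hM), Matrix.one_mulVec]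

lemma actInv_act (hM : M.det ≠ 0) (x : RSpace d) : actInv M (act M x) = x := by
  ext i
  simp only [act, actInv]
  rw [Matrix.mulVec_mulVec, Matrix.nonsing_inv_mul _ (isUnit_det_map hM), Matrix.one_mulVec]

lemma act_pow_actInv_iterate (hM : M.det ≠ 0) (i n : ℕ) (x : RSpace d) :
    act (M ^ i) ((actInv M)^[i + n] x) = (actInv M)^[n] x := by
  induction i generalizing x with
  | zero => simp [act_one]
  | succ i ih =>
    rw [pow_succ, act_mul, show i + 1 + n = (i + n) + 1 by omega, Function.iterate_succ_apply',
      act_actInv hM, ih]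

lemma det_ne_zero_of_isDilation (hM : IsDilation M) : M.det ≠ 0 := by
  intro h
  have h1 : (M.map (Int.cast : ℤ → ℂ)).det = 0 := by
    have : (M.map (Int.cast : ℤ → ℂ)).det = (M.det : ℂ) := ((Int.castRingHom ℂ).map_det M).symm
    rw [this, h]; simp
  have h2 : (0 : ℂ) ∈ spectrum ℂ (M.map (Int.cast : ℤ → ℂ)) := by
    rw [spectrum.zero_mem_iff, Matrix.isUnit_iff_isUnit_det, h1]
    simp
  have := hM 0 h2
  rw [norm_zero] at this
  linarith

attribute [local instance] Matrix.linftyOpNormedRing Matrix.linftyOpNormedAlgebra in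
/-- The powers of the inverse of a dilation matrix tend to zero, by Gelfand's formula. -/
lemma tendsto_inv_pow (hM : IsDilation M) :
    Tendsto (fun n : ℕ => ((M.map (Int.cast : ℤ → ℂ))⁻¹) ^ n) atTop (𝓝 0) := by
  set A := M.map (Int.cast : ℤ → ℂ) with hA
  have hdet : IsUnit A.det := by
    have : A.det = (M.det : ℂ) := ((Int.castRingHom ℂ).map_det M).symm
    rw [this, isUnit_iff_ne_zero]
    exact_mod_cast det_ne_zero_of_isDilation hM
  rcases isEmpty_or_nonempty (Fin d) with he | hne
  · exact tendsto_const_nhds.congr fun n => Subsingleton.elim _ _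
  have hspec : ∀ z ∈ spectrum ℂ A⁻¹, ‖z‖₊ < 1 := by
    intro z hz
    let u : (Matrix (Fin d) (Fin d) ℂ)ˣ := Matrix.nonsingInvUnit A hdet
    have hz0 : z ≠ 0 := by
      rintro rfl
      exact spectrum.zero_notMem ℂ (u⁻¹).isUnit hz
    have h1 : z⁻¹ ∈ spectrum ℂ A := by
      have h2 := spectrum.inv_mem_iff (r := Units.mk0 z hz0) (a := u⁻¹)
      have h3 := h2.1 hz
      rw [inv_inv, Units.val_inv_eq_inv_val, Units.val_mk0] at h3
      exact h3
    have h2 := hM _ h1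
    rw [norm_inv] at h2
    have h3 : ‖z‖ < 1 := by
      by_contra hcon
      exact absurd h2 (not_lt.2 (inv_le_one_of_one_le₀ (not_lt.1 hcon)))
    exact_mod_cast h3
  have hrad : spectralRadius ℂ A⁻¹ < 1 := by
    have := spectrum.spectralRadius_lt_of_forall_lt_of_nonempty (spectrum.nonempty A⁻¹) hspec
    simpa using this
  have hgel := spectrum.pow_nnnorm_pow_one_div_tendsto_nhds_spectralRadius A⁻¹
  obtain ⟨r, hr1, hr2⟩ := exists_between hrad
  have hr : r ≠ ⊤ := (hr2.trans ENNReal.one_lt_top).ne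
  have hev := hgel.eventually_lt_const hr1
  refine tendsto_zero_iff_norm_tendsto_zero.2 ?_
  have hr0 : Tendsto (fun n : ℕ => r.toReal ^ n) atTop (𝓝 0) := by
    refine tendsto_pow_atTop_nhds_zero_of_lt_one ENNReal.toReal_nonneg ?_
    rw [← ENNReal.toReal_one]
    exact (ENNReal.toReal_lt_toReal hr ENNReal.one_ne_top).2 hr2
  refine squeeze_zero' (Eventually.of_forall fun _ => norm_nonneg _) ?_ hr0
  filter_upwards [hev, eventually_gt_atTop 0] with n hn hn0
  have h4 : (‖A⁻¹ ^ n‖₊ : ℝ≥0∞) ≤ r ^ n := by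
    have h5 := ENNReal.rpow_le_rpow hn.le (Nat.cast_nonneg (α := ℝ) n)
    rwa [← ENNReal.rpow_mul, one_div_mul_cancel (by positivity), ENNReal.rpow_one,
      ENNReal.rpow_natCast] at h5
  have h6 := ENNReal.toReal_mono (ENNReal.pow_ne_top hr) h4
  simpa using h6

lemma tendsto_actInv_iterate (hM : IsDilation M) (x : RSpace d) :
    Tendsto (fun n => (actInv M)^[n] x) atTop (𝓝 0) := by
  have h1 : ∀ n i, (((actInv M)^[n] x i : ℝ) : ℂ)
      = (((M.map (Int.cast : ℤ → ℂ))⁻¹ ^ n) *ᵥ fun i => (x i : ℂ)) i := by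
    intro n
    have hinv : (M.map (Int.cast : ℤ → ℂ))⁻¹
        = ((M.map (Int.cast : ℤ → ℝ))⁻¹).map (Complex.ofRealHom) := by
      rw [Matrix.inv_eq_right_inv]
      have h2 : M.map (Int.cast : ℤ → ℂ) = (M.map (Int.cast : ℤ → ℝ)).map Complex.ofRealHom := by
        ext i j; simp
      rw [h2, ← Matrix.map_mul, Matrix.mul_nonsing_inv _
        (isUnit_det_map (det_ne_zero_of_isDilation hM))]
      simp
    induction n with
    | zero => intro i; simp
    | succ n ih =>
      intro i
      rw [Function.iterate_succ_apply', pow_succ', ← Matrix.mulVec_mulVec]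
      simp only [actInv, Matrix.mulVec, dotProduct]
      push_cast
      refine Finset.sum_congr rfl fun j _ => ?_
      rw [ih j, hinv]
      rfl
  have h2 : Tendsto (fun n i => (((actInv M)^[n] x i : ℝ) : ℂ)) atTop (𝓝 0) := by
    have hc : Continuous fun A : Matrix (Fin d) (Fin d) ℂ => A *ᵥ fun i => (x i : ℂ) := by
      fun_prop
    have := (hc.tendsto 0).comp (tendsto_inv_pow hM)
    rw [Matrix.zero_mulVec] at this
    refine this.congr fun n => ?_
    funext i
    exact (h1 n i).symm
  have h3 : Tendsto (fun n => WithLp.ofLp ((actInv M)^[n] x)) atTop (𝓝 0) := by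
    rw [tendsto_pi_nhds] at h2 ⊢
    intro i
    have := (Complex.continuous_re.tendsto _).comp (h2 i)
    simpa [Function.comp_def] using this
  have := ((PiLp.continuous_toLp 2 (fun _ : Fin d => ℝ)).tendsto 0).comp h3
  simpa [Function.comp_def] using this

end dilation

section wavelet
variable {d : ℕ} {M : Matrix (Fin d) (Fin d) ℤ}

lemma norm_sum_smul_transL_le {R : ℝ} {g : L2Space d} (hg : SuppIn R g) (F : Finset (IntLattice d))
    (c : IntLattice d → ℂ) :
    ‖∑ k ∈ F, c k • transL (latticeVec k) g‖ ≤ √(overlap d R) * ‖g‖ * √(∑ k ∈ F, ‖c k‖ ^ 2) := by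
  have h := norm_sum_smul_sq_le_of_bessel (fun k => transL (latticeVec k) g) F
    (B := overlap d R * ‖g‖ ^ 2) (mul_nonneg (overlap_nonneg d R) (sq_nonneg _))
    (fun f => sum_norm_inner_transL_sq_le hg f F) c
  rw [← Real.sqrt_sq (norm_nonneg (∑ k ∈ F, c k • transL (latticeVec k) g))]
  refine (Real.sqrt_le_sqrt h).trans (le_of_eq ?_)
  rw [Real.sqrt_mul (mul_nonneg (overlap_nonneg d R) (sq_nonneg _)),
    Real.sqrt_mul (overlap_nonneg d R), Real.sqrt_sq (norm_nonneg _)]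

lemma SuppIn.exists_dil (hM : M.det ≠ 0) {R : ℝ} {g : L2Space d} (hg : SuppIn R g) :
    ∃ R', SuppIn R' (dil M hM g) := by
  let A : RSpace d →ₗ[ℝ] RSpace d :=
    Matrix.toLpLin 2 2 ((M.map (Int.cast : ℤ → ℝ))⁻¹)
  have hA : ∀ x, ‖actInv M x‖ ≤ ‖A.toContinuousLinearMap‖ * ‖x‖ :=
    fun x => A.toContinuousLinearMap.le_opNorm x
  refine ⟨‖A.toContinuousLinearMap‖ * max R 0, ?_⟩
  have h1 := (quasiMeasurePreserving_act hM).ae hg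
  have h2 : dil M hM g =ᵐ[volume] dilFun M g := MemLp.coeFn_toLp (memLp_dilFun hM (Lp.memLp g))
  filter_upwards [h1, h2] with x h3 h4 h5
  rw [h4, dilFun, h3, mul_zero]
  by_contra hcon
  rw [not_lt] at hcon
  have h6 := hA (act M x)
  rw [actInv_act hM] at h6
  have h7 : ‖A.toContinuousLinearMap‖ * ‖act M x‖ ≤ ‖A.toContinuousLinearMap‖ * max R 0 := by
    gcongr
    exact hcon.trans (le_max_left _ _)
  linarith

lemma det_pow_ne_zero (hM : M.det ≠ 0) (j : ℕ) : (M ^ j).det ≠ 0 := by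
  rw [Matrix.det_pow]; exact pow_ne_zero _ hM

/-- The function `|det M|^{j/2} g(M^j · - k)`. -/
def wav (hM : M.det ≠ 0) (g : L2Space d) (p : ℕ × IntLattice d) : L2Space d :=
  dil (M ^ p.1) (det_pow_ne_zero hM p.1) (transL (latticeVec p.2) g)

/-- The wavelet system of a compactly supported `ψ = ∑ β_q D τ_q φ` with `∑ β_q = 0`, where `φ` is
a compactly supported refinable function, is Bessel. The cancellation of the finer level is traded
for a small translation of the coarser level. -/
lemma exists_isBessel_wav (hM : IsDilation M) (hdet : M.det ≠ 0) {R R' : ℝ} {φ ψ : L2Space d}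
    (hR : SuppIn R φ) (hR' : SuppIn R' ψ)
    (S : Finset (IntLattice d)) (α : IntLattice d → ℂ)
    (hφ : φ = ∑ k ∈ S, α k • dil M hdet (transL (latticeVec k) φ))
    (S' : Finset (IntLattice d)) (β : IntLattice d → ℂ)
    (hψ : ψ = ∑ k ∈ S', β k • dil M hdet (transL (latticeVec k) φ)) (hβ : ∑ k ∈ S', β k = 0) :
    ∃ B, 0 ≤ B ∧ IsBessel (wav hdet ψ) B := by
  obtain ⟨R₁, hR₁⟩ := hR.exists_dil hdet
  set φ₁ := dil M hdet φ with hφ₁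
  let u : IntLattice d → ℕ → RSpace d := fun q n => (actInv M)^[n] (latticeVec q)
  have hu0 : ∀ q, Tendsto (u q) atTop (𝓝 0) := fun q => tendsto_actInv_iterate hM _
  have huM : ∀ q n, act M (u q (n + 1)) = u q n := by
    intro q n
    simp only [u]
    rw [Function.iterate_succ_apply', act_actInv hdet]
  -- the translates of `φ`, hence those of `ψ`, converge summably
  have hsumφ : ∀ q, Summable fun n => ‖transL (-u q n) φ - φ‖ := by
    intro q
    refine summable_norm_transL_sub hdet hR S α hφ (t := fun n => -u q n)
      (fun n => by rw [act_neg, huM]) ?_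
    simpa using (hu0 q).neg
  have hψle : ∀ q n, ‖transL (-u q (n + 1)) ψ - ψ‖
      ≤ (∑ k ∈ S', ‖β k‖) * ‖transL (-u q n) φ - φ‖ := by
    intro q n
    have h1 : transL (-u q (n + 1)) ψ - ψ
        = ∑ k ∈ S', β k • dil M hdet (transL (latticeVec k) (transL (-u q n) φ - φ)) := by
      conv_lhs => rw [hψ]
      rw [map_sum, ← Finset.sum_sub_distrib]
      refine Finset.sum_congr rfl fun k _ => ?_
      rw [map_smul, transL_dil, act_neg, huM, ← smul_sub, ← map_sub, map_sub (transL (latticeVec k)),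
        ← transL_add, ← transL_add, add_comm]
    rw [h1, Finset.sum_mul]
    refine (norm_sum_le _ _).trans (Finset.sum_le_sum fun k _ => ?_)
    rw [norm_smul, LinearIsometry.norm_map, LinearIsometry.norm_map]
  have hsumψ : ∀ q, Summable fun n => ‖transL (-u q (n + 1)) ψ - ψ‖ := fun q =>
    Summable.of_nonneg_of_le (fun _ => norm_nonneg _) (hψle q) ((hsumφ q).mul_left _)
  have hT : ∀ q, ∃ T, ∀ n, ‖u q n‖ ≤ T := fun q => by
    obtain ⟨T, hT⟩ := (Metric.isBounded_range_of_tendsto _ (hu0 q)).exists_norm_le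
    exact ⟨T, fun n => hT _ ⟨n, rfl⟩⟩
  choose T hT using hT
  let K : IntLattice d → ℝ := fun q =>
    ‖β q‖ * (√(overlap d (R' + T q)) * (√(overlap d R₁) * ‖φ₁‖))
  have hK : ∀ q, 0 ≤ K q := fun q => by positivity
  let ε : ℕ → ℝ := fun n => ∑ q ∈ S', K q * ‖transL (-u q (n + 1)) ψ - ψ‖
  have hε0 : ∀ n, 0 ≤ ε n := fun n =>
    Finset.sum_nonneg fun q _ => mul_nonneg (hK q) (norm_nonneg _)
  have hε : Summable ε := summable_sum fun q _ => (hsumψ q).mul_left _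
  refine ⟨2 * ∑' n, ε n, mul_nonneg zero_le_two (tsum_nonneg hε0),
    isBessel_of_almost_orthogonal (fun j k => wav hdet ψ (j, k)) hε0 hε fun i n c e F => ?_⟩
  let H := ∑ l ∈ F, e l • wav hdet ψ (i, l)
  let Y := dil (M ^ (i + n)) (det_pow_ne_zero hdet _) (∑ k ∈ F, c k • transL (latticeVec k) φ₁)
  let s : IntLattice d → RSpace d := fun q => u q (i + n + 1)
  -- since `∑ β_q = 0`, the fine level consists of differences by the translations `s q`
  have hfine : ∑ k ∈ F, c k • wav hdet ψ (i + n, k) = ∑ q ∈ S', β q • (transL (s q) Y - Y) := by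
    have h1 : ψ = ∑ q ∈ S', β q • (transL (u q 1) φ₁ - φ₁) := by
      simp only [smul_sub, Finset.sum_sub_distrib, ← Finset.sum_smul, hβ, zero_smul, sub_zero]
      conv_lhs => rw [hψ]
      refine Finset.sum_congr rfl fun q _ => ?_
      rw [hφ₁, transL_dil, huM]
      rfl
    have h2 : ∑ k ∈ F, c k • wav hdet ψ (i + n, k)
        = dil (M ^ (i + n)) (det_pow_ne_zero hdet _) (∑ k ∈ F, c k • transL (latticeVec k) ψ) := by
      simp only [wav, map_sum, map_smul]
    have h3 : ∑ k ∈ F, c k • transL (latticeVec k) ψ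
        = ∑ q ∈ S', β q • (transL (u q 1) (∑ k ∈ F, c k • transL (latticeVec k) φ₁)
          - ∑ k ∈ F, c k • transL (latticeVec k) φ₁) := by
      conv_lhs => rw [h1]
      simp only [map_sum, map_smul, map_sub, Finset.smul_sum, smul_sub, Finset.sum_sub_distrib,
        ← transL_add]
      rw [Finset.sum_comm, Finset.sum_comm (s := F)]
      congr 1
      · refine Finset.sum_congr rfl fun q _ => Finset.sum_congr rfl fun k _ => ?_
        rw [smul_comm, add_comm]
      · exact Finset.sum_congr rfl fun q _ => Finset.sum_congr rfl fun k _ => smul_comm _ _ _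
    rw [h2, h3, map_sum]
    refine Finset.sum_congr rfl fun q _ => ?_
    rw [map_smul, map_sub, transL_dil]
    congr 3
    simp only [s, u]
    rw [show i + n + 1 = (i + n) + 1 from rfl, act_pow_actInv_iterate hdet]
  -- at the coarse level `i` the translation by `s q` becomes one by `M^{-(n+1)} q`
  have hcoarse : ∀ q ∈ S', ‖transL (-s q) H - H‖
      ≤ √(overlap d (R' + T q)) * ‖transL (-u q (n + 1)) ψ - ψ‖ * √(∑ l ∈ F, ‖e l‖ ^ 2) := by
    intro q _
    have h1 : transL (-s q) H - H = dil (M ^ i) (det_pow_ne_zero hdet _)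
        (∑ l ∈ F, e l • transL (latticeVec l) (transL (-u q (n + 1)) ψ - ψ)) := by
      simp only [H, wav, map_sum, map_smul, ← Finset.sum_sub_distrib, ← smul_sub]
      refine Finset.sum_congr rfl fun l _ => ?_
      rw [transL_dil, ← map_sub]
      congr 2
      rw [map_sub, ← transL_add, ← transL_add]
      congr 2
      rw [add_comm, act_neg]
      simp only [s, u]
      rw [show i + n + 1 = i + (n + 1) by omega, act_pow_actInv_iterate hdet]
    rw [h1, LinearIsometry.norm_map]
    refine norm_sum_smul_transL_le (SuppIn.sub ?_ ?_) F e
    · refine (hR'.transL' _).mono ?_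
      rw [norm_neg]
      linarith [hT q (n + 1)]
    · exact hR'.mono (by linarith [(norm_nonneg _).trans (hT q 0)])
  have hY : ‖Y‖ ≤ √(overlap d R₁) * ‖φ₁‖ * √(∑ k ∈ F, ‖c k‖ ^ 2) := by
    simp only [Y]
    rw [LinearIsometry.norm_map]
    exact norm_sum_smul_transL_le hR₁ F c
  change ‖inner ℂ H (∑ k ∈ F, c k • wav hdet ψ (i + n, k))‖ ≤ _
  rw [hfine, inner_sum]
  refine (norm_sum_le _ _).trans ?_
  simp only [ε]
  rw [Finset.sum_mul]
  refine Finset.sum_le_sum fun q hq => ?_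
  rw [inner_smul_right, norm_mul, inner_sub_right]
  have h1 : inner ℂ H (transL (s q) Y) = inner ℂ (transL (-s q) H) Y := by
    rw [inner_transL_left, neg_neg]
  rw [h1, ← inner_sub_left]
  calc ‖β q‖ * ‖inner ℂ (transL (-s q) H - H) Y‖
      ≤ ‖β q‖ * ((√(overlap d (R' + T q)) * ‖transL (-u q (n + 1)) ψ - ψ‖
          * √(∑ l ∈ F, ‖e l‖ ^ 2)) * (√(overlap d R₁) * ‖φ₁‖ * √(∑ k ∈ F, ‖c k‖ ^ 2))) := by
        gcongr
        exact (norm_inner_le_norm _ _).trans (mul_le_mul (hcoarse q hq) hY (norm_nonneg _)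
          (by positivity))
    _ = _ := by simp only [K]; ring

end wavelet

/-! ### Pairs of Bessel families -/

section frames
variable {H ι : Type*} [NormedAddCommGroup H] [InnerProductSpace ℂ H] {g g' : ι → H} {B B' : ℝ}

lemma IsBessel.summable (hg : IsBessel g B) (f : H) : Summable fun i => ‖inner ℂ (g i) f‖ ^ 2 :=
  summable_of_sum_le (fun _ => sq_nonneg _) (hg f)

lemma IsBessel.tsum_le (hg : IsBessel g B) (f : H) :
    ∑' i, ‖inner ℂ (g i) f‖ ^ 2 ≤ B * ‖f‖ ^ 2 :=
  (hg.summable f).tsum_le_of_sum_le (hg f)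

lemma IsBessel.norm_sum_smul_sq_le (hg : IsBessel g B) (hB : 0 ≤ B) (F : Finset ι) (c : ι → ℂ) :
    ‖∑ i ∈ F, c i • g i‖ ^ 2 ≤ B * ∑ i ∈ F, ‖c i‖ ^ 2 :=
  norm_sum_smul_sq_le_of_bessel g F hB (fun f => hg f F) c

/-- The mixed frame series of two Bessel families converges unconditionally. -/
lemma IsBessel.summable_smul [CompleteSpace H] (hg : IsBessel g B) (hg' : IsBessel g' B')
    (hB' : 0 ≤ B') (f : H) : Summable fun i => inner ℂ (g i) f • g' i := by
  rw [summable_iff_vanishing_norm]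
  intro ε hε
  obtain ⟨s, hs⟩ := summable_iff_vanishing_norm.1 (hg.summable f) (ε ^ 2 / (B' + 1)) (by positivity)
  refine ⟨s, fun t ht => ?_⟩
  have h1 := hs t ht
  rw [Real.norm_of_nonneg (Finset.sum_nonneg fun _ _ => sq_nonneg _), lt_div_iff₀ (by positivity)] at h1
  have h2 := hg'.norm_sum_smul_sq_le hB' t fun i => inner ℂ (g i) f
  have h3 : 0 ≤ ∑ i ∈ t, ‖inner ℂ (g i) f‖ ^ 2 := Finset.sum_nonneg fun _ _ => sq_nonneg _
  refine lt_of_pow_lt_pow_left₀ 2 hε.le ?_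
  nlinarith

lemma IsBessel.summable_mul (hg : IsBessel g B) (hg' : IsBessel g' B') (f h : H) :
    Summable fun i => inner ℂ (g i) f * conj (inner ℂ (g' i) h) := by
  refine Summable.of_norm ?_
  refine Summable.of_nonneg_of_le (fun _ => norm_nonneg _) (fun i => ?_)
    ((hg.summable f).add (hg'.summable h))
  rw [norm_mul, RCLike.norm_conj]
  nlinarith [sq_nonneg (‖inner ℂ (g i) f‖ - ‖inner ℂ (g' i) h‖), sq_nonneg (‖inner ℂ (g i) f‖),
    sq_nonneg (‖inner ℂ (g' i) h‖)]

lemma IsBessel.norm_tsum_smul_le [CompleteSpace H] (hg : IsBessel g B) (hg' : IsBessel g' B')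
    (hB : 0 ≤ B) (hB' : 0 ≤ B') (f : H) :
    ‖∑' i, inner ℂ (g i) f • g' i‖ ≤ √(B' * B) * ‖f‖ := by
  refine le_of_tendsto (hg.summable_smul hg' hB' f).hasSum.norm (Eventually.of_forall fun F => ?_)
  have h1 : ‖∑ i ∈ F, inner ℂ (g i) f • g' i‖ ^ 2 ≤ (B' * B) * ‖f‖ ^ 2 := by
    refine (hg'.norm_sum_smul_sq_le hB' F _).trans ?_
    rw [mul_assoc]
    exact mul_le_mul_of_nonneg_left (hg f F) hB'
  calc ‖∑ i ∈ F, inner ℂ (g i) f • g' i‖ = √(‖∑ i ∈ F, inner ℂ (g i) f • g' i‖ ^ 2) :=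
        (Real.sqrt_sq (norm_nonneg _)).symm
    _ ≤ √((B' * B) * ‖f‖ ^ 2) := Real.sqrt_le_sqrt h1
    _ = _ := by rw [Real.sqrt_mul (by positivity), Real.sqrt_sq (norm_nonneg _)]

/-- Two Bessel families that reproduce inner products on a dense set reproduce all vectors. -/
lemma IsBessel.hasSum_of_dense [CompleteSpace H] (hg : IsBessel g B) (hg' : IsBessel g' B')
    (hB : 0 ≤ B) (hB' : 0 ≤ B') {D : Set H} (hD : Dense D)
    (h : ∀ f ∈ D, ∀ k ∈ D, ∑' i, inner ℂ (g i) f * conj (inner ℂ (g' i) k) = inner ℂ k f) (f : H) :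
    HasSum (fun i => inner ℂ (g i) f • g' i) f := by
  have hs := fun f => hg.summable_smul hg' hB' f
  let S : H →ₗ[ℂ] H :=
    { toFun := fun f => ∑' i, inner ℂ (g i) f • g' i
      map_add' := fun f k => by
        rw [← (hs f).tsum_add (hs k)]
        simp only [inner_add_right, add_smul]
      map_smul' := fun c f => by
        rw [RingHom.id_apply, ← (hs f).tsum_const_smul]
        simp only [inner_smul_right, mul_smul] }
  have hScont : Continuous S :=
    (S.mkContinuous (√(B' * B)) (hg.norm_tsum_smul_le hg' hB hB')).continuous
  -- the mixed frame operator `S` is bounded and equals the identity weakly on `D`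
  have hSD : ∀ f ∈ D, S f = f := by
    intro f hf
    refine ext_inner_left ℂ fun k => ?_
    refine congrFun (Continuous.ext_on hD (f := fun k => inner ℂ k (S f))
      (g := fun k => inner ℂ k f) (by fun_prop) (by fun_prop) fun k hk => ?_) k
    beta_reduce
    rw [← h f hf k hk]
    have h1 := ((innerSL ℂ k).hasSum (hs f).hasSum).tsum_eq
    refine h1.symm.trans (tsum_congr fun i => ?_)
    simp
  have hS : S f = f := congrFun (Continuous.ext_on hD hScont continuous_id hSD) f
  have := (hs f).hasSum
  change HasSum _ (S f) at this
  rwa [hS] at this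

/-- Lower frame bounds from the reconstruction formula and the Bessel property of the dual. -/
lemma IsBessel.lower_bound (hg : IsBessel g B) (hg' : IsBessel g' B') {f : H}
    (h : HasSum (fun i => inner ℂ (g i) f • g' i) f) :
    ‖f‖ ^ 2 ≤ B' * ∑' i, ‖inner ℂ (g i) f‖ ^ 2 ∧ ‖f‖ ^ 2 ≤ B * ∑' i, ‖inner ℂ (g' i) f‖ ^ 2 := by
  set X := ∑' i, ‖inner ℂ (g i) f‖ ^ 2
  set Y := ∑' i, ‖inner ℂ (g' i) f‖ ^ 2
  have hX : X ≤ B * ‖f‖ ^ 2 := hg.tsum_le f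
  have hY : Y ≤ B' * ‖f‖ ^ 2 := hg'.tsum_le f
  have hX0 : 0 ≤ X := tsum_nonneg fun _ => sq_nonneg _
  have hY0 : 0 ≤ Y := tsum_nonneg fun _ => sq_nonneg _
  have h1 : HasSum (fun i => inner ℂ (g i) f * inner ℂ f (g' i)) (inner ℂ f f) := by
    have := (innerSL ℂ f).hasSum h
    simpa [inner_smul_right] using this
  -- Cauchy-Schwarz for the expansion of `⟨f, f⟩`
  have h2 : (‖f‖ ^ 2) ^ 2 ≤ X * Y := by
    have h3 : ‖f‖ ^ 2 = ‖inner ℂ f f‖ := by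
      rw [inner_self_eq_norm_sq_to_K]; simp
    rw [h3]
    refine le_of_tendsto (h1.norm.pow 2) (Eventually.of_forall fun F => ?_)
    calc ‖∑ i ∈ F, inner ℂ (g i) f * inner ℂ f (g' i)‖ ^ 2
        ≤ (∑ i ∈ F, ‖inner ℂ (g i) f‖ * ‖inner ℂ (g' i) f‖) ^ 2 := by
          gcongr
          refine (norm_sum_le _ _).trans (Finset.sum_le_sum fun i _ => ?_)
          rw [norm_mul, norm_inner_symm f]
      _ ≤ (∑ i ∈ F, ‖inner ℂ (g i) f‖ ^ 2) * ∑ i ∈ F, ‖inner ℂ (g' i) f‖ ^ 2 :=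
          Finset.sum_mul_sq_le_sq_mul_sq F _ _
      _ ≤ X * Y := by
          refine mul_le_mul ((hg.summable f).sum_le_tsum _ fun _ _ => sq_nonneg _)
            ((hg'.summable f).sum_le_tsum _ fun _ _ => sq_nonneg _)
            (Finset.sum_nonneg fun _ _ => sq_nonneg _) hX0
  by_cases hf : ‖f‖ = 0
  · have hX1 : X = 0 := le_antisymm (by rw [hf] at hX; simpa using hX) hX0
    have hY1 : Y = 0 := le_antisymm (by rw [hf] at hY; simpa using hY) hY0
    rw [hf, hX1, hY1]; simp
  · have hpos : 0 < ‖f‖ ^ 2 := by positivity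
    constructor
    · nlinarith [mul_le_mul_of_nonneg_left hY hX0]
    · nlinarith [mul_le_mul_of_nonneg_right hX hY0]

end frames

/-! ### The limit of the sampling operators at fine scales -/

section floor
variable {d : ℕ}

/-- The coordinatewise integer part. -/
def floorVec (x : RSpace d) : IntLattice d := fun i => ⌊x i⌋

lemma measurable_floorVec : Measurable (floorVec : RSpace d → IntLattice d) := by
  refine measurable_pi_lambda _ fun i => Int.measurable_floor.comp ?_
  exact (show Continuous fun x : RSpace d => x i by fun_prop).measurable

/-- Sums over the lattice are integrals over `ℝ^d`, since the unit cubes have measure one. -/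
lemma map_floorVec_volume :
    Measure.map floorVec (volume : Measure (RSpace d)) = Measure.count := by
  refine Measure.ext_of_singleton fun k => ?_
  rw [Measure.count_singleton, Measure.map_apply measurable_floorVec (measurableSet_singleton k)]
  have h1 : floorVec ⁻¹' {k} = (WithLp.ofLp : RSpace d → Fin d → ℝ) ⁻¹'
      (Set.univ.pi fun i => Set.Ico (k i : ℝ) (k i + 1)) := by
    ext x
    simp only [Set.mem_preimage, Set.mem_singleton_iff, Set.mem_univ_pi, floorVec, funext_iff,
      Int.floor_eq_iff, Set.mem_Ico]
  rw [h1, (PiLp.volume_preserving_ofLp (Fin d)).measure_preimage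
    (MeasurableSet.univ_pi fun i => measurableSet_Ico).nullMeasurableSet, Real.volume_pi_Ico]
  simp

lemma integral_comp_floorVec {h : IntLattice d → ℂ} (hh : Summable fun k => ‖h k‖) :
    ∫ x : RSpace d, h (floorVec x) = ∑' k, h k := by
  have hm : Measurable h := measurable_of_countable h
  have hi : Integrable h Measure.count := integrable_count_iff.2 hh
  rw [← integral_map (μ := (volume : Measure (RSpace d))) (φ := floorVec)
    measurable_floorVec.aemeasurable hm.aestronglyMeasurable, map_floorVec_volume,
    integral_countable hi]
  simp [Measure.real]

lemma norm_sub_floorVec_le (x : RSpace d) : ‖x - latticeVec (floorVec x)‖ ≤ √d := by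
  rw [EuclideanSpace.norm_eq]
  refine Real.sqrt_le_sqrt ?_
  calc _ ≤ ∑ _i : Fin d, (1 : ℝ) := by
        refine Finset.sum_le_sum fun i _ => ?_
        have h1 : (x - latticeVec (floorVec x)) i = Int.fract (x i) := rfl
        rw [h1, Real.norm_of_nonneg (Int.fract_nonneg _)]
        exact pow_le_one₀ (Int.fract_nonneg _) (Int.fract_lt_one _).le
    _ = d := by simp

lemma finite_norm_latticeVec_le (R : ℝ) : {k : IntLattice d | ‖latticeVec k‖ ≤ R}.Finite := by
  refine Set.Finite.subset (Set.Finite.pi' (t := fun _ : Fin d => Set.Icc (-⌈R⌉) ⌈R⌉)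
    fun i => Set.finite_Icc _ _) fun k hk i => ?_
  have h1 : |(k i : ℝ)| ≤ ⌈R⌉ :=
    ((abs_apply_le_norm (latticeVec k) i).trans hk).trans (Int.le_ceil R)
  rw [abs_le] at h1
  exact ⟨by exact_mod_cast h1.1, by exact_mod_cast h1.2⟩

end floor

section limit
variable {d : ℕ} {M : Matrix (Fin d) (Fin d) ℤ}

/-- Only finitely many wavelets of a given scale meet a given bounded set. -/
lemma finite_inner_wav_ne_zero (hdet : M.det ≠ 0) {R R' : ℝ} {g f : L2Space d} (hg : SuppIn R g)
    (hf : SuppIn R' f) (j : ℕ) : {k | inner ℂ (wav hdet g (j, k)) f ≠ 0}.Finite := by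
  let A : RSpace d →L[ℝ] RSpace d := (actLin (M ^ j)).toContinuousLinearMap
  have hA : ∀ x, ‖act (M ^ j) x‖ ≤ ‖A‖ * ‖x‖ := fun x => A.le_opNorm x
  refine (finite_norm_latticeVec_le (R + ‖A‖ * R')).subset fun k hk => ?_
  by_contra hcon
  refine hk ?_
  rw [L2.inner_def]
  refine integral_eq_zero_of_ae ?_
  have h1 := (quasiMeasurePreserving_act (det_pow_ne_zero hdet j)).ae (hg.transL (latticeVec k))
  have h2 : wav hdet g (j, k) =ᵐ[volume] dilFun (M ^ j) (transL (latticeVec k) g) :=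
    MemLp.coeFn_toLp (memLp_dilFun (det_pow_ne_zero hdet j) (Lp.memLp _))
  filter_upwards [h1, h2, hf] with x h3 h4 h5
  by_cases hx : R' < ‖x‖
  · rw [h5 hx]; simp
  · have h6 : R < ‖act (M ^ j) x - latticeVec k‖ := by
      by_contra h7
      rw [not_lt] at h7 hx
      refine hcon ?_
      have h8 : ‖A‖ * ‖x‖ ≤ ‖A‖ * R' := by gcongr
      have h9 := norm_sub_norm_le (latticeVec k) (act (M ^ j) x)
      rw [norm_sub_rev] at h9
      have h10 := hA x
      change ‖latticeVec k‖ ≤ _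
      linarith
    rw [h4, dilFun, h3 h6]; simp

lemma actInv_add (x y : RSpace d) : actInv M (x + y) = actInv M x + actInv M y :=
  map_add (Matrix.toLpLin 2 2 ((M.map (Int.cast : ℤ → ℝ))⁻¹)) x y

lemma actInv_iterate_eq (j : ℕ) (x : RSpace d) : (actInv M)^[j] x
    = ((Matrix.toLpLin 2 2 ((M.map (Int.cast : ℤ → ℝ))⁻¹) : RSpace d →ₗ[ℝ] RSpace d) ^ j) x := by
  rw [Module.End.pow_apply]
  rfl

lemma actInv_iterate_add (j : ℕ) (x y : RSpace d) :
    (actInv M)^[j] (x + y) = (actInv M)^[j] x + (actInv M)^[j] y := by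
  simp only [actInv_iterate_eq, map_add]

lemma actInv_iterate_act (hM : M.det ≠ 0) (j : ℕ) (x : RSpace d) :
    (actInv M)^[j] (act (M ^ j) x) = x := by
  induction j generalizing x with
  | zero => simp [act_one]
  | succ j ih => rw [Function.iterate_succ_apply, pow_succ', act_mul, actInv_act hM, ih]

/-- The powers of `M⁻¹` tend to zero uniformly on bounded sets. -/
lemma exists_norm_actInv_iterate_le (hM : IsDilation M) : ∃ κ : ℕ → ℝ, (∀ j, 0 ≤ κ j) ∧
    Tendsto κ atTop (𝓝 0) ∧ ∀ j x, ‖(actInv M)^[j] x‖ ≤ κ j * ‖x‖ := by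
  let e := EuclideanSpace.basisFun (Fin d) ℝ
  refine ⟨fun j => ∑ i, ‖(actInv M)^[j] (e i)‖, fun j => Finset.sum_nonneg fun _ _ => norm_nonneg _,
    ?_, fun j x => ?_⟩
  · rw [← Finset.sum_const_zero (s := (Finset.univ : Finset (Fin d)))]
    exact tendsto_finsetSum _ fun i _ =>
      tendsto_zero_iff_norm_tendsto_zero.1 (tendsto_actInv_iterate hM _)
  · conv_lhs => rw [← e.sum_repr x]
    simp only [actInv_iterate_eq, map_sum, map_smul]
    rw [Finset.sum_mul]
    refine (norm_sum_le _ _).trans (Finset.sum_le_sum fun i _ => ?_)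
    rw [norm_smul, mul_comm]
    gcongr
    exact abs_apply_le_norm x i

lemma continuous_actInv_iterate (j : ℕ) : Continuous fun x : RSpace d => (actInv M)^[j] x := by
  simp only [actInv_iterate_eq]
  exact LinearMap.continuous_of_finiteDimensional _

/-- The local average of `f` near `M^{-j} k`, with respect to the weight `conj η`. -/
def sample (M : Matrix (Fin d) (Fin d) ℤ) (f η : RSpace d → ℂ) (j : ℕ) (k : IntLattice d) : ℂ :=
  ∫ y, f ((actInv M)^[j] (y + latticeVec k)) * conj (η y)

/-- The frame coefficients at scale `j` are normalized local averages. -/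
lemma inner_wav_toLp (hdet : M.det ≠ 0) {f η : RSpace d → ℂ} (hf : MemLp f 2 volume)
    (hη : MemLp η 2 volume) (j : ℕ) (k : IntLattice d) :
    inner ℂ (wav hdet (hη.toLp η) (j, k)) (hf.toLp f)
      = (((√|((M ^ j).det : ℝ)|)⁻¹ : ℝ) : ℂ) * sample M f η j k := by
  have h0 : wav hdet (hη.toLp η) (j, k) = (memLp_dilFun (det_pow_ne_zero hdet j)
      (memLp_trans hη (latticeVec k))).toLp _ := by
    rw [wav, transL_toLp, dil_toLp]
  set D : ℝ := |((M ^ j).det : ℝ)|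
  have hD : 0 < D := abs_pos.2 (by exact_mod_cast det_pow_ne_zero hdet j)
  rw [h0, inner_toLp, pairing]
  have h1 : ∀ x, f x * conj (dilFun (M ^ j) (fun x => η (x - latticeVec k)) x)
      = (fun y => f ((actInv M)^[j] y) * ((√D : ℝ) * conj (η (y - latticeVec k))))
        (act (M ^ j) x) := by
    intro x
    simp only [dilFun, map_mul, Complex.conj_ofReal, actInv_iterate_act hdet]
    rfl
  rw [integral_congr_ae (Eventually.of_forall h1), integral_comp_act (det_pow_ne_zero hdet j)
      (fun y => f ((actInv M)^[j] y) * ((√D : ℝ) * conj (η (y - latticeVec k))))]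
  change (D⁻¹ : ℝ) • _ = _
  have h2 : ∀ y, f ((actInv M)^[j] y) * ((√D : ℝ) * conj (η (y - latticeVec k)))
      = (√D : ℝ) * (fun y => f ((actInv M)^[j] (y + latticeVec k)) * conj (η y))
        (y - latticeVec k) := by
    intro y
    simp only [sub_add_cancel]
    ring
  rw [integral_congr_ae (Eventually.of_forall h2), integral_const_mul,
    integral_sub_right_eq_self (fun y => f ((actInv M)^[j] (y + latticeVec k)) * conj (η y)),
    Complex.real_smul, ← mul_assoc, sample, ← Complex.ofReal_mul]
  congr 2
  have := Real.mul_self_sqrt hD.le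
  have h3 : √D ≠ 0 := (Real.sqrt_pos.2 hD).ne'
  field_simp
  rw [sq, this]

lemma actInv_iterate_add_floorVec (hM : M.det ≠ 0) (j : ℕ) (x y : RSpace d) :
    (actInv M)^[j] (y + latticeVec (floorVec (act (M ^ j) x)))
      = x + (actInv M)^[j] (y - (act (M ^ j) x - latticeVec (floorVec (act (M ^ j) x)))) := by
  conv_rhs => enter [1]; rw [← actInv_iterate_act hM j x]
  rw [← actInv_iterate_add]
  congr 1
  abel

/-- Local averages over shrinking neighbourhoods converge to the values of a continuous function. -/
lemma tendsto_sample (hM : IsDilation M) {f η : RSpace d → ℂ} (hf : Continuous f)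
    (hfc : HasCompactSupport f) (hη : Integrable η) (x : RSpace d) :
    Tendsto (fun j => sample M f η j (floorVec (act (M ^ j) x))) atTop
      (𝓝 (f x * conj (∫ y, η y))) := by
  obtain ⟨κ, hκ0, hκ, hκle⟩ := exists_norm_actInv_iterate_le hM
  have hdet := det_ne_zero_of_isDilation hM
  obtain ⟨C, hC⟩ := hfc.exists_bound_of_continuous hf
  rw [← integral_conj, ← integral_const_mul]
  refine tendsto_integral_of_dominated_convergence (fun y => C * ‖η y‖) (fun j => ?_)
    (hη.norm.const_mul C) (fun j => ae_of_all _ fun y => ?_) (ae_of_all _ fun y => ?_)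
  · refine AEStronglyMeasurable.mul ?_ (Complex.continuous_conj.comp_aestronglyMeasurable hη.1)
    exact (hf.comp ((continuous_actInv_iterate j).comp (by fun_prop))).aestronglyMeasurable
  · rw [norm_mul, RCLike.norm_conj]
    gcongr
    exact hC _
  · refine Tendsto.mul_const _ ((hf.tendsto x).comp ?_)
    simp only [actInv_iterate_add_floorVec hdet]
    conv => enter [3]; rw [← add_zero x]
    refine tendsto_const_nhds.add (squeeze_zero_norm (a := fun j => κ j * (‖y‖ + √d))
      (fun j => ?_) ?_)
    · refine (hκle j _).trans (mul_le_mul_of_nonneg_left ?_ (hκ0 j))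
      exact (norm_sub_le _ _).trans (add_le_add_right (norm_sub_floorVec_le _) _)
    · simpa using hκ.mul_const (‖y‖ + √d)

/-- The supports of the sampled averages stay in a fixed ball at all scales. -/
lemma exists_sample_eq_zero (hM : IsDilation M) {f η : RSpace d → ℂ}
    (hfc : HasCompactSupport f) (hηc : HasCompactSupport η) :
    ∃ R, ∀ j x, R < ‖x‖ → sample M f η j (floorVec (act (M ^ j) x)) = 0 := by
  obtain ⟨κ, hκ0, hκ, hκle⟩ := exists_norm_actInv_iterate_le hM
  have hdet := det_ne_zero_of_isDilation hM
  obtain ⟨K, hK⟩ := (Metric.isBounded_range_of_tendsto _ hκ).exists_norm_le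
  obtain ⟨Rf, hRf⟩ := hfc.isBounded.exists_norm_le
  obtain ⟨Rη, hRη⟩ := hηc.isBounded.exists_norm_le
  refine ⟨Rf + K * (max Rη 0 + √d), fun j x hx => ?_⟩
  refine integral_eq_zero_of_ae (ae_of_all _ fun y => ?_)
  by_cases hy : η y = 0
  · simp [hy]
  have hy1 : ‖y‖ ≤ max Rη 0 := (hRη y (subset_tsupport η hy)).trans (le_max_left _ _)
  beta_reduce
  rw [actInv_iterate_add_floorVec hdet]
  set z := (actInv M)^[j] (y - (act (M ^ j) x - latticeVec (floorVec (act (M ^ j) x))))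
  have hz : ‖z‖ ≤ K * (max Rη 0 + √d) := by
    refine (hκle j _).trans (mul_le_mul ((le_abs_self _).trans (hK _ ⟨j, rfl⟩)) ?_ (norm_nonneg _)
      ((norm_nonneg _).trans (hK _ ⟨j, rfl⟩)))
    exact (norm_sub_le _ _).trans (add_le_add hy1 (norm_sub_floorVec_le _))
  have : f (x + z) = 0 := by
    by_contra hcon
    have h1 := hRf _ (subset_tsupport f hcon)
    have h2 := norm_sub_le (x + z) z
    rw [add_sub_cancel_right] at h2
    linarith
  simp [this]

lemma exists_norm_sample_le {f η : RSpace d → ℂ} (hf : Continuous f)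
    (hfc : HasCompactSupport f) (hη : Integrable η) :
    ∃ C, 0 ≤ C ∧ ∀ j k, ‖sample M f η j k‖ ≤ C := by
  obtain ⟨C, hC⟩ := hfc.exists_bound_of_continuous hf
  have hC0 : 0 ≤ C := (norm_nonneg _).trans (hC 0)
  refine ⟨C * ∫ y, ‖η y‖, mul_nonneg hC0 (integral_nonneg fun _ => norm_nonneg _), fun j k => ?_⟩
  rw [← integral_const_mul]
  refine norm_integral_le_of_norm_le (hη.norm.const_mul C) (ae_of_all _ fun y => ?_)
  rw [norm_mul, RCLike.norm_conj]
  gcongr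
  exact hC _

/-- At fine scales, analysis with `η` followed by synthesis with `η'` approaches the identity, up
to the factor `conj (∫ η) ∫ η'`. -/
lemma tendsto_tsum_inner_wav (hM : IsDilation M) (hdet : M.det ≠ 0) {f g η η' : RSpace d → ℂ}
    (hf : Continuous f) (hfc : HasCompactSupport f) (hf2 : MemLp f 2 volume)
    (hg : Continuous g) (hgc : HasCompactSupport g) (hg2 : MemLp g 2 volume)
    (hη : MemLp η 2 volume) (hηi : Integrable η) (hηc : HasCompactSupport η)
    (hη' : MemLp η' 2 volume) (hηi' : Integrable η') :
    Tendsto (fun j : ℕ => ∑' k, inner ℂ (wav hdet (hη.toLp η) (j, k)) (hf2.toLp f)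
        * conj (inner ℂ (wav hdet (hη'.toLp η') (j, k)) (hg2.toLp g))) atTop
      (𝓝 (conj (∫ x, η x) * (∫ x, η' x) * pairing f g)) := by
  obtain ⟨R, hR⟩ := exists_sample_eq_zero hM hfc hηc
  obtain ⟨C, hC0, hC⟩ := exists_norm_sample_le (M := M) hf hfc hηi
  obtain ⟨C', hC0', hC'⟩ := exists_norm_sample_le (M := M) hg hgc hηi'
  obtain ⟨r, -, hr⟩ := exists_suppIn hη hηc
  obtain ⟨r', -, hr'⟩ := exists_suppIn hf2 hfc
  let h : ℕ → IntLattice d → ℂ := fun j k => sample M f η j k * conj (sample M g η' j k)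
  have hDne : ∀ j, |((M ^ j).det : ℝ)| ≠ 0 := fun j =>
    abs_ne_zero.2 (by exact_mod_cast det_pow_ne_zero hdet j)
  have hfin : ∀ j, (Function.support (h j)).Finite := by
    intro j
    refine (finite_inner_wav_ne_zero hdet hr hr' j).subset fun k hk => ?_
    simp only [Set.mem_ofPred_eq]
    rw [inner_wav_toLp]
    refine mul_ne_zero ?_ (left_ne_zero_of_mul hk)
    rw [Complex.ofReal_ne_zero]
    exact inv_ne_zero (Real.sqrt_ne_zero'.2 (lt_of_le_of_ne (abs_nonneg _) (hDne j).symm))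
  have hW : ∀ j, ∑' k, inner ℂ (wav hdet (hη.toLp η) (j, k)) (hf2.toLp f)
      * conj (inner ℂ (wav hdet (hη'.toLp η') (j, k)) (hg2.toLp g))
      = ∫ x : RSpace d, h j (floorVec (act (M ^ j) x)) := by
    intro j
    rw [integral_comp_act (det_pow_ne_zero hdet j) (fun y => h j (floorVec y)),
      integral_comp_floorVec (summable_of_hasFiniteSupport ((hfin j).subset fun k hk => by
        simpa using hk)), Complex.real_smul, ← tsum_mul_left]
    refine tsum_congr fun k => ?_
    rw [inner_wav_toLp, inner_wav_toLp, map_mul, Complex.conj_ofReal]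
    have h2 : (((√|((M ^ j).det : ℝ)|)⁻¹ : ℝ) : ℂ) * (((√|((M ^ j).det : ℝ)|)⁻¹ : ℝ) : ℂ)
        = ((|((M ^ j).det : ℝ)|⁻¹ : ℝ) : ℂ) := by
      rw [← Complex.ofReal_mul, ← mul_inv, Real.mul_self_sqrt (abs_nonneg _)]
    rw [← h2]
    ring
  -- both sides are integrals now, and dominated convergence applies
  simp only [hW]
  have hlim : conj (∫ x, η x) * (∫ x, η' x) * pairing f g
      = ∫ x, (f x * conj (∫ y, η y)) * conj (g x * conj (∫ y, η' y)) := by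
    rw [pairing, ← integral_const_mul]
    refine integral_congr_ae (ae_of_all _ fun x => ?_)
    simp only [map_mul, Complex.conj_conj]
    ring
  rw [hlim]
  refine tendsto_integral_of_dominated_convergence
    ((Metric.closedBall (0 : RSpace d) R).indicator fun _ => C * C') (fun j => ?_) ?_
    (fun j => ae_of_all _ fun x => ?_) (ae_of_all _ fun x => ?_)
  · exact ((measurable_of_countable (h j)).comp
      (measurable_floorVec.comp (measurable_act _))).aestronglyMeasurable
  · exact (integrable_indicator_iff Metric.isClosed_closedBall.measurableSet).2
      (integrableOn_const (isCompact_closedBall _ _).measure_lt_top.ne)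
  · by_cases hx : ‖x‖ ≤ R
    · rw [Set.indicator_of_mem (by simpa using hx)]
      simp only [h, norm_mul, RCLike.norm_conj]
      exact mul_le_mul (hC _ _) (hC' _ _) (norm_nonneg _) hC0
    · rw [Set.indicator_of_notMem (by simpa using hx)]
      simp only [h]
      rw [hR j x (not_le.1 hx)]
      simp
  · exact (tendsto_sample hM hf hfc hηi x).mul
      ((Complex.continuous_conj.tendsto _).comp (tendsto_sample hM hg hgc hηi' x))

end limit

/-! ### Telescoping of the scales and the dual framelet in `L²` -/

section telescope
variable {d : ℕ} {M : Matrix (Fin d) (Fin d) ℤ}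

/-- The combination `∑ k, u(k) g(· - k)` of lattice translates. -/
def lcomb (u : Laurent d) (g : L2Space d) : L2Space d :=
  ∑ k ∈ u.coeff.support, u.coeff k • transL (latticeVec k) g

lemma coeff_adj_mul (u x : Laurent d) (n : IntLattice d) :
    (adj u * x).coeff n = ∑ k ∈ u.coeff.support, conj (u.coeff k) * x.coeff (n + k) := by
  conv_lhs => rw [← AddMonoidAlgebra.sum_coeff_single u, Finsupp.sum, map_sum, Finset.sum_mul]
  rw [AddMonoidAlgebra.coeff_sum, Finsupp.finsetSum_apply]
  refine Finset.sum_congr rfl fun k _ => ?_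
  rw [adj_single]
  exact AddMonoidAlgebra.coeff_single_mul_eq_mul_coeff _ fun m' _ => by
    rw [neg_add_eq_iff_eq_add, add_comm]

/-- The inner product of two filters is the constant coefficient of `x * y^⋆`. -/
lemma coeff_zero_mul_adj (x y : Laurent d) :
    (x * adj y).coeff 0 = ∑' k, x.coeff k * conj (y.coeff k) := by
  have h : (x * adj y).coeff 0 = conj ((adj x * y).coeff 0) := by
    rw [← neg_zero (G := IntLattice d), ← coeff_adj, map_mul, adj_adj, neg_zero]
  rw [h, coeff_adj_mul, map_sum, tsum_eq_sum (s := x.coeff.support) fun k hk => by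
    rw [Finsupp.notMem_support_iff.1 hk, zero_mul]]
  simp

/-- The analysis coefficients `k ↦ ⟨f, |det M|^{j/2} g(M^j · - k)⟩`, as a filter. -/
def analysisCoeff (hdet : M.det ≠ 0) (g f : L2Space d) (j : ℕ)
    (h : {k | inner ℂ (wav hdet g (j, k)) f ≠ 0}.Finite) : Laurent d :=
  AddMonoidAlgebra.ofCoeff (Finsupp.ofSupportFinite (fun k => inner ℂ (wav hdet g (j, k)) f) h)

lemma coeff_analysisCoeff (hdet : M.det ≠ 0) (g f : L2Space d) (j : ℕ)
    (h : {k | inner ℂ (wav hdet g (j, k)) f ≠ 0}.Finite) (k : IntLattice d) :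
    (analysisCoeff hdet g f j h).coeff k = inner ℂ (wav hdet g (j, k)) f := rfl

lemma wav_lcomb (hdet : M.det ≠ 0) (u : Laurent d) (g : L2Space d) (j : ℕ) (n : IntLattice d) :
    wav hdet (lcomb u g) (j, n) = ∑ k ∈ u.coeff.support, u.coeff k • wav hdet g (j, n + k) := by
  simp only [wav, lcomb, map_sum, map_smul, latticeVec_add, transL_add]

lemma inner_wav_lcomb (hdet : M.det ≠ 0) (u : Laurent d) (g f : L2Space d) (j : ℕ)
    (h : {k | inner ℂ (wav hdet g (j, k)) f ≠ 0}.Finite) (n : IntLattice d) :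
    inner ℂ (wav hdet (lcomb u g) (j, n)) f = (adj u * analysisCoeff hdet g f j h).coeff n := by
  rw [wav_lcomb, sum_inner, coeff_adj_mul]
  refine Finset.sum_congr rfl fun k _ => ?_
  rw [inner_smul_left, coeff_analysisCoeff]

/-- A dilation by `M` moves the wavelets to the next scale, with the lattice subsampled. -/
lemma wav_dil (hdet : M.det ≠ 0) (g : L2Space d) (j : ℕ) (n : IntLattice d) :
    wav hdet (dil M hdet g) (j, n) = wav hdet g (j + 1, latMap M n) := by
  have h1 : ∀ (A : Matrix (Fin d) (Fin d) ℤ) (hA : A.det ≠ 0) (_ : A = M * M ^ j) (g : L2Space d),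
      dil A hA g = dil (M ^ j) (det_pow_ne_zero hdet j) (dil M hdet g) := by
    rintro A hA rfl g
    exact dil_mul _ _ _ _
  simp only [wav]
  rw [h1 _ (det_pow_ne_zero hdet (j + 1)) (pow_succ' M j), transL_dil, latticeVec_latMap]

lemma wav_smul (hdet : M.det ≠ 0) (c : ℂ) (g : L2Space d) (p : ℕ × IntLattice d) :
    wav hdet (c • g) p = c • wav hdet g p := by
  simp only [wav, map_smul]

lemma wav_zero (hdet : M.det ≠ 0) (g : L2Space d) (k : IntLattice d) :
    wav hdet g (0, k) = transL (latticeVec k) g := by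
  have h1 : ∀ (A : Matrix (Fin d) (Fin d) ℤ) (hA : A.det ≠ 0) (_ : A = 1) (g : L2Space d),
      dil A hA g = g := by
    rintro A hA rfl g
    obtain ⟨f, hf, rfl⟩ := exists_toLp g
    rw [dil_toLp]
    refine MemLp.toLp_congr _ _ (Eventually.of_forall fun x => ?_)
    simp [dilFun, act_one]
  exact h1 _ _ (pow_zero M) _

/-- The function `|det M| ∑ k, u(k) g(M · - k)`, whose Fourier transform at `Mᵀ ξ` is
`û(ξ) ĝ(ξ)`. -/
def upsynth (hdet : M.det ≠ 0) (u : Laurent d) (g : L2Space d) : L2Space d :=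
  ((√|(M.det : ℝ)| : ℝ) : ℂ) • dil M hdet (lcomb u g)

lemma inner_wav_upsynth (hdet : M.det ≠ 0) (u : Laurent d) (g f : L2Space d) (j : ℕ)
    (h : {k | inner ℂ (wav hdet g (j + 1, k)) f ≠ 0}.Finite) (n : IntLattice d) :
    inner ℂ (wav hdet (upsynth hdet u g) (j, n)) f = ((√|(M.det : ℝ)| : ℝ) : ℂ)
      * (down M (latMap_injective hdet) (adj u * analysisCoeff hdet g f (j + 1) h)).coeff n := by
  rw [upsynth, wav_smul, wav_dil, inner_smul_left, Complex.conj_ofReal, coeff_down,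
    inner_wav_lcomb hdet u g f (j + 1) h]

lemma sqrt_det_mul_self : ((√|(M.det : ℝ)| : ℝ) : ℂ) * ((√|(M.det : ℝ)| : ℝ) : ℂ)
    = (M.det.natAbs : ℂ) := by
  rw [← Complex.ofReal_mul, Real.mul_self_sqrt (abs_nonneg _), ← Int.cast_abs, Int.abs_eq_natAbs,
    Int.cast_natCast, Complex.ofReal_natCast]

/-- The pairings of the low-pass and the high-pass coefficients at scale `j` add up to the pairing
of the low-pass coefficients at scale `j + 1`. -/
lemma tsum_inner_wav_add (hdet : M.det ≠ 0) {s : ℕ} {a a' θ θ' : Laurent d}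
    {b b' : Fin s → Laurent d}
    (hbank : ∀ ω ∈ Omega M, adj a * up M (adj θ * θ') * modul ((2 * Real.pi) • ω) a'
        + ∑ l, adj (b l) * modul ((2 * Real.pi) • ω) (b' l)
      = (open Classical in if ω = 0 then (1 : ℂ) else 0) • (adj θ * θ'))
    {φ φ' f g : L2Space d} (hφ : φ = upsynth hdet a φ) (hφ' : φ' = upsynth hdet a' φ')
    (hfin : ∀ j, {k | inner ℂ (wav hdet φ (j, k)) f ≠ 0}.Finite)
    (hfin' : ∀ j, {k | inner ℂ (wav hdet φ' (j, k)) g ≠ 0}.Finite) (j : ℕ) :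
    ∑' k, inner ℂ (wav hdet (lcomb θ φ) (j, k)) f * conj (inner ℂ (wav hdet (lcomb θ' φ') (j, k)) g)
      + ∑ l, ∑' k, inner ℂ (wav hdet (upsynth hdet (b l) φ) (j, k)) f
          * conj (inner ℂ (wav hdet (upsynth hdet (b' l) φ') (j, k)) g)
      = ∑' k, inner ℂ (wav hdet (lcomb θ φ) (j + 1, k)) f
          * conj (inner ℂ (wav hdet (lcomb θ' φ') (j + 1, k)) g) := by
  set X : ℕ → Laurent d := fun j => analysisCoeff hdet φ f j (hfin j)
  set Y : ℕ → Laurent d := fun j => analysisCoeff hdet φ' g j (hfin' j)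
  have hW : ∀ j, ∑' k, inner ℂ (wav hdet (lcomb θ φ) (j, k)) f
      * conj (inner ℂ (wav hdet (lcomb θ' φ') (j, k)) g)
      = (X j * (adj θ * θ') * adj (Y j)).coeff 0 := by
    intro j
    have h1 : X j * (adj θ * θ') * adj (Y j) = (adj θ * X j) * adj (adj θ' * Y j) := by
      rw [map_mul, adj_adj]; ring
    rw [h1, coeff_zero_mul_adj]
    exact tsum_congr fun k => by
      rw [inner_wav_lcomb hdet θ φ f j (hfin j), inner_wav_lcomb hdet θ' φ' g j (hfin' j)]
  have hX : X j = ((√|(M.det : ℝ)| : ℝ) : ℂ) •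
      down M (latMap_injective hdet) (adj a * X (j + 1)) := by
    ext n
    have h1 := inner_wav_upsynth hdet a φ f j (hfin (j + 1)) n
    rw [← hφ] at h1
    exact h1
  have hY : Y j = ((√|(M.det : ℝ)| : ℝ) : ℂ) •
      down M (latMap_injective hdet) (adj a' * Y (j + 1)) := by
    ext n
    have h1 := inner_wav_upsynth hdet a' φ' g j (hfin' (j + 1)) n
    rw [← hφ'] at h1
    exact h1
  rw [hW, hW, ← coeff_zero_filterBank hdet hbank (X (j + 1)) (Y (j + 1)), hX, hY, adj_smul,
    Complex.conj_ofReal]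
  congr 1
  · rw [smul_mul_assoc, smul_mul_assoc, mul_smul_comm, smul_smul, sqrt_det_mul_self,
      AddMonoidAlgebra.coeff_smul_apply, smul_eq_mul]
  · refine Finset.sum_congr rfl fun l _ => ?_
    rw [coeff_zero_mul_adj, ← tsum_mul_left]
    refine tsum_congr fun k => ?_
    rw [inner_wav_upsynth hdet (b l) φ f j (hfin (j + 1)),
      inner_wav_upsynth hdet (b' l) φ' g j (hfin' (j + 1)), map_mul, Complex.conj_ofReal,
      ← sqrt_det_mul_self]
    ring

/-- The framelet system generated by `η` and `ψ`, as vectors of `L²(ℝ^d)`. -/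
def frameletL2 {s : ℕ} (hdet : M.det ≠ 0) (η : L2Space d) (ψ : Fin s → L2Space d) :
    SystemIndex d s → L2Space d
  | Sum.inl k => transL (latticeVec k) η
  | Sum.inr (j, k, l) => wav hdet (ψ l) (j, k)

lemma ev_zero_eq_sum (u : Laurent d) : ev 0 u = ∑ k ∈ u.coeff.support, u.coeff k := by
  conv_lhs => rw [← AddMonoidAlgebra.sum_coeff_single u, Finsupp.sum, map_sum]
  refine Finset.sum_congr rfl fun k _ => ?_
  rw [ev_single, expChar_apply]
  simp

/-- The translates of `η` are Bessel by bounded overlap, and the wavelets by almost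
orthogonality. -/
lemma exists_isBessel_frameletL2 (hM : IsDilation M) (hdet : M.det ≠ 0) {s : ℕ} {a : Laurent d}
    {b : Fin s → Laurent d} {φ η : L2Space d} {R r : ℝ} (hR : SuppIn R φ) (hr : SuppIn r η)
    (hφ : φ = upsynth hdet a φ) (hb : ∀ l, ev 0 (b l) = 0)
    (hψ : ∀ l, ∃ r', SuppIn r' (upsynth hdet (b l) φ)) :
    ∃ B, 0 ≤ B ∧ IsBessel (frameletL2 hdet η fun l => upsynth hdet (b l) φ) B := by
  have hform : ∀ u : Laurent d, upsynth hdet u φ = ∑ k ∈ u.coeff.support,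
      (((√|(M.det : ℝ)| : ℝ) : ℂ) * u.coeff k) • dil M hdet (transL (latticeVec k) φ) := by
    intro u
    simp only [upsynth, lcomb, map_sum, map_smul, Finset.smul_sum, smul_smul]
  have h1 : ∀ l, ∃ B, 0 ≤ B ∧ IsBessel (wav hdet (upsynth hdet (b l) φ)) B := by
    intro l
    obtain ⟨r', hr'⟩ := hψ l
    refine exists_isBessel_wav hM hdet hR hr' _ _ (hφ.trans (hform a)) _ _ (hform (b l)) ?_
    rw [← Finset.mul_sum, ← ev_zero_eq_sum, hb, mul_zero]
  choose B hB0 hB using h1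
  refine ⟨overlap d r * ‖η‖ ^ 2 + ∑ l, B l, add_nonneg (mul_nonneg (overlap_nonneg d r)
    (sq_nonneg _)) (Finset.sum_nonneg fun l _ => hB0 l), fun f F => ?_⟩
  classical
  have hF : F ⊆ (F.toLeft).disjSum (F.toRight.image (fun p => (p.1, p.2.1)) ×ˢ Finset.univ |>.image
      fun q : (ℕ × IntLattice d) × Fin s => (q.1.1, q.1.2, q.2)) := by
    intro i hi
    rcases i with k | ⟨j, k, l⟩
    · simpa using hi
    · rw [Finset.inr_mem_disjSum, Finset.mem_image]
      refine ⟨((j, k), l), ?_, rfl⟩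
      rw [Finset.mem_product, Finset.mem_image]
      exact ⟨⟨(j, k, l), by simpa using hi, rfl⟩, Finset.mem_univ _⟩
  refine (Finset.sum_le_sum_of_subset_of_nonneg hF fun _ _ _ => sq_nonneg _).trans ?_
  rw [Finset.sum_disjSum, add_mul]
  refine add_le_add (sum_norm_inner_transL_sq_le hr f _) ?_
  rw [Finset.sum_image (by rintro ⟨⟨_, _⟩, _⟩ _ ⟨⟨_, _⟩, _⟩ _ h; simpa [and_assoc] using h),
    Finset.sum_product_right, Finset.sum_mul]
  exact Finset.sum_le_sum fun l _ => hB l f _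

/-- Summing the telescoping identity over all scales: the two framelet systems reproduce the inner
products of continuous functions with compact support. -/
lemma tsum_frameletL2 (hM : IsDilation M) (hdet : M.det ≠ 0) {s : ℕ} {a a' θ θ' : Laurent d}
    {b b' : Fin s → Laurent d}
    (hbank : ∀ ω ∈ Omega M, adj a * up M (adj θ * θ') * modul ((2 * Real.pi) • ω) a'
        + ∑ l, adj (b l) * modul ((2 * Real.pi) • ω) (b' l)
      = (open Classical in if ω = 0 then (1 : ℂ) else 0) • (adj θ * θ'))
    {φ φ' : L2Space d} (hφ : φ = upsynth hdet a φ) (hφ' : φ' = upsynth hdet a' φ')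
    {R R' : ℝ} (hR : SuppIn R φ) (hR' : SuppIn R' φ')
    {η η' : RSpace d → ℂ} (hη : MemLp η 2 volume) (hη' : MemLp η' 2 volume)
    (hηi : Integrable η) (hηi' : Integrable η') (hηc : HasCompactSupport η)
    (hηθ : hη.toLp η = lcomb θ φ) (hηθ' : hη'.toLp η' = lcomb θ' φ')
    (hone : conj (∫ x, η x) * ∫ x, η' x = 1) {B B' : ℝ}
    (hB : IsBessel (frameletL2 hdet (hη.toLp η) fun l => upsynth hdet (b l) φ) B)
    (hB' : IsBessel (frameletL2 hdet (hη'.toLp η') fun l => upsynth hdet (b' l) φ') B')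
    {f g : RSpace d → ℂ}
    (hf : Continuous f) (hfc : HasCompactSupport f) (hf2 : MemLp f 2 volume)
    (hg : Continuous g) (hgc : HasCompactSupport g) (hg2 : MemLp g 2 volume) :
    ∑' i, inner ℂ (frameletL2 hdet (hη.toLp η) (fun l => upsynth hdet (b l) φ) i) (hf2.toLp f)
        * conj (inner ℂ (frameletL2 hdet (hη'.toLp η') (fun l => upsynth hdet (b' l) φ') i)
          (hg2.toLp g))
      = inner ℂ (hg2.toLp g) (hf2.toLp f) := by
  obtain ⟨rf, -, hrf⟩ := exists_suppIn hf2 hfc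
  obtain ⟨rg, -, hrg⟩ := exists_suppIn hg2 hgc
  set F := hf2.toLp f
  set G := hg2.toLp g
  set W : ℕ → ℂ := fun j => ∑' k, inner ℂ (wav hdet (hη.toLp η) (j, k)) F
        * conj (inner ℂ (wav hdet (hη'.toLp η') (j, k)) G) with hW
  set T : SystemIndex d s → ℂ := fun i =>
    inner ℂ (frameletL2 hdet (hη.toLp η) (fun l => upsynth hdet (b l) φ) i) F
        * conj (inner ℂ (frameletL2 hdet (hη'.toLp η') (fun l => upsynth hdet (b' l) φ') i) G)
    with hT
  have hsum : Summable T := hB.summable_mul hB' F G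
  have hlim : Tendsto W atTop (𝓝 (inner ℂ G F)) := by
    have := tendsto_tsum_inner_wav hM hdet hf hfc hf2 hg hgc hg2 hη hηi hηc hη' hηi'
    rwa [hone, one_mul, ← inner_toLp hf2 hg2] at this
  -- `W 0` is the contribution of `η`, and scale `j` of the wavelets contributes `W (j + 1) - W j`
  have hl : Summable (T ∘ Sum.inl) := hsum.comp_injective Sum.inl_injective
  have hr : Summable (T ∘ Sum.inr) := hsum.comp_injective Sum.inr_injective
  have hj : ∀ j, ∑' p : IntLattice d × Fin s, (T ∘ Sum.inr) (j, p) = W (j + 1) - W j := by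
    intro j
    have h1 := tsum_inner_wav_add hdet hbank hφ hφ'
      (fun j => finite_inner_wav_ne_zero hdet hR hrf j)
      (fun j => finite_inner_wav_ne_zero hdet hR' hrg j) j
    have h2 : Summable fun p : IntLattice d × Fin s => (T ∘ Sum.inr) (j, p) :=
      hr.comp_injective (Prod.mk_right_injective j)
    have h3 : ∑' p : IntLattice d × Fin s, (T ∘ Sum.inr) (j, p)
        = ∑ l, ∑' k, (T ∘ Sum.inr) (j, k, l) := by
      rw [← (Equiv.prodComm (Fin s) (IntLattice d)).tsum_eq, Summable.tsum_prod, tsum_fintype]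
      · rfl
      · exact (Equiv.prodComm (Fin s) (IntLattice d)).summable_iff.2 h2
    rw [h3, eq_sub_iff_add_eq, add_comm]
    simp only [hW, hηθ, hηθ']
    exact h1
  have h0 : ∑' k, (T ∘ Sum.inl) k = W 0 := by
    refine tsum_congr fun k => ?_
    simp only [wav_zero]
    rfl
  rw [hl.tsum_sum hr]
  change ∑' k, (T ∘ Sum.inl) k + ∑' p, (T ∘ Sum.inr) p = _
  rw [h0, hr.tsum_prod]
  have h4 : HasSum (fun j => W (j + 1) - W j) (∑' j, ∑' p, (T ∘ Sum.inr) (j, p)) := by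
    have := hr.prod.hasSum
    simpa only [hj] using this
  have h5 := h4.tendsto_sum_nat
  simp only [Finset.sum_range_sub] at h5
  rw [tendsto_nhds_unique h5 (hlim.sub_const _)]
  ring

lemma dense_continuous_compactSupport : Dense {F : L2Space d | ∃ (f : RSpace d → ℂ)
    (hf2 : MemLp f 2 volume), Continuous f ∧ HasCompactSupport f ∧ hf2.toLp f = F} := by
  intro F
  rw [Metric.mem_closure_iff]
  intro ε hε
  obtain ⟨g, hgc, hgle, hg, hg2⟩ := (Lp.memLp F).exists_hasCompactSupport_eLpNorm_sub_le
    (by norm_num) (ε := ENNReal.ofReal (ε / 2)) (by simpa using hε)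
  refine ⟨hg2.toLp g, ⟨g, hg2, hg, hgc, rfl⟩, ?_⟩
  rw [← Lp.toLp_coeFn F (Lp.memLp F), dist_eq_norm, ← MemLp.toLp_sub, Lp.norm_toLp]
  refine (ENNReal.toReal_mono ENNReal.ofReal_ne_top hgle).trans_lt ?_
  rw [ENNReal.toReal_ofReal (by positivity)]
  linarith

end telescope

/-! ### Generators as functions and their Fourier transforms -/

section fourier
variable {d : ℕ}

lemma norm_exp_neg_I_mul (r : ℝ) : ‖Complex.exp (-(Complex.I * (r : ℂ)))‖ = 1 := by
  rw [Complex.norm_exp]; simp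

lemma continuous_exp_inner (ξ : RSpace d) :
    Continuous fun x : RSpace d => Complex.exp (-(Complex.I * ((inner ℝ x ξ : ℝ) : ℂ))) := by
  fun_prop

lemma integrable_fnHat {f : RSpace d → ℂ} (hf : Integrable f) (ξ : RSpace d) :
    Integrable fun x => f x * Complex.exp (-(Complex.I * ((inner ℝ x ξ : ℝ) : ℂ))) :=
  hf.mul_bdd (continuous_exp_inner ξ).aestronglyMeasurable
    (ae_of_all _ fun _ => (norm_exp_neg_I_mul _).le)

lemma continuous_fnHat {f : RSpace d → ℂ} (hf : Integrable f) : Continuous (fnHat f) := by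
  refine continuous_of_dominated (fun ξ => (integrable_fnHat hf ξ).1) (bound := fun x => ‖f x‖)
    (fun ξ => ae_of_all _ fun x => ?_) hf.norm (ae_of_all _ fun x => by fun_prop)
  rw [norm_mul, norm_exp_neg_I_mul, mul_one]

lemma fnHat_zero (f : RSpace d → ℂ) : fnHat f 0 = ∫ x, f x := by
  simp [fnHat]

/-- A real integrable function with vanishing Fourier transform vanishes: its positive and negative
parts are densities of finite measures with the same characteristic function. -/
lemma ae_eq_zero_of_fnHat_ofReal {r : RSpace d → ℝ} (hr : Integrable r)
    (h : ∀ ξ, fnHat (fun x => (r x : ℂ)) ξ = 0) : r =ᵐ[volume] 0 := by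
  have hm : AEMeasurable (fun x => ENNReal.ofReal (r x)) volume := hr.1.aemeasurable.ennreal_ofReal
  have hm' : AEMeasurable (fun x => ENNReal.ofReal (-r x)) volume :=
    hr.1.aemeasurable.neg.ennreal_ofReal
  have hfin : ∫⁻ x, ENNReal.ofReal (r x) ≠ ⊤ := hr.lintegral_lt_top.ne
  have hfin' : ∫⁻ x, ENNReal.ofReal (-r x) ≠ ⊤ := hr.neg.lintegral_lt_top.ne
  have := isFiniteMeasure_withDensity hfin
  have := isFiniteMeasure_withDensity hfin'
  have key : volume.withDensity (fun x => ENNReal.ofReal (r x))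
      = volume.withDensity fun x => ENNReal.ofReal (-r x) := by
    refine Measure.ext_of_charFun (funext fun t => ?_)
    rw [charFun_apply, charFun_apply,
      integral_withDensity_eq_integral_toReal_smul₀ hm (ae_of_all _ fun _ => ENNReal.ofReal_lt_top),
      integral_withDensity_eq_integral_toReal_smul₀ hm' (ae_of_all _ fun _ => ENNReal.ofReal_lt_top),
      ← sub_eq_zero]
    have hexp : ∀ x : RSpace d, ‖Complex.exp (((inner ℝ x t : ℝ) : ℂ) * Complex.I)‖ ≤ 1 := fun x =>
      (Complex.norm_exp_ofReal_mul_I _).le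
    have hc : Continuous fun x : RSpace d => Complex.exp (((inner ℝ x t : ℝ) : ℂ) * Complex.I) := by
      fun_prop
    have hi : ∀ q : RSpace d → ℝ, Integrable q → Integrable fun x =>
        (ENNReal.ofReal (q x)).toReal • Complex.exp (((inner ℝ x t : ℝ) : ℂ) * Complex.I) := by
      intro q hq
      have h1 : Integrable fun x => (ENNReal.ofReal (q x)).toReal :=
        integrable_toReal_of_lintegral_ne_top hq.1.aemeasurable.ennreal_ofReal
          hq.lintegral_lt_top.ne
      exact h1.smul_bdd 1 hc.aestronglyMeasurable (ae_of_all _ hexp)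
    have hn : Integrable fun x => -r x := hr.neg
    rw [← integral_sub (hi r hr) (hi _ hn), ← h (-t)]
    refine integral_congr_ae (ae_of_all _ fun x => ?_)
    have h2 : (ENNReal.ofReal (r x)).toReal - (ENNReal.ofReal (-r x)).toReal = r x := by
      rw [ENNReal.toReal_ofReal', ENNReal.toReal_ofReal', max_zero_sub_eq_self]
    simp only
    rw [← sub_smul, h2, Complex.real_smul, inner_neg_right]
    congr 2
    push_cast
    ring
  rw [withDensity_eq_iff hm hm' hfin] at key
  filter_upwards [key] with x hx
  rcases le_total 0 (r x) with h1 | h1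
  · rw [ENNReal.ofReal_of_nonpos (by linarith : -r x ≤ 0), ENNReal.ofReal_eq_zero] at hx
    exact le_antisymm hx h1
  · rw [ENNReal.ofReal_of_nonpos h1, eq_comm, ENNReal.ofReal_eq_zero] at hx
    have h2 : 0 ≤ r x := by linarith
    exact le_antisymm h1 h2

/-- The Fourier transform is injective on integrable functions. -/
lemma ae_eq_zero_of_fnHat {f : RSpace d → ℂ} (hf : Integrable f) (h : ∀ ξ, fnHat f ξ = 0) :
    f =ᵐ[volume] 0 := by
  have hbar : ∀ ξ, ∫ x, conj (f x) * Complex.exp (-(Complex.I * ((inner ℝ x ξ : ℝ) : ℂ))) = 0 := by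
    intro ξ
    have h1 := congrArg (starRingEnd ℂ) (h (-ξ))
    rw [fnHat, ← integral_conj, map_zero] at h1
    rw [← h1]
    refine integral_congr_ae (ae_of_all _ fun x => ?_)
    simp only [map_mul, ← Complex.exp_conj, map_neg, Complex.conj_I, Complex.conj_ofReal,
      inner_neg_right]
    congr 2
    push_cast
    ring
  have hc : Integrable fun x => conj (f x) := by
    refine hf.norm.mono' (Complex.continuous_conj.comp_aestronglyMeasurable hf.1)
      (ae_of_all _ fun x => ?_)
    rw [RCLike.norm_conj]
  have hre := ae_eq_zero_of_fnHat_ofReal (d := d) hf.re fun ξ => by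
    have h1 : ∀ x, ((RCLike.re (f x) : ℝ) : ℂ) * Complex.exp (-(Complex.I * ((inner ℝ x ξ : ℝ) : ℂ)))
        = (1 / 2) * (f x * Complex.exp (-(Complex.I * ((inner ℝ x ξ : ℝ) : ℂ)))
          + conj (f x) * Complex.exp (-(Complex.I * ((inner ℝ x ξ : ℝ) : ℂ)))) := by
      intro x
      have := Complex.re_eq_add_conj (f x)
      simp only [RCLike.re_eq_complex_re]
      rw [this]; ring
    rw [fnHat, integral_congr_ae (ae_of_all _ h1), integral_const_mul,
      integral_add (integrable_fnHat hf ξ) (integrable_fnHat hc ξ), hbar ξ]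
    have := h ξ
    rw [fnHat] at this
    rw [this]; simp
  have him := ae_eq_zero_of_fnHat_ofReal (d := d) hf.im fun ξ => by
    have h1 : ∀ x, ((RCLike.im (f x) : ℝ) : ℂ) * Complex.exp (-(Complex.I * ((inner ℝ x ξ : ℝ) : ℂ)))
        = (1 / (2 * Complex.I)) * (f x * Complex.exp (-(Complex.I * ((inner ℝ x ξ : ℝ) : ℂ)))
          - conj (f x) * Complex.exp (-(Complex.I * ((inner ℝ x ξ : ℝ) : ℂ)))) := by
      intro x
      have := Complex.im_eq_sub_conj (f x)
      simp only [RCLike.im_eq_complex_im]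
      rw [this]; ring
    rw [fnHat, integral_congr_ae (ae_of_all _ h1), integral_const_mul,
      integral_sub (integrable_fnHat hf ξ) (integrable_fnHat hc ξ), hbar ξ]
    have := h ξ
    rw [fnHat] at this
    rw [this]; simp
  filter_upwards [hre, him] with x h1 h2
  exact Complex.ext h1 h2

lemma integrable_of_memLp {f : RSpace d → ℂ} (hf : MemLp f 2 volume) (hfc : HasCompactSupport f) :
    Integrable f := by
  exact memLp_one_iff_integrable.1 (hf.mono_exponent_of_measure_support_ne_top
    (fun x hx => image_eq_zero_of_notMem_tsupport hx) hfc.measure_lt_top.ne one_le_two)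

end fourier

section generators
variable {d : ℕ} {M : Matrix (Fin d) (Fin d) ℤ}

/-- The function `∑ k, u(k) f(· - k)`. -/
def lcombFun (u : Laurent d) (f : RSpace d → ℂ) : RSpace d → ℂ :=
  fun x => ∑ k ∈ u.coeff.support, u.coeff k * f (x - latticeVec k)

lemma memLp_lcombFun (u : Laurent d) {f : RSpace d → ℂ} (hf : MemLp f 2 volume) :
    MemLp (lcombFun u f) 2 volume :=
  memLp_finsetSum _ fun k _ => (memLp_trans hf (latticeVec k)).const_mul _

lemma hasCompactSupport_lcombFun (u : Laurent d) {f : RSpace d → ℂ} (hf : HasCompactSupport f) :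
    HasCompactSupport (lcombFun u f) := by
  refine HasCompactSupport.intro (K := ⋃ k ∈ u.coeff.support, (fun x => x + latticeVec k) '' tsupport f)
    (u.coeff.support.isCompact_biUnion fun _ _ => hf.isCompact.image (by fun_prop)) fun x hx => ?_
  refine Finset.sum_eq_zero fun k hk => ?_
  rw [image_eq_zero_of_notMem_tsupport (f := f), mul_zero]
  intro hcon
  exact hx (Set.mem_biUnion hk ⟨_, hcon, sub_add_cancel _ _⟩)

lemma toLp_lcombFun (u : Laurent d) {f : RSpace d → ℂ} (hf : MemLp f 2 volume) :
    (memLp_lcombFun u hf).toLp _ = lcomb u (hf.toLp f) := by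
  refine Lp.ext ((MemLp.coeFn_toLp _).trans (EventuallyEq.symm ?_))
  have h1 : ∀ k ∈ u.coeff.support, ∀ᵐ x, (u.coeff k • transL (latticeVec k) (hf.toLp f) : L2Space d) x
      = u.coeff k * f (x - latticeVec k) := by
    intro k _
    rw [transL_toLp, ← MemLp.toLp_const_smul]
    exact (MemLp.coeFn_toLp _).trans (Eventually.of_forall fun x => rfl)
  filter_upwards [Lp.coeFn_fun_finsetSum u.coeff.support
    (fun k => u.coeff k • transL (latticeVec k) (hf.toLp f)), (ae_ball_iff
      (Finset.countable_toSet u.coeff.support)).2 h1] with x h2 h3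
  rw [lcomb, h2]
  exact Finset.sum_congr rfl h3

lemma integral_lcombFun_mul (u : Laurent d) {f : RSpace d → ℂ} (hf : Integrable f)
    (hfc : HasCompactSupport f) {q : RSpace d → ℂ} (hq : Continuous q) :
    ∫ x, q x * lcombFun u f x
      = ∫ x, (∑ k ∈ u.coeff.support, u.coeff k * q (x + latticeVec k)) * f x := by
  have hi : ∀ t, Integrable fun x => f x * q (x + t) := fun t =>
    integrable_mul_continuous hf hfc (hq.comp (by fun_prop))
  have h1 : ∀ x, q x * lcombFun u f x = ∑ k ∈ u.coeff.support,
      u.coeff k * (fun y => f y * q (y + latticeVec k)) (x - latticeVec k) := by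
    intro x
    simp only [lcombFun, Finset.mul_sum, sub_add_cancel]
    exact Finset.sum_congr rfl fun k _ => by ring
  have h2 : ∀ x, (∑ k ∈ u.coeff.support, u.coeff k * q (x + latticeVec k)) * f x
      = ∑ k ∈ u.coeff.support, u.coeff k * (f x * q (x + latticeVec k)) := by
    intro x
    rw [Finset.sum_mul]
    exact Finset.sum_congr rfl fun k _ => by ring
  rw [integral_congr_ae (ae_of_all _ h1), integral_congr_ae (ae_of_all _ h2),
    integral_finsetSum _ fun k _ => ((hi _).comp_sub_right (latticeVec k)).const_mul _,
    integral_finsetSum _ fun k _ => (hi _).const_mul _]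
  refine Finset.sum_congr rfl fun k _ => ?_
  rw [integral_const_mul, integral_const_mul, integral_sub_right_eq_self
    (fun y => f y * q (y + latticeVec k))]

lemma fnHat_lcombFun (u : Laurent d) {f : RSpace d → ℂ} (hf : Integrable f)
    (hfc : HasCompactSupport f) (ξ : RSpace d) : fnHat (lcombFun u f) ξ = ev ξ u * fnHat f ξ := by
  have h1 := integral_lcombFun_mul u hf hfc (continuous_exp_inner ξ)
  simp only [mul_comm (Complex.exp _) (lcombFun u f _)] at h1
  rw [fnHat, h1, fnHat, ← integral_const_mul]
  refine integral_congr_ae (ae_of_all _ fun x => ?_)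
  have h2 : ev ξ u = ∑ k ∈ u.coeff.support, u.coeff k * expChar ξ (Multiplicative.ofAdd k) := by
    conv_lhs => rw [← AddMonoidAlgebra.sum_coeff_single u, Finsupp.sum, map_sum]
    exact Finset.sum_congr rfl fun k _ => ev_single _ _ _
  simp only
  rw [h2, Finset.sum_mul, Finset.sum_mul]
  refine Finset.sum_congr rfl fun k _ => ?_
  rw [expChar_apply, inner_add_left, Complex.ofReal_add, mul_add, neg_add, Complex.exp_add]
  ring

/-- The function `|det M| ∑ k, u(k) f(M · - k)`. -/
def upsynthFun (M : Matrix (Fin d) (Fin d) ℤ) (u : Laurent d) (f : RSpace d → ℂ) : RSpace d → ℂ :=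
  fun x => ((|(M.det : ℝ)| : ℝ) : ℂ) * lcombFun u f (act M x)

lemma upsynthFun_eq (u : Laurent d) (f : RSpace d → ℂ) : upsynthFun M u f
    = fun x => ((√|(M.det : ℝ)| : ℝ) : ℂ) • dilFun M (lcombFun u f) x := by
  funext x
  rw [upsynthFun, dilFun, smul_eq_mul, ← mul_assoc, ← Complex.ofReal_mul,
    Real.mul_self_sqrt (abs_nonneg _)]

lemma memLp_upsynthFun (hdet : M.det ≠ 0) (u : Laurent d) {f : RSpace d → ℂ}
    (hf : MemLp f 2 volume) : MemLp (upsynthFun M u f) 2 volume := by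
  rw [upsynthFun_eq]
  exact (memLp_dilFun hdet (memLp_lcombFun u hf)).const_smul ((√|(M.det : ℝ)| : ℝ) : ℂ)

lemma toLp_upsynthFun (hdet : M.det ≠ 0) (u : Laurent d) {f : RSpace d → ℂ}
    (hf : MemLp f 2 volume) :
    (memLp_upsynthFun hdet u hf).toLp _ = upsynth hdet u (hf.toLp f) := by
  rw [upsynth, ← toLp_lcombFun u hf, dil_toLp, ← MemLp.toLp_const_smul]
  exact MemLp.toLp_congr _ _ (Eventually.of_forall fun x => congrFun (upsynthFun_eq u f) x)

lemma continuous_actInv : Continuous (actInv M : RSpace d → RSpace d) :=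
  LinearMap.continuous_of_finiteDimensional
    (Matrix.toLpLin 2 2 ((M.map (Int.cast : ℤ → ℝ))⁻¹) : RSpace d →ₗ[ℝ] RSpace d)

lemma hasCompactSupport_upsynthFun (hdet : M.det ≠ 0) (u : Laurent d) {f : RSpace d → ℂ}
    (hf : HasCompactSupport f) : HasCompactSupport (upsynthFun M u f) := by
  have h := hasCompactSupport_lcombFun u hf
  refine HasCompactSupport.intro (h.isCompact.image (continuous_actInv (M := M))) fun x hx => ?_
  rw [upsynthFun, image_eq_zero_of_notMem_tsupport (f := lcombFun u f), mul_zero]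
  exact fun hcon => hx ⟨_, hcon, actInv_act hdet x⟩

/-- The adjoint of `upsynthFun M u`, applied to a continuous test function. -/
lemma integral_mul_upsynthFun (hdet : M.det ≠ 0) (u : Laurent d) {f : RSpace d → ℂ}
    (hf : Integrable f) (hfc : HasCompactSupport f) {q : RSpace d → ℂ} (hq : Continuous q) :
    ∫ x, q x * upsynthFun M u f x = ∫ x, (∑ k ∈ u.coeff.support,
      u.coeff k * q (actInv M (x + latticeVec k))) * f x := by
  have h1 : ∀ x, q x * upsynthFun M u f x = (fun y => ((|(M.det : ℝ)| : ℝ) : ℂ) *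
      (q (actInv M y) * lcombFun u f y)) (act M x) := by
    intro x
    simp only [upsynthFun, actInv_act hdet]
    ring
  rw [integral_congr_ae (ae_of_all _ h1), integral_comp_act hdet (fun y => ((|(M.det : ℝ)| : ℝ) : ℂ) *
      (q (actInv M y) * lcombFun u f y)), integral_const_mul,
    integral_lcombFun_mul u hf hfc (q := fun y => q (actInv M y)) (hq.comp continuous_actInv), Complex.real_smul, ← mul_assoc,
    ← Complex.ofReal_mul, inv_mul_cancel₀ (abs_ne_zero.2 (by exact_mod_cast hdet)),
    Complex.ofReal_one, one_mul]

lemma fnHat_upsynthFun (hdet : M.det ≠ 0) (u : Laurent d) {f : RSpace d → ℂ} (hf : Integrable f)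
    (hfc : HasCompactSupport f) (ξ : RSpace d) :
    fnHat (upsynthFun M u f) (act Mᵀ ξ) = ev ξ u * fnHat f ξ := by
  have h1 := integral_mul_upsynthFun hdet u hf hfc (continuous_exp_inner (act Mᵀ ξ))
  have h2 := integral_lcombFun_mul u hf hfc (continuous_exp_inner ξ)
  rw [← fnHat_lcombFun u hf hfc, fnHat, fnHat]
  simp only [mul_comm _ (Complex.exp _)]
  rw [h1, h2]
  simp only [← inner_act_left, act_actInv hdet]

lemma act_actInvTranspose (hdet : M.det ≠ 0) (ξ : RSpace d) : act Mᵀ (actInvTranspose M ξ) = ξ := by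
  have h : actInvTranspose M ξ = actInv Mᵀ ξ := by
    rw [actInvTranspose, actInv, Matrix.transpose_map]
  rw [h, act_actInv (by rwa [Matrix.det_transpose])]

/-- The refinement equation in the Fourier domain amounts to a refinement equation in the time
domain. -/
lemma toLp_eq_upsynth (hdet : M.det ≠ 0) (a : Laurent d) {φ : RSpace d → ℂ} (hφ : MemLp φ 2 volume)
    (hφc : HasCompactSupport φ) (href : ∀ ξ, fnHat φ (act Mᵀ ξ) = ev ξ a * fnHat φ ξ) :
    hφ.toLp φ = upsynth hdet a (hφ.toLp φ) := by
  have hi := integrable_of_memLp hφ hφc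
  have hi' := integrable_of_memLp (memLp_upsynthFun hdet a hφ) (hasCompactSupport_upsynthFun hdet a hφc)
  rw [← toLp_upsynthFun]
  refine MemLp.toLp_congr _ _ ?_
  have h := ae_eq_zero_of_fnHat (hi.sub hi') fun ξ => by
    have h1 : fnHat (φ - upsynthFun M a φ) ξ = fnHat φ ξ - fnHat (upsynthFun M a φ) ξ := by
      rw [fnHat, fnHat, fnHat, ← integral_sub (integrable_fnHat hi ξ) (integrable_fnHat hi' ξ)]
      exact integral_congr_ae (ae_of_all _ fun x => by simp [sub_mul])
    rw [h1, ← act_actInvTranspose hdet ξ, fnHat_upsynthFun hdet a hi hφc, href, sub_self]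
  filter_upwards [h] with x hx
  exact sub_eq_zero.1 hx

end generators

/-! ### Vanishing moments -/

section moments
variable {d : ℕ} {M : Matrix (Fin d) (Fin d) ℤ}

/-- The pointwise product of a sequence on the lattice and a filter. -/
def mulSeq (r : IntLattice d → ℂ) (u : Laurent d) : Laurent d :=
  AddMonoidAlgebra.ofCoeff (Finsupp.onFinset u.coeff.support (fun k => r k * u.coeff k)
    fun _ h => Finsupp.mem_support_iff.2 (right_ne_zero_of_mul h))

lemma coeff_mulSeq (r : IntLattice d → ℂ) (u : Laurent d) (k : IntLattice d) :
    (mulSeq r u).coeff k = r k * u.coeff k := rfl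

lemma mulSeq_add (r : IntLattice d → ℂ) (u w : Laurent d) :
    mulSeq r (u + w) = mulSeq r u + mulSeq r w := by
  ext k
  simp [coeff_mulSeq, mul_add]

lemma mulSeq_zero (r : IntLattice d → ℂ) : mulSeq r (0 : Laurent d) = 0 := by
  ext k
  simp [coeff_mulSeq]

lemma mulSeq_single (r : IntLattice d → ℂ) (k : IntLattice d) (c : ℂ) :
    mulSeq r (AddMonoidAlgebra.single k c) = AddMonoidAlgebra.single k (r k * c) := by
  classical
  ext l
  rw [coeff_mulSeq, AddMonoidAlgebra.coeff_single, AddMonoidAlgebra.coeff_single,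
    Finsupp.single_apply, Finsupp.single_apply]
  split_ifs with h
  · rw [h]
  · simp

lemma ev_zero_mulSeq (r : IntLattice d → ℂ) (u : Laurent d) :
    ev 0 (mulSeq r u) = ∑ k ∈ u.coeff.support, u.coeff k * r k := by
  rw [ev_zero_eq_sum]
  have h : (mulSeq r u).coeff.support ⊆ u.coeff.support := fun k hk =>
    Finsupp.mem_support_iff.2 (right_ne_zero_of_mul (Finsupp.mem_support_iff.1 hk))
  rw [Finset.sum_subset h]
  · exact Finset.sum_congr rfl fun k _ => by rw [coeff_mulSeq, mul_comm]
  · exact fun k _ hk => Finsupp.notMem_support_iff.1 hk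

/-- Multiplication by an affine sequence is a first order differential operator. -/
lemma mulSeq_mul {r r' : IntLattice d → ℂ} (h : ∀ k l, r (k + l) = r k + r' l) (u w : Laurent d) :
    mulSeq r (u * w) = mulSeq r u * w + u * mulSeq r' w := by
  induction u using AddMonoidAlgebra.induction_linear with
  | zero => simp [mulSeq_zero]
  | add u v hu hv => rw [add_mul, mulSeq_add, hu, hv, mulSeq_add]; ring
  | single k c =>
    induction w using AddMonoidAlgebra.induction_linear with
    | zero => simp [mulSeq_zero]
    | add u v hu hv => rw [mul_add, mulSeq_add, hu, hv, mulSeq_add]; ring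
    | single l e =>
      simp only [AddMonoidAlgebra.single_mul_single, mulSeq_single, h, ← AddMonoidAlgebra.single_add]
      congr 1
      ring

/-- Multiplication by `r` lowers the order of vanishing at the origin by at most `e`. -/
def LowersBy (e : ℕ) (r : IntLattice d → ℂ) : Prop :=
  ∀ n, ∀ u ∈ augIdeal d ^ (n + e), mulSeq r u ∈ augIdeal d ^ n

lemma LowersBy.mono {e e' : ℕ} {r : IntLattice d → ℂ} (h : LowersBy e r) (he : e ≤ e') :
    LowersBy e' r := fun n u hu => h n u (Ideal.pow_le_pow_right (by omega) hu)

lemma LowersBy.mul {e e' : ℕ} {r r' : IntLattice d → ℂ} (h : LowersBy e r) (h' : LowersBy e' r') :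
    LowersBy (e + e') fun k => r k * r' k := by
  intro n u hu
  have h1 : mulSeq (fun k => r k * r' k) u = mulSeq r (mulSeq r' u) := by
    ext k
    simp only [coeff_mulSeq, mul_assoc]
  rw [h1]
  exact h n _ (h' (n + e) u (by rwa [add_assoc]))

lemma lowersBy_const (c : ℂ) : LowersBy (d := d) 0 fun _ => c := by
  intro n u hu
  have h1 : mulSeq (fun _ => c) u = algebraMap ℂ (Laurent d) c * u := by
    rw [← Algebra.smul_def]
    ext k
    simp [coeff_mulSeq]
  rw [h1]
  exact Ideal.mul_mem_left _ _ hu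

lemma LowersBy.pow {e : ℕ} {r : IntLattice d → ℂ} (h : LowersBy e r) (n : ℕ) :
    LowersBy (n * e) fun k => r k ^ n := by
  induction n with
  | zero => simpa using lowersBy_const (d := d) 1
  | succ n ih =>
    simp only [pow_succ]
    rw [Nat.succ_mul]
    exact ih.mul h

lemma lowersBy_prod {ι : Type*} (S : Finset ι) {e : ι → ℕ} {r : ι → IntLattice d → ℂ}
    (h : ∀ i, LowersBy (e i) (r i)) : LowersBy (∑ i ∈ S, e i) fun k => ∏ i ∈ S, r i k := by
  classical
  induction S using Finset.induction_on with
  | empty => simpa using lowersBy_const (d := d) 1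
  | insert i S hi ih =>
    simp only [Finset.prod_insert hi, Finset.sum_insert hi]
    exact (h i).mul ih

lemma lowersBy_sum {ι : Type*} (S : Finset ι) {e : ℕ} {r : ι → IntLattice d → ℂ}
    (h : ∀ i ∈ S, LowersBy e (r i)) : LowersBy e fun k => ∑ i ∈ S, r i k := by
  intro n u hu
  have h1 : mulSeq (fun k => ∑ i ∈ S, r i k) u = ∑ i ∈ S, mulSeq (r i) u := by
    ext k
    rw [AddMonoidAlgebra.coeff_sum, Finsupp.finsetSum_apply]
    simp only [coeff_mulSeq, Finset.sum_mul]
  rw [h1]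
  exact Ideal.sum_mem _ fun i hi => h i hi n u hu

/-- An affine sequence acts as a derivation up to lower order terms, so by the Leibniz rule it
lowers the order of vanishing by at most one. -/
lemma lowersBy_affine {r r₀ : IntLattice d → ℂ} (h : ∀ k l, r (k + l) = r k + r₀ l)
    (h₀ : ∀ k l, r₀ (k + l) = r₀ k + r₀ l) : LowersBy 1 r := by
  intro n
  induction n generalizing r with
  | zero => intro u _; simp
  | succ n ih =>
    intro u hu
    rw [pow_succ'] at hu
    refine Submodule.mul_induction_on hu (fun x hx y hy => ?_) (fun x y hx hy => ?_)
    · rw [mulSeq_mul h]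
      refine Ideal.add_mem _ (Ideal.mul_mem_left _ _ hy) ?_
      rw [pow_succ']
      exact Ideal.mul_mem_mul hx (ih h₀ y hy)
    · rw [mulSeq_add]
      exact Ideal.add_mem _ hx hy

/-- A polynomial of degree at most `e` along a lattice lowers the order of vanishing by at
most `e`. -/
lemma lowersBy_eval {e : ℕ} (p : MvPolynomial (Fin d) ℂ) (hp : p.totalDegree ≤ e)
    {r r₀ : Fin d → IntLattice d → ℂ} (h : ∀ i k l, r i (k + l) = r i k + r₀ i l)
    (h₀ : ∀ i k l, r₀ i (k + l) = r₀ i k + r₀ i l) :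
    LowersBy e fun k => MvPolynomial.eval (fun i => r i k) p := by
  simp only [MvPolynomial.eval_eq]
  refine lowersBy_sum _ fun s hs => ?_
  have h1 := (lowersBy_const (d := d) (p.coeff s)).mul
    (lowersBy_prod s.support fun i => (lowersBy_affine (h i) (h₀ i)).pow (s i))
  refine h1.mono ?_
  simp only [mul_one, zero_add]
  exact (MvPolynomial.le_totalDegree hs).trans hp

lemma continuous_eval_mvPolynomial (p : MvPolynomial (Fin d) ℂ) :
    Continuous fun x : RSpace d => MvPolynomial.eval (fun i => (x i : ℂ)) p :=
  p.continuous_eval.comp (by fun_prop)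

lemma ofReal_actInv_add_apply (x y : RSpace d) (i : Fin d) :
    ((actInv M (x + y) i : ℝ) : ℂ) = (actInv M x i : ℂ) + (actInv M y i : ℂ) := by
  rw [actInv_add]; simp

/-- A high-pass filter vanishing to order `m` at the origin produces `m` vanishing moments. -/
lemma integral_eval_mul_upsynthFun (hdet : M.det ≠ 0) {m : ℕ} {b : Laurent d}
    (hb : b ∈ augIdeal d ^ m) {φ : RSpace d → ℂ} (hφ : Integrable φ) (hφc : HasCompactSupport φ)
    (p : MvPolynomial (Fin d) ℂ) (hp : p.totalDegree < m) :
    ∫ x : RSpace d, MvPolynomial.eval (fun i => (x i : ℂ)) p * upsynthFun M b φ x = 0 := by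
  rw [integral_mul_upsynthFun hdet b hφ hφc (continuous_eval_mvPolynomial p)]
  refine integral_eq_zero_of_ae (ae_of_all _ fun y => ?_)
  have h1 : LowersBy (d := d) (m - 1) fun k =>
      MvPolynomial.eval (fun i => ((actInv M (y + latticeVec k) i : ℝ) : ℂ)) p := by
    refine lowersBy_eval p (by omega)
      (r := fun i k => ((actInv M (y + latticeVec k) i : ℝ) : ℂ))
      (r₀ := fun i k => ((actInv M (latticeVec k) i : ℝ) : ℂ)) (fun i k l => ?_) fun i k l => ?_
    · rw [latticeVec_add, ← add_assoc, ofReal_actInv_add_apply]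
    · rw [latticeVec_add, ofReal_actInv_add_apply]
  have h2 := h1 1 b (by rwa [show 1 + (m - 1) = m by omega])
  rw [pow_one, mem_augIdeal, ev_zero_mulSeq] at h2
  simp only [h2, zero_mul, Pi.zero_apply]

/-- The binomial expansion of `(z_i - 1)^m`. -/
lemma augGen_pow (i : Fin d) (m : ℕ) : (augGen i : Laurent d) ^ m = ∑ k ∈ Finset.range (m + 1),
    AddMonoidAlgebra.single (Pi.single i (k : ℤ)) ((((-1 : ℤ) ^ (m - k) * m.choose k : ℤ)) : ℂ) := by
  rw [augGen, sub_eq_add_neg, add_pow]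
  refine Finset.sum_congr rfl fun k _ => ?_
  have h1 : ((-1 : Laurent d) ^ (m - k) * (m.choose k : Laurent d))
      = AddMonoidAlgebra.single 0 ((((-1 : ℤ) ^ (m - k) * m.choose k : ℤ)) : ℂ) := by
    have : (AddMonoidAlgebra.single 0 ((((-1 : ℤ) ^ (m - k) * m.choose k : ℤ)) : ℂ) : Laurent d)
        = algebraMap ℂ (Laurent d) ((((-1 : ℤ) ^ (m - k) * m.choose k : ℤ)) : ℂ) := rfl
    rw [this, map_intCast]
    push_cast
    ring
  rw [mul_assoc, h1, AddMonoidAlgebra.single_pow, AddMonoidAlgebra.single_mul_single, one_pow,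
    one_mul, add_zero]
  congr 1
  rw [← Pi.single_smul]
  simp

/-- The `m`-th difference of a monomial of degree `m`. -/
lemma sum_augGen_pow (i : Fin d) (m : ℕ) (y : ℂ) :
    ∑ k ∈ ((augGen i : Laurent d) ^ m).coeff.support,
      ((augGen i : Laurent d) ^ m).coeff k * (y + k i) ^ m = (m.factorial : ℂ) := by
  have hs : ∀ (S : Finset ℕ) (u : ℕ → Laurent d), mulSeq (fun k => (y + k i) ^ m) (∑ j ∈ S, u j)
      = ∑ j ∈ S, mulSeq (fun k => (y + k i) ^ m) (u j) := fun S u =>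
    map_sum (⟨⟨_, mulSeq_zero _⟩, mulSeq_add (fun k => (y + k i) ^ m)⟩ : Laurent d →+ Laurent d) u S
  rw [← ev_zero_mulSeq (fun k => (y + k i) ^ m), augGen_pow, hs, map_sum]
  have h1 := congrFun (fwdDiff_iter_eq_factorial (R := ℂ) (n := m)) y
  rw [fwdDiff_iter_eq_sum_shift] at h1
  refine Eq.trans (Finset.sum_congr rfl fun k _ => ?_) h1
  rw [mulSeq_single, ev_single, expChar_apply]
  simp
  ring

/-- The moment against `(M x)_i ^ m` that keeps `(z_i - 1)^m` from producing `m + 1` vanishing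
moments. -/
lemma integral_eval_mul_upsynthFun_augGen (hdet : M.det ≠ 0) (i : Fin d) (m : ℕ)
    {φ : RSpace d → ℂ} (hφ : Integrable φ) (hφc : HasCompactSupport φ) :
    ∫ x : RSpace d, MvPolynomial.eval (fun i => (x i : ℂ))
      ((∑ j, MvPolynomial.C ((M i j : ℤ) : ℂ) * MvPolynomial.X j) ^ m)
        * upsynthFun M (augGen i ^ m) φ x = m.factorial * ∫ x, φ x := by
  rw [integral_mul_upsynthFun hdet _ hφ hφc (continuous_eval_mvPolynomial _), ← integral_const_mul]
  refine integral_congr_ae (ae_of_all _ fun y => ?_)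
  simp only
  congr 1
  rw [← sum_augGen_pow i m (y i : ℂ)]
  refine Finset.sum_congr rfl fun k _ => ?_
  congr 1
  simp only [map_pow, map_sum, map_mul, MvPolynomial.eval_C, MvPolynomial.eval_X]
  congr 1
  have h1 := congrArg (fun z : RSpace d => ((z i : ℝ) : ℂ)) (act_actInv hdet (y + latticeVec k))
  simp only [act, Matrix.mulVec, dotProduct, Matrix.map_apply] at h1
  push_cast at h1
  rw [h1]
  simp [latticeVec]

lemma totalDegree_linear_pow_le (c : Fin d → ℂ) (m : ℕ) :
    ((∑ j, MvPolynomial.C (c j) * MvPolynomial.X j : MvPolynomial (Fin d) ℂ) ^ m).totalDegree ≤ m := by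
  refine (MvPolynomial.totalDegree_pow _ _).trans ?_
  have h1 : (∑ j, MvPolynomial.C (c j) * MvPolynomial.X j : MvPolynomial (Fin d) ℂ).totalDegree ≤ 1 := by
    refine MvPolynomial.totalDegree_finsetSum_le fun j _ => ?_
    refine (MvPolynomial.totalDegree_mul _ _).trans ?_
    rw [MvPolynomial.totalDegree_C, MvPolynomial.totalDegree_X]
  nlinarith

lemma vmoEq_upsynthFun (hdet : M.det ≠ 0) (i : Fin d) {s m : ℕ} {b : Fin s → Laurent d}
    (hb : ∀ l, b l ∈ augIdeal d ^ m) (hex : ∃ l, b l = augGen i ^ m) {φ : RSpace d → ℂ}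
    (hφ : Integrable φ) (hφc : HasCompactSupport φ) (h0 : ∫ x, φ x ≠ 0) :
    VmoEq (fun l => upsynthFun M (b l) φ) m := by
  refine ⟨fun p hp l => integral_eval_mul_upsynthFun hdet (hb l) hφ hφc p hp, fun n hn => ?_⟩
  by_contra hcon
  obtain ⟨l, hl⟩ := hex
  have h1 := hn _ ((totalDegree_linear_pow_le (fun j => ((M i j : ℤ) : ℂ)) m).trans_lt
    (not_le.1 hcon)) l
  simp only [hl] at h1
  rw [integral_eval_mul_upsynthFun_augGen hdet i m hφ hφc] at h1
  exact mul_ne_zero (by exact_mod_cast m.factorial_ne_zero) h0 h1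

end moments

/-! ### From vectors of `L²` to functions -/

section assembly
variable {d s : ℕ} {M : Matrix (Fin d) (Fin d) ℤ}

lemma sqrt_abs_det_pow (j : ℕ) :
    √|((M ^ j).det : ℝ)| = (M.det.natAbs : ℝ) ^ ((j : ℝ) / 2) := by
  have h1 : |((M ^ j).det : ℝ)| = (M.det.natAbs : ℝ) ^ j := by
    rw [Matrix.det_pow, Int.cast_pow, abs_pow, ← Int.cast_abs, Int.abs_eq_natAbs, Int.cast_natCast]
  rw [h1, Real.sqrt_eq_rpow, ← Real.rpow_natCast, ← Real.rpow_mul (Nat.cast_nonneg _)]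
  ring_nf

/-- The classes in `L²` of the elements of the framelet system are the vectors `frameletL2`. -/
lemma exists_toLp_frameletSystem (hdet : M.det ≠ 0) {η : RSpace d → ℂ} {ψ : Fin s → RSpace d → ℂ}
    (hη : MemLp η 2 volume) (hψ : ∀ l, MemLp (ψ l) 2 volume) (i : SystemIndex d s) :
    ∃ h : MemLp (frameletSystem M η ψ i) 2 volume,
      h.toLp _ = frameletL2 hdet (hη.toLp η) (fun l => (hψ l).toLp (ψ l)) i := by
  rcases i with k | ⟨j, k, l⟩
  · exact ⟨memLp_trans hη _, rfl⟩
  · have h1 : frameletSystem M η ψ (Sum.inr (j, k, l))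
        = dilFun (M ^ j) (fun x => ψ l (x - latticeVec k)) := by
      funext x
      simp only [frameletSystem, dilFun, sqrt_abs_det_pow]
    rw [h1]
    refine ⟨memLp_dilFun (det_pow_ne_zero hdet j) (memLp_trans (hψ l) _), ?_⟩
    rw [frameletL2, wav, transL_toLp, dil_toLp]

lemma isFramelet_of_bounds (hdet : M.det ≠ 0) {η : RSpace d → ℂ} {ψ : Fin s → RSpace d → ℂ}
    (hη : MemLp η 2 volume) (hψ : ∀ l, MemLp (ψ l) 2 volume) {B B' : ℝ} (hB0 : 0 ≤ B)
    (hB0' : 0 ≤ B') (hB : IsBessel (frameletL2 hdet (hη.toLp η) fun l => (hψ l).toLp (ψ l)) B)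
    (hB' : ∀ f, ‖f‖ ^ 2 ≤ B' * ∑' i,
      ‖inner ℂ (frameletL2 hdet (hη.toLp η) (fun l => (hψ l).toLp (ψ l)) i) f‖ ^ 2) :
    IsFramelet M η ψ := by
  -- `B + 1` and `B' + 1` are used because the frame constants have to be positive
  refine ⟨hη, hψ, (B' + 1)⁻¹, B + 1, by positivity, by positivity, fun f hf => ?_⟩
  set F := hf.toLp f
  set g := frameletL2 hdet (hη.toLp η) fun l => (hψ l).toLp (ψ l)
  have h1 : ∀ i, pairing f (frameletSystem M η ψ i) = inner ℂ (g i) F := by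
    intro i
    obtain ⟨h, hi⟩ := exists_toLp_frameletSystem hdet hη hψ i
    rw [← inner_toLp hf h, hi]
  have h2 : eLpNorm f 2 volume ^ 2 = ENNReal.ofReal (‖F‖ ^ 2) := by
    rw [ENNReal.ofReal_pow (norm_nonneg _), Lp.norm_toLp, ENNReal.ofReal_toReal hf.2.ne]
  have h3 : ∑' i, ‖pairing f (frameletSystem M η ψ i)‖ₑ ^ 2
      = ENNReal.ofReal (∑' i, ‖inner ℂ (g i) F‖ ^ 2) := by
    rw [ENNReal.ofReal_tsum_of_nonneg (fun i => sq_nonneg _) (hB.summable F)]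
    refine tsum_congr fun i => ?_
    rw [h1, ENNReal.ofReal_pow (norm_nonneg _), ofReal_norm]
  have h4 : 0 ≤ ∑' i, ‖inner ℂ (g i) F‖ ^ 2 := tsum_nonneg fun _ => sq_nonneg _
  rw [h2, h3, ← ENNReal.ofReal_mul (by positivity), ← ENNReal.ofReal_mul (by positivity)]
  constructor
  · refine ENNReal.ofReal_le_ofReal ?_
    rw [inv_mul_le_iff₀ (by positivity)]
    linarith [hB' F]
  · exact ENNReal.ofReal_le_ofReal ((hB.tsum_le F).trans (by gcongr; linarith))

lemma tendsto_of_hasSum (hdet : M.det ≠ 0) {η η' : RSpace d → ℂ} {ψ ψ' : Fin s → RSpace d → ℂ}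
    (hη : MemLp η 2 volume) (hψ : ∀ l, MemLp (ψ l) 2 volume)
    (hη' : MemLp η' 2 volume) (hψ' : ∀ l, MemLp (ψ' l) 2 volume)
    {f : RSpace d → ℂ} (hf : MemLp f 2 volume)
    (h : HasSum (fun i => inner ℂ (frameletL2 hdet (hη.toLp η) (fun l => (hψ l).toLp (ψ l)) i)
      (hf.toLp f) • frameletL2 hdet (hη'.toLp η') (fun l => (hψ' l).toLp (ψ' l)) i) (hf.toLp f)) :
    Tendsto (fun F : Finset (SystemIndex d s) => eLpNorm (fun x => f x - ∑ i ∈ F,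
      pairing f (frameletSystem M η ψ i) * frameletSystem M η' ψ' i x) 2 volume) atTop (𝓝 0) := by
  have h1 : Tendsto (fun F : Finset (SystemIndex d s) => ‖hf.toLp f - ∑ i ∈ F,
      inner ℂ (frameletL2 hdet (hη.toLp η) (fun l => (hψ l).toLp (ψ l)) i) (hf.toLp f)
        • frameletL2 hdet (hη'.toLp η') (fun l => (hψ' l).toLp (ψ' l)) i‖ₑ) atTop (𝓝 0) := by
    have h2 := (tendsto_const_nhds (x := hf.toLp f)).sub h
    rw [sub_self] at h2
    simpa [Function.comp_def] using (continuous_enorm.tendsto (0 : L2Space d)).comp h2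
  refine h1.congr fun F => ?_
  rw [Lp.enorm_def]
  refine eLpNorm_congr_ae ?_
  have h3 : ∀ i ∈ F, ∀ᵐ x, (inner ℂ (frameletL2 hdet (hη.toLp η) (fun l => (hψ l).toLp (ψ l)) i)
      (hf.toLp f) • frameletL2 hdet (hη'.toLp η') (fun l => (hψ' l).toLp (ψ' l)) i : L2Space d) x
      = pairing f (frameletSystem M η ψ i) * frameletSystem M η' ψ' i x := by
    intro i _
    obtain ⟨h4, h5⟩ := exists_toLp_frameletSystem hdet hη hψ i
    obtain ⟨h6, h7⟩ := exists_toLp_frameletSystem hdet hη' hψ' i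
    rw [← h5, ← h7, inner_toLp, ← MemLp.toLp_const_smul]
    exact (MemLp.coeFn_toLp _).trans (Eventually.of_forall fun x => rfl)
  filter_upwards [Lp.coeFn_sub (hf.toLp f) (∑ i ∈ F,
      inner ℂ (frameletL2 hdet (hη.toLp η) (fun l => (hψ l).toLp (ψ l)) i) (hf.toLp f)
        • frameletL2 hdet (hη'.toLp η') (fun l => (hψ' l).toLp (ψ' l)) i),
    Lp.coeFn_fun_finsetSum F (fun i =>
      inner ℂ (frameletL2 hdet (hη.toLp η) (fun l => (hψ l).toLp (ψ l)) i) (hf.toLp f)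
        • frameletL2 hdet (hη'.toLp η') (fun l => (hψ' l).toLp (ψ' l)) i),
    hf.coeFn_toLp, (ae_ball_iff (Finset.countable_toSet F)).2 h3] with x h4 h5 h6 h7
  rw [h4, Pi.sub_apply, h5, h6]
  exact congrArg (f x - ·) (Finset.sum_congr rfl h7)

/-- The mixed oblique extension principle: a filter bank built from refinable functions whose
high-pass filters vanish at the origin generates a dual framelet. -/
lemma isDualFramelet_upsynthFun (hM : IsDilation M) (hdet : M.det ≠ 0) {a a' θ θ' : Laurent d}
    {b b' : Fin s → Laurent d}
    (hbank : ∀ ω ∈ Omega M, adj a * up M (adj θ * θ') * modul ((2 * Real.pi) • ω) a'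
        + ∑ l, adj (b l) * modul ((2 * Real.pi) • ω) (b' l)
      = (open Classical in if ω = 0 then (1 : ℂ) else 0) • (adj θ * θ'))
    (hb : ∀ l, ev 0 (b l) = 0) (hb' : ∀ l, ev 0 (b' l) = 0) {φ φ' : RSpace d → ℂ}
    (hφ : MemLp φ 2 volume) (hφc : HasCompactSupport φ)
    (hφ' : MemLp φ' 2 volume) (hφc' : HasCompactSupport φ')
    (href : ∀ ξ, fnHat φ (act Mᵀ ξ) = ev ξ a * fnHat φ ξ)
    (href' : ∀ ξ, fnHat φ' (act Mᵀ ξ) = ev ξ a' * fnHat φ' ξ)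
    (hone : ev 0 θ * fnHat φ 0 = 1) (hone' : ev 0 θ' * fnHat φ' 0 = 1) :
    IsDualFramelet M (lcombFun θ φ) (fun l => upsynthFun M (b l) φ)
      (lcombFun θ' φ') (fun l => upsynthFun M (b' l) φ') := by
  have hr := toLp_eq_upsynth hdet a hφ hφc href
  have hr' := toLp_eq_upsynth hdet a' hφ' hφc' href'
  have hη := memLp_lcombFun θ hφ
  have hη' := memLp_lcombFun θ' hφ'
  have hηc := hasCompactSupport_lcombFun θ hφc
  have hηc' := hasCompactSupport_lcombFun θ' hφc'
  have hψ := fun l => memLp_upsynthFun hdet (b l) hφ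
  have hψ' := fun l => memLp_upsynthFun hdet (b' l) hφ'
  obtain ⟨R, -, hR⟩ := exists_suppIn hφ hφc
  obtain ⟨R', -, hR'⟩ := exists_suppIn hφ' hφc'
  obtain ⟨r, -, hsr⟩ := exists_suppIn hη hηc
  obtain ⟨r', -, hsr'⟩ := exists_suppIn hη' hηc'
  obtain ⟨B, hB0, hB⟩ := exists_isBessel_frameletL2 hM hdet hR hsr hr hb fun l => by
    obtain ⟨q, -, hq⟩ := exists_suppIn (hψ l) (hasCompactSupport_upsynthFun hdet (b l) hφc)
    exact ⟨q, by rwa [← toLp_upsynthFun hdet]⟩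
  obtain ⟨B', hB0', hB'⟩ := exists_isBessel_frameletL2 hM hdet hR' hsr' hr' hb' fun l => by
    obtain ⟨q, -, hq⟩ := exists_suppIn (hψ' l) (hasCompactSupport_upsynthFun hdet (b' l) hφc')
    exact ⟨q, by rwa [← toLp_upsynthFun hdet]⟩
  have hconst : conj (∫ x, lcombFun θ φ x) * ∫ x, lcombFun θ' φ' x = 1 := by
    rw [← fnHat_zero, ← fnHat_zero, fnHat_lcombFun θ (integrable_of_memLp hφ hφc) hφc,
      fnHat_lcombFun θ' (integrable_of_memLp hφ' hφc') hφc', hone, hone', map_one, one_mul]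
  have hsum := hB.hasSum_of_dense hB' hB0 hB0' dense_continuous_compactSupport (by
    rintro _ ⟨f, hf2, hf, hfc, rfl⟩ _ ⟨g, hg2, hg, hgc, rfl⟩
    exact tsum_frameletL2 hM hdet hbank hr hr' hR hR' hη hη' (integrable_of_memLp hη hηc)
      (integrable_of_memLp hη' hηc') hηc (toLp_lcombFun θ hφ) (toLp_lcombFun θ' hφ') hconst hB hB'
      hf hfc hf2 hg hgc hg2)
  simp only [← toLp_upsynthFun hdet (b _) hφ] at hB hsum
  simp only [← toLp_upsynthFun hdet (b' _) hφ'] at hB' hsum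
  refine ⟨isFramelet_of_bounds hdet hη hψ hB0 hB0' hB fun f => (hB.lower_bound hB' (hsum f)).1,
    isFramelet_of_bounds hdet hη' hψ' hB0' hB0 hB' fun f => (hB.lower_bound hB' (hsum f)).2,
    fun f hf => tendsto_of_hasSum hdet hη hψ hη' hψ' hf (hsum _)⟩

lemma areOEPGenerators (hdet : M.det ≠ 0) (θ : Laurent d) (b : Fin s → Laurent d) {φ : RSpace d → ℂ}
    (hφ : MemLp φ 2 volume) (hφc : HasCompactSupport φ) :
    AreOEPGenerators M φ θ.coeff (fun l => (b l).coeff) (lcombFun θ φ)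
      fun l => upsynthFun M (b l) φ := by
  have hi := integrable_of_memLp hφ hφc
  refine ⟨memLp_lcombFun θ hφ, hasCompactSupport_lcombFun θ hφc,
    fun l => ⟨memLp_upsynthFun hdet (b l) hφ, hasCompactSupport_upsynthFun hdet (b l) hφc⟩,
    fun ξ => ?_, fun l ξ => ?_⟩
  · rw [fnHat_lcombFun θ hi hφc, maskHat_eq_ev]
  · conv_lhs => rw [← act_actInvTranspose hdet ξ]
    rw [fnHat_upsynthFun hdet (b l) hi hφc, maskHat_eq_ev]

lemma isDualFrameletFilterBank_of_laurent {a a' : Mask d} {θ θ' : Laurent d}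
    {b b' : Fin s → Laurent d}
    (hbank : ∀ ω ∈ Omega M, adj (AddMonoidAlgebra.ofCoeff a) * up M (adj θ * θ')
        * modul ((2 * Real.pi) • ω) (AddMonoidAlgebra.ofCoeff a')
        + ∑ l, adj (b l) * modul ((2 * Real.pi) • ω) (b' l)
      = (open Classical in if ω = 0 then (1 : ℂ) else 0) • (adj θ * θ')) :
    IsDualFrameletFilterBank M a (fun l => (b l).coeff) a' (fun l => (b' l).coeff)
      (maskConv (maskStar θ.coeff) θ'.coeff) := by
  intro ξ ω hω
  have h := congrArg (ev ξ) (hbank ω hω)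
  simp only [map_add, map_mul, map_sum, map_smul, ev_adj, ev_up, ev_modul, smul_eq_mul] at h
  simp only [maskHat_eq_ev, ofCoeff_maskConv, ofCoeff_maskStar, AddMonoidAlgebra.ofCoeff_coeff,
    map_mul, ev_adj]
  exact h

lemma eq_one_of_isBigO {n : ℕ} (hn : n ≠ 0) {f : RSpace d → ℂ}
    (h : (fun ξ => f ξ - 1) =O[𝓝 0] fun ξ => ‖ξ‖ ^ n) : f 0 = 1 := by
  obtain ⟨c, hc⟩ := h.bound
  have h1 := hc.self_of_nhds
  simp only [norm_zero, zero_pow hn, mul_zero] at h1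
  exact sub_eq_zero.1 (norm_le_zero_iff.1 h1)

end assembly

end OEPFramelet

end

open OEPFramelet
theorem corollary3p3 (d : ℕ) (hd : 1 ≤ d)
    (M : Matrix (Fin d) (Fin d) ℤ) (hM : IsDilation M)
    (φ φ' : RSpace d → ℂ)
    (hφ : MemLp φ 2 volume) (hφc : HasCompactSupport φ)
    (hφ' : MemLp φ' 2 volume) (hφc' : HasCompactSupport φ')
    (a a' : Mask d)
    (href : ∀ ξ, fnHat φ (act Mᵀ ξ) = maskHat a ξ * fnHat φ ξ)
    (href' : ∀ ξ, fnHat φ' (act Mᵀ ξ) = maskHat a' ξ * fnHat φ' ξ)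
    (m m' : ℕ) (hm : 1 ≤ m) (hm' : 1 ≤ m')
    (v v' : Mask d)
    (hsr : HasSumRules M a m' v) (hsr' : HasSumRules M a' m v')
    (hv : maskHat v 0 * fnHat φ 0 = 1) (hv' : maskHat v' 0 * fnHat φ' 0 = 1) :
    ∃ (s : ℕ) (b b' : Fin s → Mask d) (θ θ' : Mask d),
      IsDualFrameletFilterBank M a b a' b' (maskConv (maskStar θ) θ') ∧
      ∃ (η η' : RSpace d → ℂ) (ψ ψ' : Fin s → RSpace d → ℂ),
        AreOEPGenerators M φ θ b η ψ ∧
        AreOEPGenerators M φ' θ' b' η' ψ' ∧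
        IsDualFramelet M η ψ η' ψ' ∧
        VmoEq ψ m ∧ VmoEq ψ' m' := by
  have hdet := det_ne_zero_of_isDilation hM
  have hi := integrable_of_memLp hφ hφc
  have hi' := integrable_of_memLp hφ' hφc'
  have h0 : fnHat φ 0 ≠ 0 := right_ne_zero_of_mul_eq_one hv
  have h0' : fnHat φ' 0 ≠ 0 := right_ne_zero_of_mul_eq_one hv'
  simp only [maskHat_eq_ev] at href href'
  have hn : m + m' ≠ 0 := by omega
  obtain ⟨θ, hθ⟩ := (isTrigJet_fnHat hi hφc (m + m')).exists_inverse hn h0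
  obtain ⟨θ', hθ'⟩ := (isTrigJet_fnHat hi' hφc' (m + m')).exists_inverse hn h0'
  let i₀ : Fin d := ⟨0, hd⟩
  -- the sum rules of `a` control the dual high-pass filters and conversely; `augGen i₀ ^ m` and
  -- `augGen i₀ ^ m'` are adjoined so that the vanishing moments do not exceed `m` and `m'`
  obtain ⟨s, b, b', hb, hb', hex, hex', hbank⟩ := exists_highpass hdet
    (modul_mem_of_hasSumRules hsr) (modul_mem_of_hasSumRules hsr')
    (sub_mem_augIdeal_pow (continuous_fnHat hi).continuousAt (continuous_fnHat hi').continuousAt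
      h0 h0' href href' hθ hθ')
    (Ideal.pow_mem_pow (augGen_mem i₀) m) (Ideal.pow_mem_pow (augGen_mem i₀) m')
  have hone : ∀ (n : ℕ), 1 ≤ n → ∀ u : Laurent d, u ∈ augIdeal d ^ n → ev 0 u = 0 :=
    fun n hn u hu => mem_augIdeal.1 (Ideal.pow_le_self (by omega) hu)
  refine ⟨s, fun l => (b l).coeff, fun l => (b' l).coeff, θ.coeff, θ'.coeff,
    isDualFrameletFilterBank_of_laurent hbank, lcombFun θ φ, lcombFun θ' φ',
    fun l => upsynthFun M (b l) φ, fun l => upsynthFun M (b' l) φ',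
    areOEPGenerators hdet θ b hφ hφc, areOEPGenerators hdet θ' b' hφ' hφc',
    isDualFramelet_upsynthFun hM hdet hbank (fun l => hone m hm _ (hb l))
      (fun l => hone m' hm' _ (hb' l)) hφ hφc hφ' hφc' href href'
      (eq_one_of_isBigO hn hθ) (eq_one_of_isBigO hn hθ'),
    vmoEq_upsynthFun hdet i₀ hb hex hi hφc (by rwa [← fnHat_zero]),
    vmoEq_upsynthFun hdet i₀ hb' hex' hi' hφc' (by rwa [← fnHat_zero])⟩
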